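/- Let $0<a<c\le b$ be real numbers. For $\mathbf n=(n_1,n_2,n_3)\in\mathbb N^3$ (positive integers) put $P_{\mathbf n}=n_1n_2n_3$, $L_{\mathbf a}(\mathbf n)=n_1^{-a}n_2^{b}n_3^{c}$ and $N_{\mathbf n}=2\pi\max(n_1^2/a,\,n_2^2/b,\,n_3^2/c)$, and write $e(x)=e^{2\pi i x}$. Let $I_{\mathbf a}=\frac1a-\frac1b-\frac1c$, $A(x,t)=(abc)^{1/2}(t/2\pi)^{3/2}/x$ and $F_1(z,t)=e^{z^2/t-iI_{\mathbf a}z^2/(4t)}$. Let $c_1(u,v)\in\mathbb C$ be arbitrary fixed coefficients (for instance those occurring in the approximate functional equation for $\zeta(\tfrac12+iat)\zeta(\tfrac12-ibt)\zeta(\tfrac12-ict)$), indexed by the finitely many pairs of integers $(u,v)$ with $1\le v\le 16$, $1\le u\le 3v/2$, and $v\ge 2$ whenever $u\ge v+1$. For $x,t>0$ define $$W_1(x,t)=\frac1{2\pi i}\int_{1-i\infty}^{1+i\infty}A(x,t)^zF_1(z,t)\Big(1+\sum_{u,v}c_1(u,v)z^ut^{-v}\Big)\frac{dz}{z},$$ and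 for $T\ge 1$ let $$I_{1,2}(T)=\sum_{n_1^a\ne n_2^bn_3^c}P_{\mathbf n}^{-1/2}\int_1^T L_{\mathbf a}(\mathbf n)^{it}\,W_1(P_{\mathbf n},t)\,dt .$$ Further let $$M_1(T)=\frac{2\pi}{a}\sum_{\mathbf n}n_2^{\frac b{2a}-\frac12}n_3^{\frac c{2a}-\frac12}\,e\big(n_1n_2^{b/a}n_3^{c/a}\big),$$ the sum running over the $\mathbf n\in\mathbb N^3$ for which $n_2^{b/a}n_3^{c/a}$ is not an integer and $N_{\mathbf n}\le\frac{2\pi}a n_1n_2^{b/a}n_3^{c/a}\le T$. Let $N_1=N_1(n_2,n_3)$ be the integer nearest to $n_2^{b/a}n_3^{c/a}$ (half-integers being rounded up), let $L(n_2,n_3)=\log(n_2^bn_3^c/N_1^a)$, and let $$J_{2,2}(T)=\sum_{\substack{N_{\mathbf n}\le T,\ n_1=N_1\\ n_1^a\neq n_2^bn_3^c}}P_{\mathbf n}^{-1/2}\int_{N_{\mathbf n}}^{T}e^{itL(n_2,n_3)}\,dt .$$ Then the integrals and the series defining $I_{1,2}(T)$ converge absolutely, and there is a constant $C$, depending only on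 $a,b,c$ and the coefficients $c_1(u,v)$, such that for all $T\ge 2$ $$\big|M_1(T)+J_{2,2}(T)-I_{1,2}(T)\big|\le C\Big(T^{\frac14+\frac{3a}{2(a+c)}}\log T+T^{\frac54-\frac c{4a}}+T^{\frac12+\frac a{2c}}\log T+T^{\frac34}(\log T)^3\Big).$$ -/

import Mathlib

namespace OffDiag

/-- Triples `𝐧 = (n₁, n₂, n₃)` of positive integers. -/
abbrev Triple : Type := ℕ+ × ℕ+ × ℕ+

/-- `e(x) = exp(2πix)`. -/
noncomputable def e (x : ℝ) : ℂ := Complex.exp (2 * Real.pi * Complex.I * x)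

/-- `P_𝐧 = n₁ n₂ n₃`. -/
noncomputable def P (n : Triple) : ℝ := (n.1 : ℝ) * (n.2.1 : ℝ) * (n.2.2 : ℝ)

/-- `L_𝐚(𝐧) = n₁^{-a} n₂^{b} n₃^{c}`, for `𝐚 = (a, -b, -c)`. -/
noncomputable def La (a b c : ℝ) (n : Triple) : ℝ :=
  (n.1 : ℝ) ^ (-a) * (n.2.1 : ℝ) ^ b * (n.2.2 : ℝ) ^ c

/-- `I_𝐚 = ∑ 1 / a_l`, for `𝐚 = (a, -b, -c)`. -/
noncomputable def Ia (a b c : ℝ) : ℝ := 1 / a + 1 / (-b) + 1 / (-c)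

/-- `Q_𝐚 = ∏ a_l`, for `𝐚 = (a, -b, -c)`. -/
noncomputable def Qa (a b c : ℝ) : ℝ := a * (-b) * (-c)

/-- `A(x,t) = Q_𝐚^{1/2} (t/2π)^{3/2} / x`. -/
noncomputable def A (a b c x t : ℝ) : ℝ :=
  (Qa a b c) ^ (1 / 2 : ℝ) * (t / (2 * Real.pi)) ^ (3 / 2 : ℝ) / x

/-- `F₁(z,t) = exp(z²/t - i I_𝐚 z²/(4t))`. -/
noncomputable def F1 (a b c : ℝ) (z : ℂ) (t : ℝ) : ℂ :=
  Complex.exp (z ^ 2 / t - Complex.I * (Ia a b c) * z ^ 2 / (4 * t))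

/-- The index set of the lower order terms of the approximate functional equation of a product of
`k = 3` zeta functions: pairs `(u, v)` with `1 ≤ u ≤ 3v/2`, `1 ≤ v ≤ 2(k + 5) = 16`, and
`v ≥ 2` whenever `u ≥ v + 1`. -/
def uvRange : Finset (ℕ × ℕ) :=
  (Finset.Icc 1 24 ×ˢ Finset.Icc 1 16).filter
    (fun p => 2 * p.1 ≤ 3 * p.2 ∧ (p.2 + 1 ≤ p.1 → 2 ≤ p.2))

/-- The integrand `A(x,t)^z F₁(z,t) (1 + ∑ c₁(u,v) z^u t^{-v}) / z` of `W₁`, the coefficients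
`c₁(u,v)` being `coef u v`. -/
noncomputable def W1Integrand (a b c : ℝ) (coef : ℕ → ℕ → ℂ) (x t : ℝ) (z : ℂ) : ℂ :=
  (A a b c x t : ℂ) ^ z * F1 a b c z t *
    (1 + ∑ p ∈ uvRange, coef p.1 p.2 * z ^ p.1 * ((t : ℂ) ^ p.2)⁻¹) / z

/-- `W₁(x,t) = (2πi)⁻¹ ∫_{1-i∞}^{1+i∞} A(x,t)^z F₁(z,t) (1 + ∑ c₁(u,v) z^u t^{-v}) dz/z`;
on the line `z = 1 + iy` one has `dz = i dy`. -/
noncomputable def W1 (a b c : ℝ) (coef : ℕ → ℕ → ℂ) (x t : ℝ) : ℂ :=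
  (1 / (2 * Real.pi) : ℂ) * ∫ y : ℝ, W1Integrand a b c coef x t (1 + y * Complex.I)

/-- The off-diagonal triples: `n₁^a ≠ n₂^b n₃^c`. -/
def offDiagonal (a b c : ℝ) : Set Triple :=
  {n | (n.1 : ℝ) ^ a ≠ (n.2.1 : ℝ) ^ b * (n.2.2 : ℝ) ^ c}

/-- The integrand `L_𝐚(𝐧)^{it} W₁(P_𝐧, t)`. -/
noncomputable def I12Integrand (a b c : ℝ) (coef : ℕ → ℕ → ℂ) (n : Triple) (t : ℝ) : ℂ :=
  (La a b c n : ℂ) ^ (Complex.I * t) * W1 a b c coef (P n) t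

/-- The summand `P_𝐧^{-1/2} ∫_1^T L_𝐚(𝐧)^{it} W₁(P_𝐧, t) dt`. -/
noncomputable def I12Term (a b c : ℝ) (coef : ℕ → ℕ → ℂ) (T : ℝ) (n : Triple) : ℂ :=
  ((P n) ^ (-(1 / 2) : ℝ) : ℝ) * ∫ t in (1 : ℝ)..T, I12Integrand a b c coef n t

/-- `I_{1,2}(T)`, the off-diagonal part of the integral over `[1, T]` of the first term of the
approximate functional equation. -/
noncomputable def I12 (a b c : ℝ) (coef : ℕ → ℕ → ℂ) (T : ℝ) : ℂ :=
  ∑' n : offDiagonal a b c, I12Term a b c coef T n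

/-- `N_𝐧 = 2π max(n₁²/a, n₂²/b, n₃²/c)`. -/
noncomputable def Nn (a b c : ℝ) (n : Triple) : ℝ :=
  2 * Real.pi * max ((n.1 : ℝ) ^ 2 / a) (max ((n.2.1 : ℝ) ^ 2 / b) ((n.2.2 : ℝ) ^ 2 / c))

/-- `n₂^{b/a} n₃^{c/a}`. -/
noncomputable def X (a b c : ℝ) (n₂ n₃ : ℕ+) : ℝ := (n₂ : ℝ) ^ (b / a) * (n₃ : ℝ) ^ (c / a)

/-- `N₁ = [n₂^{b/a} n₃^{c/a}]`, the nearest integer. -/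
noncomputable def N1 (a b c : ℝ) (n₂ n₃ : ℕ+) : ℤ := round (X a b c n₂ n₃)

/-- `L(n₂, n₃) = log(n₂^b n₃^c / N₁^a)`. -/
noncomputable def L (a b c : ℝ) (n₂ n₃ : ℕ+) : ℝ :=
  Real.log ((n₂ : ℝ) ^ b * (n₃ : ℝ) ^ c / (N1 a b c n₂ n₃ : ℝ) ^ a)

/-- The range of summation of `M₁(T)`: the triples such that `n₂^{b/a} n₃^{c/a}` is not an integer
and `N_𝐧 ≤ (2π/a) n₁ n₂^{b/a} n₃^{c/a} ≤ T`. -/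
def M1Set (a b c T : ℝ) : Set Triple :=
  {n | (∀ m : ℤ, X a b c n.2.1 n.2.2 ≠ m) ∧
    Nn a b c n ≤ 2 * Real.pi / a * ((n.1 : ℝ) * X a b c n.2.1 n.2.2) ∧
    2 * Real.pi / a * ((n.1 : ℝ) * X a b c n.2.1 n.2.2) ≤ T}

/-- `M₁(T) = (2π/a) ∑* n₂^{b/2a-1/2} n₃^{c/2a-1/2} e(n₁ n₂^{b/a} n₃^{c/a})`, a finite sum. -/
noncomputable def M1 (a b c T : ℝ) : ℂ :=
  (2 * Real.pi / a : ℂ) * ∑' n : M1Set a b c T,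
    (((n.1.2.1 : ℝ) ^ (b / (2 * a) - 1 / 2) * (n.1.2.2 : ℝ) ^ (c / (2 * a) - 1 / 2) : ℝ) : ℂ) *
      e ((n.1.1 : ℝ) * X a b c n.1.2.1 n.1.2.2)

/-- The range of summation of `J_{2,2}(T)`: the off-diagonal triples with `n₁ = N₁` and
`N_𝐧 ≤ T`. -/
def J22Set (a b c T : ℝ) : Set Triple :=
  {n | n ∈ offDiagonal a b c ∧ ((n.1 : ℕ) : ℤ) = N1 a b c n.2.1 n.2.2 ∧ Nn a b c n ≤ T}

/-- `J_{2,2}(T) = ∑ P_𝐧^{-1/2} ∫_{N_𝐧}^T e^{itL(n₂,n₃)} dt`, a finite sum. -/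
noncomputable def J22 (a b c T : ℝ) : ℂ :=
  ∑' n : J22Set a b c T, (((P n.1) ^ (-(1 / 2) : ℝ) : ℝ) : ℂ) *
    ∫ t in (Nn a b c n.1)..T, Complex.exp (Complex.I * t * L a b c n.1.2.1 n.1.2.2)

end OffDiag

/-!
Why the estimate holds. Write `X = n₂^{b/a} n₃^{c/a}`, so that
`L_𝐚(𝐧)^{it} = exp (i t a log (X/n₁))` (`La_cpow_eq`).

The cutoff is explicit. Since `F₁(z,t) = exp (αz²/t)` with `Re α = 1`, the integral defining
`W₁(x,t)` is, in the variable `s = log A(x,t) √t`, the distribution function of a complex Gaussian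
plus small multiples of its derivatives (`W1_eq`). Hence `W₁(x,·)` is a smoothed indicator of
`t ≥ t₀(x)`, where `A(x,t₀) = 1`: on `[1, T]` it has size and total variation
`O(min(1, T^{3/2}/x))`, and its distance in mean to the indicator is smaller than the trivial bound
by a factor `√T` (`exists_W1_integral_bounds`). In particular no Stirling formula and no contour
shift is needed.

If `n₁ ≠ N₁`, the phase does not stand still: bounded variation gives a term
`P^{-1/2} min(1, T^{3/2}/P) / |log (X/n₁)|` (`exists_I12Term_le`), and replacing the minimum by
`(T^{3/2}/P)^{1/2+δ}` with `δ ≍ 1/log T` bounds the sum of all of them by `T^{3/4} (log T)³`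
(`exists_tsum_far_le`).

If `n₁ = N₁`, the cutoff is first replaced by the indicator of `t ≥ t₂`, where
`t₂ = 2π max(n₂²/b, n₃²/c)`. The range `t ≥ 2πN₁²/a` is the summand of `J_{2,2}`. On the range
`t₂ ≤ t ≤ 2πN₁²/a` the phase `a log (X/N₁)` may be replaced by `a (X - N₁)/X`, and with
`t = 2πuX/a` the integral turns into `∫ e(u(X - N₁)) du`. As `|X - N₁| ≤ 1/2`, this is the
geometric sum `∑ e(k(X - N₁)) = ∑ e(kX)` up to a bounded error (`norm_sum_e_sub_integral_le`), and
that sum is the part of `M₁` belonging to `(n₂, n₃)`, with `k` in the role of its `n₁`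
(`exists_dual_sum_sub_integral_le`, `exists_pair_estimate`). So the theorem is a truncated Poisson
summation formula in which a single frequency survives.

The errors are then summed over the pairs `(n₂, n₃)` (`exists_tsum_pairError_le`). The location of
the cutoff and the passage between sum and integral cost `T^{1/4 + 3a/(2(a+c))}` and
`T^{1/2 + a/(2c)}`, the lower end `t₂` costs `T^{5/4 - c/(4a)}` if `c < 2a`, and everything else is
`T^{3/4}` up to logarithms. The first two powers are in fact dominated by the other two
(`exists_rpow_mul_log_sq_le`), which is why the logarithms that accompany them do not matter.
-/

namespace OffDiag

open MeasureTheory Filter Topology Set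

/-! ### The complex Gaussian and its derivatives -/

/-- The Hermite functions attached to the complex Gaussian `exp (-s² / (4α))`: `hermiteGauss α w`
is the `w`-th derivative of the density `(2π)⁻¹ (π / α)^{1/2} exp (-s² / (4α))`, defined here by
the three-term recursion. -/
noncomputable def hermiteGauss (α : ℂ) : ℕ → ℝ → ℂ
  | 0, s => 1 / (2 * Real.pi) * (Real.pi / α) ^ (1 / 2 : ℂ) * Complex.exp (-(1 / (4 * α)) * s ^ 2)
  | 1, s => -(1 / (2 * α)) * (s * (1 / (2 * Real.pi) * (Real.pi / α) ^ (1 / 2 : ℂ) *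
      Complex.exp (-(1 / (4 * α)) * s ^ 2)))
  | w + 2, s => -(1 / (2 * α)) * (s * hermiteGauss α (w + 1) s + (w + 1) * hermiteGauss α w s)

lemma hermiteGauss_one (α : ℂ) (s : ℝ) :
    hermiteGauss α 1 s = -(1 / (2 * α)) * (s * hermiteGauss α 0 s) := by
  simp only [hermiteGauss]

lemma hermiteGauss_add_two (α : ℂ) (w : ℕ) (s : ℝ) :
    hermiteGauss α (w + 2) s =
      -(1 / (2 * α)) * (s * hermiteGauss α (w + 1) s + (w + 1) * hermiteGauss α w s) := by
  simp only [hermiteGauss]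

lemma hasDerivAt_hermiteGauss (α : ℂ) (w : ℕ) (s : ℝ) :
    HasDerivAt (hermiteGauss α w) (hermiteGauss α (w + 1) s) s := by
  have hs : HasDerivAt (fun s : ℝ => (s : ℂ)) 1 s := Complex.ofRealCLM.hasDerivAt
  have h0 : HasDerivAt (hermiteGauss α 0) (hermiteGauss α 1 s) s := by
    have h := (((hs.pow 2).const_mul (-(1 / (4 * α)))).cexp).const_mul
      (1 / (2 * Real.pi) * (Real.pi / α) ^ (1 / 2 : ℂ))
    have hf : hermiteGauss α 0 = fun s : ℝ => 1 / (2 * (Real.pi : ℂ)) *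
        (Real.pi / α) ^ (1 / 2 : ℂ) * Complex.exp (-(1 / (4 * α)) * (s : ℂ) ^ 2) := by
      funext s; simp only [hermiteGauss]
    rw [hf]
    refine h.congr_deriv ?_
    simp only [hermiteGauss, Pi.pow_apply]
    rw [show 1 / (2 * α) = 2 * (1 / (4 * α)) by ring]
    push_cast
    ring
  have h1 : HasDerivAt (hermiteGauss α 1) (hermiteGauss α 2 s) s := by
    have h := (hs.mul h0).const_mul (-(1 / (2 * α)))
    have hf : hermiteGauss α 1 = fun s : ℝ => -(1 / (2 * α)) * ((s : ℂ) * hermiteGauss α 0 s) := by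
      funext s; exact hermiteGauss_one α s
    rw [hf]
    refine h.congr_deriv ?_
    rw [hermiteGauss_add_two]
    push_cast
    ring
  have key : ∀ w : ℕ, HasDerivAt (hermiteGauss α w) (hermiteGauss α (w + 1) s) s ∧
      HasDerivAt (hermiteGauss α (w + 1)) (hermiteGauss α (w + 2) s) s := by
    intro w
    induction w with
    | zero => exact ⟨h0, h1⟩
    | succ w ih =>
      refine ⟨ih.2, ?_⟩
      have h := ((hs.mul ih.2).add (ih.1.const_mul ((w : ℂ) + 1))).const_mul (-(1 / (2 * α)))
      have hf : hermiteGauss α (w + 1 + 1) = fun s : ℝ => -(1 / (2 * α)) *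
          ((s : ℂ) * hermiteGauss α (w + 1) s + (w + 1) * hermiteGauss α w s) := by
        funext s; exact hermiteGauss_add_two α w s
      rw [hf]
      refine h.congr_deriv ?_
      rw [show w + 1 + 2 = (w + 1) + 2 from rfl, hermiteGauss_add_two α (w + 1)]
      push_cast
      ring
  exact (key w).1

lemma continuous_hermiteGauss (α : ℂ) (w : ℕ) : Continuous (hermiteGauss α w) :=
  continuous_iff_continuousAt.2 fun s => (hasDerivAt_hermiteGauss α w s).continuousAt

lemma abs_le_exp_sq {ε : ℝ} (hε : 0 < ε) (s : ℝ) : |s| ≤ (1 + 1 / ε) * Real.exp (ε * s ^ 2) := by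
  have h1 : |s| ≤ 1 + s ^ 2 := by
    have := sq_abs s; nlinarith [sq_nonneg (|s| - 1), abs_nonneg s]
  have h2 : 1 + s ^ 2 ≤ (1 + 1 / ε) * (1 + ε * s ^ 2) := by
    have : (1 + 1 / ε) * (1 + ε * s ^ 2) = 1 + s ^ 2 + (ε * s ^ 2 + 1 / ε) := by
      field_simp; ring
    rw [this]; have : 0 ≤ ε * s ^ 2 + 1 / ε := by positivity
    linarith
  have h3 : 1 + ε * s ^ 2 ≤ Real.exp (ε * s ^ 2) := by
    linarith [Real.add_one_le_exp (ε * s ^ 2)]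
  calc |s| ≤ (1 + 1 / ε) * (1 + ε * s ^ 2) := h1.trans h2
    _ ≤ _ := by gcongr

lemma exists_norm_hermiteGauss_le (α : ℂ) (w : ℕ) {c : ℝ} (hc : c < (1 / (4 * α)).re) :
    ∃ C : ℝ, 0 ≤ C ∧ ∀ s, ‖hermiteGauss α w s‖ ≤ C * Real.exp (-c * s ^ 2) := by
  have h0 : ∀ c < (1 / (4 * α)).re, ∃ C : ℝ, 0 ≤ C ∧
      ∀ s, ‖hermiteGauss α 0 s‖ ≤ C * Real.exp (-c * s ^ 2) := by
    intro c hc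
    refine ⟨‖1 / (2 * Real.pi) * (Real.pi / α) ^ (1 / 2 : ℂ)‖, norm_nonneg _, fun s => ?_⟩
    simp only [hermiteGauss]
    rw [norm_mul, Complex.norm_exp]
    gcongr
    have : (-(1 / (4 * α)) * (s : ℂ) ^ 2).re = -(1 / (4 * α)).re * s ^ 2 := by
      rw [← Complex.ofReal_pow, Complex.re_mul_ofReal, Complex.neg_re]
    rw [this]
    nlinarith [sq_nonneg s]
  -- multiplication by `s` costs an arbitrarily small part of the Gaussian decay
  have hmul : ∀ f : ℝ → ℂ, (∀ c < (1 / (4 * α)).re, ∃ C : ℝ, 0 ≤ C ∧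
      ∀ s, ‖f s‖ ≤ C * Real.exp (-c * s ^ 2)) → ∀ c < (1 / (4 * α)).re, ∃ C : ℝ, 0 ≤ C ∧
      ∀ s : ℝ, ‖s * f s‖ ≤ C * Real.exp (-c * s ^ 2) := by
    intro f hf c hc
    obtain ⟨c', h1, h2⟩ := exists_between hc
    obtain ⟨C, hC, h⟩ := hf c' h2
    have hε : 0 < c' - c := sub_pos.2 h1
    refine ⟨(1 + 1 / (c' - c)) * C, by positivity, fun s => ?_⟩
    rw [norm_mul, Complex.norm_real, Real.norm_eq_abs]
    calc |s| * ‖f s‖ ≤ ((1 + 1 / (c' - c)) * Real.exp ((c' - c) * s ^ 2)) *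
          (C * Real.exp (-c' * s ^ 2)) := by
          gcongr
          · exact abs_le_exp_sq hε s
          · exact h s
      _ = (1 + 1 / (c' - c)) * C * (Real.exp ((c' - c) * s ^ 2) * Real.exp (-c' * s ^ 2)) := by ring
      _ = _ := by rw [← Real.exp_add]; ring_nf
  have key : ∀ w : ℕ, (∀ c < (1 / (4 * α)).re, ∃ C : ℝ, 0 ≤ C ∧
      ∀ s, ‖hermiteGauss α w s‖ ≤ C * Real.exp (-c * s ^ 2)) ∧
      (∀ c < (1 / (4 * α)).re, ∃ C : ℝ, 0 ≤ C ∧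
      ∀ s, ‖hermiteGauss α (w + 1) s‖ ≤ C * Real.exp (-c * s ^ 2)) := by
    intro w
    induction w with
    | zero =>
      refine ⟨h0, fun c hc => ?_⟩
      obtain ⟨C, hC, h⟩ := hmul _ h0 c hc
      refine ⟨‖-(1 / (2 * α))‖ * C, by positivity, fun s => ?_⟩
      rw [zero_add, hermiteGauss_one, norm_mul, mul_assoc]
      gcongr
      exact h s
    | succ w ih =>
      refine ⟨ih.2, fun c hc => ?_⟩
      obtain ⟨C, hC, h⟩ := hmul _ ih.2 c hc
      obtain ⟨C', hC', h'⟩ := ih.1 c hc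
      refine ⟨‖-(1 / (2 * α))‖ * (C + (w + 1) * C'), by positivity, fun s => ?_⟩
      rw [hermiteGauss_add_two, norm_mul, mul_assoc]
      gcongr
      calc _ ≤ ‖(s : ℂ) * hermiteGauss α (w + 1) s‖ + ‖((w : ℂ) + 1) * hermiteGauss α w s‖ :=
            norm_add_le _ _
        _ ≤ C * Real.exp (-c * s ^ 2) + (w + 1) * (C' * Real.exp (-c * s ^ 2)) := by
            gcongr
            · exact h s
            · rw [norm_mul]
              gcongr
              · rw [show ((w : ℂ) + 1) = ((w + 1 : ℕ) : ℂ) by push_cast; ring,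
                  Complex.norm_natCast]; push_cast; rfl
              · exact h' s
        _ = _ := by ring
  exact (key w).1 c hc

lemma one_div_four_mul_re_pos {α : ℂ} (hα : 0 < α.re) : 0 < (1 / (4 * α)).re := by
  have h0 : 0 < Complex.normSq α := Complex.normSq_pos.2 (by rintro rfl; simp at hα)
  rw [one_div, Complex.inv_re]
  simp only [Complex.mul_re, Complex.re_ofNat, Complex.im_ofNat, zero_mul, sub_zero, map_mul]
  refine div_pos (by linarith) (mul_pos ?_ h0)
  rw [Complex.normSq_ofNat]; norm_num

lemma cpow_ofReal_mul {r : ℝ} (hr : 0 < r) {z : ℂ} (hz : z ≠ 0) (w : ℂ) :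
    ((r : ℂ) * z) ^ w = (r : ℂ) ^ w * z ^ w := by
  have hr' : (r : ℂ) ≠ 0 := by exact_mod_cast hr.ne'
  rw [Complex.cpow_def_of_ne_zero (mul_ne_zero hr' hz), Complex.cpow_def_of_ne_zero hr',
    Complex.cpow_def_of_ne_zero hz, Complex.log_ofReal_mul hr hz, ← Complex.exp_add,
    Complex.ofReal_log hr.le]
  ring_nf

lemma integrable_hermiteGauss {α : ℂ} (hα : 0 < α.re) (w : ℕ) :
    Integrable (hermiteGauss α w) := by
  obtain ⟨c, h0, h1⟩ := exists_between (one_div_four_mul_re_pos hα)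
  obtain ⟨C, hC, h⟩ := exists_norm_hermiteGauss_le α w h1
  exact ((integrable_exp_neg_mul_sq h0).const_mul C).mono'
    (continuous_hermiteGauss α w).aestronglyMeasurable (Eventually.of_forall h)

lemma integral_hermiteGauss_zero {α : ℂ} (hα : 0 < α.re) : ∫ s, hermiteGauss α 0 s = 1 := by
  have hα0 : α ≠ 0 := by rintro rfl; simp at hα
  simp only [hermiteGauss]
  rw [integral_const_mul, integral_gaussian_complex (one_div_four_mul_re_pos hα)]
  rw [show (Real.pi : ℂ) / (1 / (4 * α)) = ((4 * Real.pi : ℝ) : ℂ) * α by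
      push_cast; field_simp]
  rw [cpow_ofReal_mul (by positivity) hα0, div_eq_mul_inv (Real.pi : ℂ) α,
    cpow_ofReal_mul Real.pi_pos (inv_ne_zero hα0), Complex.inv_cpow]
  · have h1 : α ^ (1 / 2 : ℂ) ≠ 0 := by simp [Complex.cpow_eq_zero_iff, hα0]
    have h2 : ((Real.pi : ℂ)) ^ (1 / 2 : ℂ) * ((4 * Real.pi : ℝ) : ℂ) ^ (1 / 2 : ℂ)
        = 2 * Real.pi := by
      rw [← Complex.mul_cpow_ofReal_nonneg Real.pi_pos.le (by positivity),
        ← Complex.ofReal_mul, show (1 / 2 : ℂ) = ((1 / 2 : ℝ) : ℂ) by push_cast; rfl,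
        ← Complex.ofReal_cpow (by positivity), ← Real.sqrt_eq_rpow,
        show Real.pi * (4 * Real.pi) = (2 * Real.pi) ^ 2 by ring,
        Real.sqrt_sq (by positivity)]
      push_cast; rfl
    have h3 : (Real.pi : ℂ) ≠ 0 := by exact_mod_cast Real.pi_ne_zero
    calc _ = 1 / (2 * (Real.pi : ℂ)) * ((Real.pi : ℂ) ^ (1 / 2 : ℂ) *
          ((4 * Real.pi : ℝ) : ℂ) ^ (1 / 2 : ℂ)) * ((α ^ (1 / 2 : ℂ))⁻¹ * α ^ (1 / 2 : ℂ)) := by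
            ring
      _ = 1 := by rw [h2, inv_mul_cancel₀ h1]; field_simp
  · intro h
    rw [Complex.arg_eq_pi_iff] at h
    linarith [h.1]

/-! ### Moments of the Gaussian on a vertical line -/

lemma quadratic_line_eq (l β : ℂ) (y : ℝ) :
    l * (1 + y * Complex.I) + β * (1 + y * Complex.I) ^ 2 =
      -β * (y : ℂ) ^ 2 + (Complex.I * (l + 2 * β)) * y + (l + β) := by
  linear_combination (β * y ^ 2) * Complex.I_sq

lemma norm_line_pow_le (w : ℕ) (y : ℝ) : ‖(1 + y * Complex.I : ℂ) ^ w‖ ≤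
    w.factorial * Real.exp 1 * (Real.exp y + Real.exp (-y)) := by
  have h1 : ‖(1 + y * Complex.I : ℂ)‖ ≤ 1 + |y| := by
    refine (norm_add_le _ _).trans ?_
    simp
  have h2 := Real.pow_div_factorial_le_exp (1 + |y|) (by positivity) w
  rw [div_le_iff₀ (by positivity)] at h2
  rw [norm_pow]
  calc _ ≤ (1 + |y|) ^ w := by gcongr
    _ ≤ Real.exp (1 + |y|) * w.factorial := h2
    _ = w.factorial * Real.exp 1 * Real.exp |y| := by rw [Real.exp_add]; ring
    _ ≤ _ := by
      gcongr
      rcases abs_cases y with ⟨h, _⟩ | ⟨h, _⟩ <;> rw [h] <;>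
        linarith [Real.exp_pos y, Real.exp_pos (-y)]

lemma integrable_line_pow_mul_exp {β : ℂ} (hβ : 0 < β.re) (l : ℂ) (w : ℕ) :
    Integrable fun y : ℝ => (1 + y * Complex.I : ℂ) ^ w *
      Complex.exp (l * (1 + y * Complex.I) + β * (1 + y * Complex.I) ^ 2) := by
  have i1 := (integrable_cexp_quadratic hβ (Complex.I * (l + 2 * β) + 1) (l + β)).norm
  have i2 := (integrable_cexp_quadratic hβ (Complex.I * (l + 2 * β) - 1) (l + β)).norm
  refine ((i1.add i2).const_mul (w.factorial * Real.exp 1)).mono' (by fun_prop)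
    (Eventually.of_forall fun y => ?_)
  rw [norm_mul, quadratic_line_eq]
  have e1 : ‖Complex.exp (-β * (y : ℂ) ^ 2 + (Complex.I * (l + 2 * β) + 1) * y + (l + β))‖ =
      Real.exp y * ‖Complex.exp (-β * (y : ℂ) ^ 2 + (Complex.I * (l + 2 * β)) * y + (l + β))‖ := by
    rw [← Real.norm_of_nonneg (Real.exp_pos y).le, ← Complex.norm_real, ← norm_mul,
      Complex.ofReal_exp, ← Complex.exp_add]
    congr 2; ring
  have e2 : ‖Complex.exp (-β * (y : ℂ) ^ 2 + (Complex.I * (l + 2 * β) - 1) * y + (l + β))‖ =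
      Real.exp (-y) *
        ‖Complex.exp (-β * (y : ℂ) ^ 2 + (Complex.I * (l + 2 * β)) * y + (l + β))‖ := by
    rw [← Real.norm_of_nonneg (Real.exp_pos (-y)).le, ← Complex.norm_real, ← norm_mul,
      Complex.ofReal_exp, ← Complex.exp_add]
    congr 2; push_cast; ring
  simp only [Pi.add_apply]
  rw [e1, e2, ← add_mul, ← mul_assoc]
  gcongr
  exact norm_line_pow_le w y

/-- The moments of the Gaussian along the line `Re z = 1`, up to normalization:
`(2π)⁻¹ ∫ z^w exp (lz + αz²/t) dy = t^{(w+1)/2} hermiteGauss α w (l √t)`. The case `w = 0` is the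
Gaussian integral; integrating a total derivative gives the three-term recursion. -/
lemma integral_line_pow_mul_exp {α : ℂ} (hα : 0 < α.re) {t : ℝ} (ht : 0 < t) (l : ℝ) (w : ℕ) :
    1 / (2 * Real.pi : ℂ) * ∫ y : ℝ, (1 + y * Complex.I : ℂ) ^ w *
      Complex.exp (l * (1 + y * Complex.I) + (α / t) * (1 + y * Complex.I) ^ 2) =
      (√t : ℂ) ^ (w + 1) * hermiteGauss α w (l * √t) := by
  have hα0 : α ≠ 0 := by rintro rfl; simp at hα
  have ht0 : (t : ℂ) ≠ 0 := by exact_mod_cast ht.ne'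
  have hst : ((√t : ℝ) : ℂ) ^ 2 = t := by rw [← Complex.ofReal_pow, Real.sq_sqrt ht.le]
  have hst0 : ((√t : ℝ) : ℂ) ≠ 0 := by exact_mod_cast (Real.sqrt_pos.2 ht).ne'
  have hβ : 0 < (α / t).re := by rw [Complex.div_ofReal_re]; positivity
  have hβ0 : α / t ≠ 0 := div_ne_zero hα0 ht0
  have hint := integrable_line_pow_mul_exp hβ l
  set F : ℕ → ℝ → ℂ := fun w y => (1 + y * Complex.I : ℂ) ^ w *
      Complex.exp (l * (1 + y * Complex.I) + (α / t) * (1 + y * Complex.I) ^ 2) with hF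
  have hz : ∀ y : ℝ, HasDerivAt (fun y : ℝ => (1 + y * Complex.I : ℂ)) Complex.I y := by
    intro y
    have hs : HasDerivAt (fun s : ℝ => (s : ℂ)) 1 y := Complex.ofRealCLM.hasDerivAt
    simpa using (hs.mul_const Complex.I).const_add 1
  have hexp : ∀ y : ℝ, HasDerivAt (F 0) (Complex.I * (l * F 0 y + 2 * (α / t) * F 1 y)) y := by
    intro y
    have h := (((hz y).const_mul (l : ℂ)).add (((hz y).pow 2).const_mul (α / t))).cexp
    have : F 0 = fun y : ℝ => Complex.exp (l * (1 + y * Complex.I) +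
        (α / t) * (1 + y * Complex.I) ^ 2) := by
      funext y; simp [hF]
    rw [this]
    refine h.congr_deriv ?_
    simp only [hF, Pi.add_apply, Pi.pow_apply]
    push_cast
    ring
  have hFw : ∀ w y, F w y = (1 + y * Complex.I : ℂ) ^ w * F 0 y := by intro w y; simp [hF]
  have hrec : ∀ w : ℕ, ∫ y, F (w + 1) y =
      -(t / (2 * α)) * (l * (∫ y, F w y) + w * ∫ y, F (w - 1) y) := by
    intro w
    have hd : ∀ y : ℝ, HasDerivAt (F w)
        (Complex.I * (w * F (w - 1) y + l * F w y + 2 * (α / t) * F (w + 1) y)) y := by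
      intro y
      have h := ((hz y).pow w).mul (hexp y)
      have : F w = fun y : ℝ => (1 + y * Complex.I : ℂ) ^ w * F 0 y := funext (hFw w)
      rw [this]
      refine h.congr_deriv ?_
      simp only [Pi.pow_apply]
      rw [hFw (w - 1), hFw (w + 1), hFw 1]
      ring
    have hI := integral_eq_zero_of_hasDerivAt_of_integrable hd
      (((((hint (w - 1)).const_mul (w : ℂ)).add ((hint w).const_mul (l : ℂ))).add
        ((hint (w + 1)).const_mul (2 * (α / t)))).const_mul Complex.I) (hint w)
    rw [integral_const_mul, integral_add, integral_add, integral_const_mul, integral_const_mul,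
      integral_const_mul] at hI
    · have h1 := (mul_eq_zero.1 hI).resolve_left Complex.I_ne_zero
      have h2 : ∫ y, F (w + 1) y = -(t / (2 * α)) * (l * (∫ y, F w y) + w * ∫ y, F (w - 1) y) +
          t / (2 * α) * (w * (∫ y, F (w - 1) y) + l * (∫ y, F w y) +
            2 * (α / t) * ∫ y, F (w + 1) y) := by
        field_simp; ring
      rw [h2]
      erw [h1]
      ring
    · exact (hint (w - 1)).const_mul _
    · exact (hint w).const_mul _
    · exact ((hint (w - 1)).const_mul _).add ((hint w).const_mul _)
    · exact (hint (w + 1)).const_mul _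
  have h0 : 1 / (2 * Real.pi : ℂ) * ∫ y, F 0 y =
      (√t : ℂ) ^ (0 + 1) * hermiteGauss α 0 (l * √t) := by
    have : ∀ y : ℝ, F 0 y = Complex.exp (-(α / t) * (y : ℂ) ^ 2 +
        (Complex.I * (l + 2 * (α / t))) * y + (l + α / t)) := by
      intro y; rw [← quadratic_line_eq]; simp [hF]
    simp_rw [this]
    rw [integral_cexp_quadratic (by simpa using hβ)]
    simp only [hermiteGauss]
    rw [neg_neg, show (Real.pi : ℂ) / (α / t) = (t : ℂ) * (Real.pi / α) by field_simp,
      cpow_ofReal_mul ht (div_ne_zero (by exact_mod_cast Real.pi_ne_zero) hα0)]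
    have e1 : (t : ℂ) ^ (1 / 2 : ℂ) = √t := by
      rw [show (1 / 2 : ℂ) = ((1 / 2 : ℝ) : ℂ) by push_cast; rfl,
        ← Complex.ofReal_cpow ht.le, ← Real.sqrt_eq_rpow]
    have e2 : (l : ℂ) + α / t - (Complex.I * (l + 2 * (α / t))) ^ 2 / (4 * -(α / t)) =
        -(1 / (4 * α)) * ((l * √t : ℝ) : ℂ) ^ 2 := by
      rw [mul_pow, Complex.I_sq]
      push_cast
      rw [mul_pow, hst]
      field_simp
      ring
    rw [e1, e2]
    ring
  have key : ∀ w : ℕ,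
      (1 / (2 * Real.pi : ℂ) * ∫ y, F w y = (√t : ℂ) ^ (w + 1) * hermiteGauss α w (l * √t)) ∧
      (1 / (2 * Real.pi : ℂ) * ∫ y, F (w + 1) y =
        (√t : ℂ) ^ (w + 1 + 1) * hermiteGauss α (w + 1) (l * √t)) := by
    intro w
    induction w with
    | zero =>
      refine ⟨h0, ?_⟩
      rw [hrec 0]
      rw [zero_add, hermiteGauss_one]
      have : 1 / (2 * Real.pi : ℂ) * (-(t / (2 * α)) * (l * (∫ y, F 0 y) +
          ((0 : ℕ) : ℂ) * ∫ y, F (0 - 1) y)) =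
          -(t / (2 * α)) * l * (1 / (2 * Real.pi : ℂ) * ∫ y, F 0 y) := by push_cast; ring
      rw [this, h0, ← hst]
      push_cast
      ring
    | succ w ih =>
      refine ⟨ih.2, ?_⟩
      rw [hrec (w + 1)]
      have : 1 / (2 * Real.pi : ℂ) * (-(t / (2 * α)) * (l * (∫ y, F (w + 1) y) +
          ((w + 1 : ℕ) : ℂ) * ∫ y, F (w + 1 - 1) y)) =
          -(t / (2 * α)) * (l * (1 / (2 * Real.pi : ℂ) * ∫ y, F (w + 1) y) +
            ((w + 1 : ℕ) : ℂ) * (1 / (2 * Real.pi : ℂ) * ∫ y, F w y)) := by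
        rw [Nat.add_sub_cancel]; ring
      rw [this, ih.1, ih.2, hermiteGauss_add_two, ← hst]
      push_cast
      ring
  exact (key w).1

/-! ### The cutoff as a Gaussian distribution function -/

/-- The distribution function `∫_{σ ≤ s} hermiteGauss α 0 σ` of the complex Gaussian. -/
noncomputable def gaussCdf (α : ℂ) (s : ℝ) : ℂ := ∫ σ in Iic s, hermiteGauss α 0 σ

lemma hasDerivAt_gaussCdf {α : ℂ} (hα : 0 < α.re) (s : ℝ) :
    HasDerivAt (gaussCdf α) (hermiteGauss α 0 s) s := by
  have hi := integrable_hermiteGauss hα 0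
  have h := (intervalIntegral.integral_hasDerivAt_right (hi.intervalIntegrable (a := 0) (b := s))
    ((continuous_hermiteGauss α 0).stronglyMeasurableAtFilter _ _)
    (continuous_hermiteGauss α 0).continuousAt).const_add (gaussCdf α 0)
  refine h.congr_of_eventuallyEq (Eventually.of_forall fun u => ?_)
  have := intervalIntegral.integral_Iic_sub_Iic (a := 0) (b := u) hi.integrableOn hi.integrableOn
  simp only [gaussCdf]
  rw [← this]; ring

/-- The distribution function of the complex Gaussian approaches `0` and `1` at Gaussian speed; the
bound `c < Re (1/(4α))` is the decay rate of the density. -/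
lemma exists_gaussCdf_tail {α : ℂ} (hα : 0 < α.re) {c : ℝ} (hc0 : 0 ≤ c)
    (hc : c < (1 / (4 * α)).re) :
    ∃ C : ℝ, 0 ≤ C ∧ ∀ s, ‖gaussCdf α s - if 0 ≤ s then 1 else 0‖ ≤ C * Real.exp (-c * s ^ 2) := by
  obtain ⟨c', h1, h2⟩ := exists_between hc
  obtain ⟨C, hC, h⟩ := exists_norm_hermiteGauss_le α 0 h2
  have hi := integrable_hermiteGauss hα 0
  have hg : Integrable fun σ : ℝ => Real.exp (-(c' - c) * σ ^ 2) :=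
    integrable_exp_neg_mul_sq (sub_pos.2 h1)
  have hI : 0 ≤ ∫ σ : ℝ, Real.exp (-(c' - c) * σ ^ 2) :=
    integral_nonneg fun σ => (Real.exp_pos _).le
  -- on a set where `|σ| ≥ |s|` the Gaussian splits off the factor `exp (-c s²)`
  have key : ∀ (s : ℝ) (S : Set ℝ), MeasurableSet S → (∀ σ ∈ S, s ^ 2 ≤ σ ^ 2) →
      ‖∫ σ in S, hermiteGauss α 0 σ‖ ≤
        C * (∫ σ : ℝ, Real.exp (-(c' - c) * σ ^ 2)) * Real.exp (-c * s ^ 2) := by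
    intro s S hS hs
    calc _ ≤ ∫ σ in S, ‖hermiteGauss α 0 σ‖ := norm_integral_le_integral_norm _
      _ ≤ ∫ σ in S, C * Real.exp (-c * s ^ 2) * Real.exp (-(c' - c) * σ ^ 2) := by
        refine setIntegral_mono_on hi.norm.integrableOn (hg.const_mul _).integrableOn hS
          fun σ hσ => (h σ).trans ?_
        rw [mul_assoc, ← Real.exp_add]
        gcongr
        nlinarith [hs σ hσ]
      _ ≤ ∫ σ : ℝ, C * Real.exp (-c * s ^ 2) * Real.exp (-(c' - c) * σ ^ 2) :=
        setIntegral_le_integral (hg.const_mul _) (Eventually.of_forall fun σ => by positivity)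
      _ = _ := by rw [integral_const_mul]; ring
  refine ⟨C * ∫ σ : ℝ, Real.exp (-(c' - c) * σ ^ 2), by positivity, fun s => ?_⟩
  split_ifs with hs
  · have h3 : gaussCdf α s - 1 = -∫ σ in Ioi s, hermiteGauss α 0 σ := by
      rw [← integral_hermiteGauss_zero hα, ← intervalIntegral.integral_Iic_add_Ioi (b := s)
        hi.integrableOn hi.integrableOn, gaussCdf]
      ring
    rw [h3, norm_neg]
    exact key s _ measurableSet_Ioi fun σ hσ => by
      have : s < σ := hσ
      nlinarith
  · rw [sub_zero]
    exact key s _ measurableSet_Iic fun σ hσ => by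
      have : σ ≤ s := hσ
      nlinarith

lemma one_le_norm_line (y : ℝ) : 1 ≤ ‖(1 + y * Complex.I : ℂ)‖ := by
  have := Complex.abs_re_le_norm (1 + y * Complex.I : ℂ)
  simpa using this

lemma line_ne_zero (y : ℝ) : (1 + y * Complex.I : ℂ) ≠ 0 := by
  have := one_le_norm_line y
  intro h; rw [h, norm_zero] at this; linarith

/-- The smooth cutoff `(2πi)⁻¹ ∫ exp (lz + αz²/t) dz/z` is the distribution function of the complex
Gaussian: write `exp (lz) / z` as an integral over `(-∞, l]` and exchange the integrals. -/
lemma integral_line_exp_div {α : ℂ} (hα : 0 < α.re) {t : ℝ} (ht : 0 < t) (l : ℝ) :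
    1 / (2 * Real.pi : ℂ) * ∫ y : ℝ,
      Complex.exp (l * (1 + y * Complex.I) + (α / t) * (1 + y * Complex.I) ^ 2) /
        (1 + y * Complex.I) = gaussCdf α (l * √t) := by
  have hst : 0 < √t := Real.sqrt_pos.2 ht
  have hst0 : ((√t : ℝ) : ℂ) ≠ 0 := by exact_mod_cast hst.ne'
  have hβ : 0 < (α / t).re := by rw [Complex.div_ofReal_re]; positivity
  set B : ℝ → ℂ := fun y => Complex.exp ((α / t) * (1 + y * Complex.I) ^ 2) with hB
  have hBi : Integrable B := by
    have := integrable_line_pow_mul_exp hβ 0 0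
    simpa using this
  set F : ℝ → ℝ → ℂ := fun σ y =>
    1 / (√t : ℂ) * Complex.exp ((1 + y * Complex.I) / √t * σ) * B y with hF
  have hFi : Integrable (Function.uncurry F) ((volume.restrict (Iic (l * √t))).prod volume) := by
    have h1 : Integrable (fun σ : ℝ => 1 / √t * Real.exp (1 / √t * σ))
        (volume.restrict (Iic (l * √t))) :=
      (integrableOn_exp_mul_Iic (by positivity) _).const_mul _
    refine (h1.mul_prod hBi.norm).mono' ?_ (Eventually.of_forall fun p => ?_)
    · apply Continuous.aestronglyMeasurable
      simp only [hF, hB, Function.uncurry_def]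
      fun_prop
    · simp only [hF, Function.uncurry_def]
      rw [norm_mul, norm_mul, Complex.norm_exp]
      have e1 : ((1 + (p.2 : ℂ) * Complex.I) / (√t : ℂ) * (p.1 : ℂ)).re = 1 / √t * p.1 := by
        rw [Complex.re_mul_ofReal, Complex.div_ofReal_re]; simp
      have e2 : ‖1 / (√t : ℂ)‖ = 1 / √t := by
        rw [norm_div, norm_one, Complex.norm_real, Real.norm_of_nonneg hst.le]
      rw [e1, e2]
  have h1 : ∀ σ : ℝ, hermiteGauss α 0 σ = 1 / (2 * Real.pi : ℂ) * ∫ y : ℝ, F σ y := by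
    intro σ
    have h := integral_line_pow_mul_exp hα ht (σ / √t) 0
    rw [div_mul_cancel₀ _ hst.ne', zero_add, pow_one] at h
    have h2 : ∫ y : ℝ, F σ y = 1 / (√t : ℂ) * ∫ y : ℝ, (1 + y * Complex.I : ℂ) ^ 0 *
      Complex.exp ((σ / √t : ℝ) * (1 + y * Complex.I) + (α / t) * (1 + y * Complex.I) ^ 2) := by
      rw [← integral_const_mul]
      congr 1; funext y
      simp only [hF, hB]
      rw [pow_zero, one_mul, Complex.exp_add, mul_assoc]
      congr 3
      push_cast; ring
    rw [h2, mul_left_comm, h]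
    field_simp
  have h2 : ∀ y : ℝ, ∫ σ in Iic (l * √t), F σ y =
      Complex.exp (l * (1 + y * Complex.I) + (α / t) * (1 + y * Complex.I) ^ 2) /
        (1 + y * Complex.I) := by
    intro y
    simp only [hF]
    rw [integral_mul_const, integral_const_mul, integral_exp_mul_complex_Iic]
    · rw [Complex.exp_add]
      have e1 : (1 + (y : ℂ) * Complex.I) / √t * ((l * √t : ℝ) : ℂ) =
          l * (1 + y * Complex.I) := by
        push_cast; field_simp
      rw [e1]
      have := line_ne_zero y
      simp only [hB]
      field_simp
    · rw [Complex.div_ofReal_re]; simp [hst]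
  simp_rw [← h2]
  rw [← integral_integral_swap hFi, gaussCdf, ← integral_const_mul]
  congr 1; funext σ
  exact (h1 σ).symm

/-! ### The explicit form of `W₁` -/

/-- The complex variance `α = 1 - i I_𝐚 / 4` of the cutoff: `F₁(z,t) = exp (α z² / t)`. -/
noncomputable def cutoffAlpha (a b c : ℝ) : ℂ := 1 - Complex.I * (Ia a b c) / 4

lemma cutoffAlpha_re (a b c : ℝ) : (cutoffAlpha a b c).re = 1 := by
  simp [cutoffAlpha]

lemma Qa_pos {a b c : ℝ} (ha : 0 < a) (hb : 0 < b) (hc : 0 < c) : 0 < Qa a b c := by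
  unfold Qa
  have : a * (-b) * (-c) = a * b * c := by ring
  rw [this]; positivity

lemma A_pos {a b c : ℝ} (ha : 0 < a) (hb : 0 < b) (hc : 0 < c) {x t : ℝ} (hx : 0 < x)
    (ht : 0 < t) : 0 < A a b c x t := by
  have := Qa_pos ha hb hc
  unfold A; positivity

/-- `log A(x,t) √t`: in this variable the cutoff `W₁(x,t)` is a fixed function, to leading order. -/
noncomputable def cutoffVar (a b c x t : ℝ) : ℝ := Real.log (A a b c x t) * √t

lemma W1Integrand_eq {a b c : ℝ} (ha : 0 < a) (hb : 0 < b) (hc : 0 < c)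
    (coef : ℕ → ℕ → ℂ) {x t : ℝ} (hx : 0 < x) (ht : 0 < t) (y : ℝ) :
    W1Integrand a b c coef x t (1 + y * Complex.I) =
    Complex.exp (Real.log (A a b c x t) * (1 + y * Complex.I) +
      (cutoffAlpha a b c / t) * (1 + y * Complex.I) ^ 2) / (1 + y * Complex.I) +
    ∑ p ∈ uvRange, coef p.1 p.2 * ((t : ℂ) ^ p.2)⁻¹ * ((1 + y * Complex.I) ^ (p.1 - 1) *
      Complex.exp (Real.log (A a b c x t) * (1 + y * Complex.I) +
      (cutoffAlpha a b c / t) * (1 + y * Complex.I) ^ 2)) := by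
  have hA := A_pos ha hb hc hx ht
  have hz := line_ne_zero y
  set z : ℂ := 1 + y * Complex.I
  have h1 : (A a b c x t : ℂ) ^ z * F1 a b c z t =
      Complex.exp (Real.log (A a b c x t) * z + (cutoffAlpha a b c / t) * z ^ 2) := by
    rw [Complex.cpow_def_of_ne_zero (by exact_mod_cast hA.ne'), F1, ← Complex.exp_add,
      Complex.ofReal_log hA.le]
    congr 1
    have ht0 : (t : ℂ) ≠ 0 := by exact_mod_cast ht.ne'
    unfold cutoffAlpha
    field_simp
  unfold W1Integrand
  rw [h1, mul_add, mul_one, add_div, Finset.mul_sum, Finset.sum_div]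
  congr 1
  refine Finset.sum_congr rfl fun p hp => ?_
  have hp1 : 1 ≤ p.1 := by
    simp only [uvRange, Finset.mem_filter, Finset.mem_product, Finset.mem_Icc] at hp
    exact hp.1.1.1
  obtain ⟨k, hk⟩ : ∃ k, p.1 = k + 1 := ⟨p.1 - 1, by omega⟩
  rw [hk, Nat.add_sub_cancel, pow_succ]
  field_simp
  ring

lemma integrable_exp_div_line (a b c x : ℝ) {t : ℝ} (ht : 0 < t) :
    Integrable fun y : ℝ => Complex.exp (Real.log (A a b c x t) * (1 + y * Complex.I) +
      (cutoffAlpha a b c / t) * (1 + y * Complex.I) ^ 2) / (1 + y * Complex.I) := by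
  have hβ : 0 < (cutoffAlpha a b c / t).re := by
    rw [Complex.div_ofReal_re, cutoffAlpha_re]; positivity
  have := integrable_line_pow_mul_exp hβ (Real.log (A a b c x t)) 0
  simp only [pow_zero, one_mul] at this
  refine this.norm.mono' ?_ (Eventually.of_forall fun y => ?_)
  · refine Continuous.aestronglyMeasurable ?_
    exact Continuous.div (by fun_prop) (by fun_prop) line_ne_zero
  · rw [norm_div]
    exact div_le_self (norm_nonneg _) (one_le_norm_line y)

lemma integrable_coef_line (a b c : ℝ) (coef : ℕ → ℕ → ℂ) (x : ℝ) {t : ℝ} (ht : 0 < t)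
    (p : ℕ × ℕ) :
    Integrable fun y : ℝ => coef p.1 p.2 * ((t : ℂ) ^ p.2)⁻¹ * ((1 + y * Complex.I) ^ (p.1 - 1) *
      Complex.exp (Real.log (A a b c x t) * (1 + y * Complex.I) +
      (cutoffAlpha a b c / t) * (1 + y * Complex.I) ^ 2)) := by
  have hβ : 0 < (cutoffAlpha a b c / t).re := by
    rw [Complex.div_ofReal_re, cutoffAlpha_re]; positivity
  exact (integrable_line_pow_mul_exp hβ (Real.log (A a b c x t)) (p.1 - 1)).const_mul _

lemma integrable_W1Integrand {a b c : ℝ} (ha : 0 < a) (hb : 0 < b) (hc : 0 < c)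
    (coef : ℕ → ℕ → ℂ) {x t : ℝ} (hx : 0 < x) (ht : 0 < t) :
    Integrable fun y : ℝ => W1Integrand a b c coef x t (1 + y * Complex.I) := by
  simp_rw [W1Integrand_eq ha hb hc coef hx ht]
  exact (integrable_exp_div_line a b c x ht).add
    (integrable_finsetSum _ fun p _ => integrable_coef_line a b c coef x ht p)

/-- The cutoff in closed form: a Gaussian distribution function in the variable `log A(x,t) √t`, and
lower order terms given by its derivatives. The exponents `u/2 - v` are negative. -/
lemma W1_eq {a b c : ℝ} (ha : 0 < a) (hb : 0 < b) (hc : 0 < c)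
    (coef : ℕ → ℕ → ℂ) {x t : ℝ} (hx : 0 < x) (ht : 0 < t) :
    W1 a b c coef x t = gaussCdf (cutoffAlpha a b c) (cutoffVar a b c x t) +
    ∑ p ∈ uvRange, coef p.1 p.2 * ((t ^ ((p.1 : ℝ) / 2 - p.2) : ℝ) : ℂ) *
      hermiteGauss (cutoffAlpha a b c) (p.1 - 1) (cutoffVar a b c x t) := by
  have hα : 0 < (cutoffAlpha a b c).re := by rw [cutoffAlpha_re]; norm_num
  unfold W1
  simp_rw [W1Integrand_eq ha hb hc coef hx ht]
  rw [integral_add (integrable_exp_div_line a b c x ht)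
    (integrable_finsetSum _ fun p _ => integrable_coef_line a b c coef x ht p), mul_add,
    integral_line_exp_div hα ht, integral_finsetSum _ fun p _ =>
      integrable_coef_line a b c coef x ht p, Finset.mul_sum]
  congr 1
  refine Finset.sum_congr rfl fun p hp => ?_
  have hp1 : p.1 - 1 + 1 = p.1 := by
    simp only [uvRange, Finset.mem_filter, Finset.mem_product, Finset.mem_Icc] at hp
    omega
  rw [integral_const_mul, mul_left_comm, integral_line_pow_mul_exp hα ht, hp1, cutoffVar]
  have h2 : ((t : ℂ) ^ p.2)⁻¹ * (√t : ℂ) ^ p.1 = ((t ^ ((p.1 : ℝ) / 2 - p.2) : ℝ) : ℂ) := by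
    rw [Real.rpow_sub ht, Real.rpow_natCast, div_eq_mul_inv, Real.sqrt_eq_rpow,
      show ((p.1 : ℝ) / 2) = (1 / 2) * (p.1 : ℝ) by ring, Real.rpow_mul ht.le, Real.rpow_natCast]
    push_cast
    ring
  rw [← h2]
  ring

/-! ### The location and the derivative of the cutoff -/

/-- The time `t₀ = 2π (x² / Q_𝐚)^{1/3}` at which `A(x,t₀) = 1`, where the cutoff `W₁(x,·)`
switches on. -/
noncomputable def cutoffTime (a b c x : ℝ) : ℝ :=
  2 * Real.pi * (x ^ 2 / Qa a b c) ^ (1 / 3 : ℝ)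

lemma cutoffTime_pos {a b c : ℝ} (ha : 0 < a) (hb : 0 < b) (hc : 0 < c) {x : ℝ} (hx : 0 < x) :
    0 < cutoffTime a b c x := by
  have := Qa_pos ha hb hc
  have := Real.pi_pos
  unfold cutoffTime; positivity

lemma log_A_eq {a b c : ℝ} (ha : 0 < a) (hb : 0 < b) (hc : 0 < c) {x t : ℝ} (hx : 0 < x)
    (ht : 0 < t) :
    Real.log (A a b c x t) = 3 / 2 * (Real.log t - Real.log (cutoffTime a b c x)) := by
  have hQ := Qa_pos ha hb hc
  have hpi := Real.pi_pos
  unfold A cutoffTime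
  rw [Real.log_div (by positivity) hx.ne', Real.log_mul (by positivity) (by positivity),
    Real.log_rpow hQ, Real.log_rpow (by positivity), Real.log_div ht.ne' (by positivity),
    Real.log_mul (by positivity : 2 * Real.pi ≠ 0) (by positivity), Real.log_rpow (by positivity),
    Real.log_div (by positivity) hQ.ne', Real.log_pow]
  push_cast
  ring

lemma cutoffVar_nonneg_iff {a b c : ℝ} (ha : 0 < a) (hb : 0 < b) (hc : 0 < c) {x t : ℝ}
    (hx : 0 < x) (ht : 0 < t) : 0 ≤ cutoffVar a b c x t ↔ cutoffTime a b c x ≤ t := by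
  have h0 := cutoffTime_pos ha hb hc hx
  unfold cutoffVar
  rw [mul_nonneg_iff_of_pos_right (Real.sqrt_pos.2 ht), log_A_eq ha hb hc hx ht,
    mul_nonneg_iff_of_pos_left (by norm_num), sub_nonneg, Real.log_le_log_iff h0 ht]

lemma hasDerivAt_cutoffVar {a b c : ℝ} (ha : 0 < a) (hb : 0 < b) (hc : 0 < c) {x t : ℝ}
    (hx : 0 < x) (ht : 0 < t) :
    HasDerivAt (cutoffVar a b c x) (1 / √t * (3 / 2 + Real.log (A a b c x t) / 2)) t := by
  have h1 : HasDerivAt (fun t => 3 / 2 * (Real.log t - Real.log (cutoffTime a b c x)))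
      (3 / 2 * t⁻¹) t := ((Real.hasDerivAt_log ht.ne').sub_const _).const_mul _
  have h2 := h1.mul (Real.hasDerivAt_sqrt ht.ne')
  have hst := Real.sqrt_pos.2 ht
  have hss := Real.mul_self_sqrt ht.le
  refine (h2.congr_deriv ?_).congr_of_eventuallyEq ?_
  · rw [log_A_eq ha hb hc hx ht]
    have : t⁻¹ * √t = 1 / √t := by
      rw [eq_div_iff hst.ne', mul_assoc, hss, inv_mul_cancel₀ ht.ne']
    rw [mul_assoc, this]
    field_simp
  · filter_upwards [lt_mem_nhds ht] with u hu
    simp only [cutoffVar, log_A_eq ha hb hc hx hu, Pi.mul_apply]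

/-- The factor `3/2 + |s|/2` dominates the one that the derivative of `cutoffVar` contributes to the
derivative of the cutoff. -/
lemma exists_norm_hermiteGauss_mul_le (α : ℂ) (w : ℕ) {κ : ℝ} (hκ : κ < (1 / (4 * α)).re) :
    ∃ C : ℝ, 0 ≤ C ∧ ∀ s, ‖hermiteGauss α w s‖ * (3 / 2 + |s| / 2) ≤ C * Real.exp (-κ * s ^ 2) := by
  obtain ⟨κ', h1, h2⟩ := exists_between hκ
  obtain ⟨C, hC, h⟩ := exists_norm_hermiteGauss_le α w h2
  have hε : 0 < κ' - κ := sub_pos.2 h1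
  refine ⟨C * (3 / 2 + (1 + 1 / (κ' - κ)) / 2), by positivity, fun s => ?_⟩
  have h3 : 3 / 2 + |s| / 2 ≤
      (3 / 2 + (1 + 1 / (κ' - κ)) / 2) * Real.exp ((κ' - κ) * s ^ 2) := by
    have e1 := abs_le_exp_sq hε s
    have e2 : 1 ≤ Real.exp ((κ' - κ) * s ^ 2) := Real.one_le_exp (by positivity)
    linarith
  calc _ ≤ (C * Real.exp (-κ' * s ^ 2)) *
        ((3 / 2 + (1 + 1 / (κ' - κ)) / 2) * Real.exp ((κ' - κ) * s ^ 2)) := by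
        gcongr
        exact h s
    _ = C * (3 / 2 + (1 + 1 / (κ' - κ)) / 2) *
        (Real.exp (-κ' * s ^ 2) * Real.exp ((κ' - κ) * s ^ 2)) := by ring
    _ = _ := by rw [← Real.exp_add]; ring_nf

lemma uvRange_exponent_nonpos {p : ℕ × ℕ} (hp : p ∈ uvRange) : (p.1 : ℝ) / 2 - p.2 ≤ 0 := by
  simp only [uvRange, Finset.mem_filter, Finset.mem_product, Finset.mem_Icc] at hp
  have : (2 * p.1 : ℝ) ≤ 3 * p.2 := by exact_mod_cast hp.2.1
  have h2 : (0 : ℝ) ≤ p.2 := by positivity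
  linarith

lemma uvRange_pred_add_one {p : ℕ × ℕ} (hp : p ∈ uvRange) : p.1 - 1 + 1 = p.1 := by
  simp only [uvRange, Finset.mem_filter, Finset.mem_product, Finset.mem_Icc] at hp
  omega

/-- The derivative of `t ↦ W₁(x,t)`. -/
noncomputable def W1Deriv (a b c : ℝ) (coef : ℕ → ℕ → ℂ) (x t : ℝ) : ℂ :=
  hermiteGauss (cutoffAlpha a b c) 0 (cutoffVar a b c x t) *
      ((1 / √t * (3 / 2 + Real.log (A a b c x t) / 2) : ℝ) : ℂ) +
    ∑ p ∈ uvRange, coef p.1 p.2 *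
      (((((p.1 : ℝ) / 2 - p.2) * t ^ ((p.1 : ℝ) / 2 - p.2 - 1) : ℝ) : ℂ) *
        hermiteGauss (cutoffAlpha a b c) (p.1 - 1) (cutoffVar a b c x t) +
      ((t ^ ((p.1 : ℝ) / 2 - p.2) : ℝ) : ℂ) *
        (hermiteGauss (cutoffAlpha a b c) p.1 (cutoffVar a b c x t) *
          ((1 / √t * (3 / 2 + Real.log (A a b c x t) / 2) : ℝ) : ℂ)))

lemma hasDerivAt_W1 {a b c : ℝ} (ha : 0 < a) (hb : 0 < b) (hc : 0 < c)
    (coef : ℕ → ℕ → ℂ) {x t : ℝ} (hx : 0 < x) (ht : 0 < t) :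
    HasDerivAt (W1 a b c coef x) (W1Deriv a b c coef x t) t := by
  have hα : 0 < (cutoffAlpha a b c).re := by rw [cutoffAlpha_re]; norm_num
  have hs := hasDerivAt_cutoffVar ha hb hc hx ht
  have h0 := (hasDerivAt_gaussCdf hα (cutoffVar a b c x t)).scomp t hs
  have hw : ∀ w, HasDerivAt (fun t => hermiteGauss (cutoffAlpha a b c) w (cutoffVar a b c x t))
      (hermiteGauss (cutoffAlpha a b c) (w + 1) (cutoffVar a b c x t) *
        ((1 / √t * (3 / 2 + Real.log (A a b c x t) / 2) : ℝ) : ℂ)) t := by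
    intro w
    have := (hasDerivAt_hermiteGauss (cutoffAlpha a b c) w (cutoffVar a b c x t)).scomp t hs
    refine this.congr_deriv ?_
    rw [Complex.real_smul, mul_comm]
  have hr : ∀ r : ℝ, HasDerivAt (fun t : ℝ => ((t ^ r : ℝ) : ℂ)) ((r * t ^ (r - 1) : ℝ) : ℂ) t :=
    fun r => (Real.hasDerivAt_rpow_const (Or.inl ht.ne')).ofReal_comp
  have hp : ∀ p ∈ uvRange, HasDerivAt (fun t => coef p.1 p.2 *
      ((t ^ ((p.1 : ℝ) / 2 - p.2) : ℝ) : ℂ) *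
      hermiteGauss (cutoffAlpha a b c) (p.1 - 1) (cutoffVar a b c x t)) (coef p.1 p.2 *
      (((((p.1 : ℝ) / 2 - p.2) * t ^ ((p.1 : ℝ) / 2 - p.2 - 1) : ℝ) : ℂ) *
        hermiteGauss (cutoffAlpha a b c) (p.1 - 1) (cutoffVar a b c x t) +
      ((t ^ ((p.1 : ℝ) / 2 - p.2) : ℝ) : ℂ) *
        (hermiteGauss (cutoffAlpha a b c) p.1 (cutoffVar a b c x t) *
          ((1 / √t * (3 / 2 + Real.log (A a b c x t) / 2) : ℝ) : ℂ)))) t := by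
    intro p hp
    have h := ((hr ((p.1 : ℝ) / 2 - p.2)).const_mul (coef p.1 p.2)).mul (hw (p.1 - 1))
    rw [uvRange_pred_add_one hp] at h
    refine h.congr_deriv ?_
    ring
  have h := h0.add (HasDerivAt.fun_sum hp)
  refine (h.congr_deriv ?_).congr_of_eventuallyEq ?_
  · rw [W1Deriv, Complex.real_smul, mul_comm (hermiteGauss _ 0 _)]
  · filter_upwards [lt_mem_nhds ht] with u hu
    rw [W1_eq ha hb hc coef hx hu]
    rfl

lemma continuousOn_W1Deriv {a b c : ℝ} (ha : 0 < a) (hb : 0 < b) (hc : 0 < c)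
    (coef : ℕ → ℕ → ℂ) {x : ℝ} (hx : 0 < x) :
    ContinuousOn (W1Deriv a b c coef x) (Ioi 0) := by
  have h1 : ContinuousOn (cutoffVar a b c x) (Ioi 0) := fun t ht =>
    (hasDerivAt_cutoffVar ha hb hc hx ht).continuousAt.continuousWithinAt
  have h2 : ContinuousOn (fun t => Real.log (A a b c x t)) (Ioi 0) := by
    refine ContinuousOn.congr (f := fun t => 3 / 2 *
      (Real.log t - Real.log (cutoffTime a b c x))) ?_ fun t ht => log_A_eq ha hb hc hx ht
    exact continuousOn_const.mul ((Real.continuousOn_log.mono fun t ht =>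
      (ne_of_gt ht : t ≠ 0)).sub continuousOn_const)
  have h3 : ContinuousOn (fun t => ((1 / √t * (3 / 2 + Real.log (A a b c x t) / 2) : ℝ) : ℂ))
      (Ioi 0) := by
    refine Complex.continuous_ofReal.comp_continuousOn ?_
    refine ContinuousOn.mul (continuousOn_const.div Real.continuous_sqrt.continuousOn
      fun t ht => (Real.sqrt_pos.2 ht).ne') (continuousOn_const.add (h2.div_const 2))
  have h4 : ∀ w, ContinuousOn (fun t => hermiteGauss (cutoffAlpha a b c) w (cutoffVar a b c x t))
      (Ioi 0) := fun w => (continuous_hermiteGauss _ w).comp_continuousOn h1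
  have h5 : ∀ r : ℝ, ContinuousOn (fun t : ℝ => t ^ r) (Ioi 0) := fun r =>
    continuousOn_id.rpow_const fun t ht => Or.inl (ne_of_gt ht)
  refine ((h4 0).mul h3).add (continuousOn_finsetSum _ fun p _ => ?_)
  refine continuousOn_const.mul (ContinuousOn.add (ContinuousOn.mul ?_ (h4 _))
    (ContinuousOn.mul ?_ ((h4 _).mul h3)))
  · exact Complex.continuous_ofReal.comp_continuousOn (continuousOn_const.mul (h5 _))
  · exact Complex.continuous_ofReal.comp_continuousOn (h5 _)

/-- `W₁(x,t)` is a smoothed version of the indicator of `t ≥ t₀(x)`, the smoothing being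
Gaussian in the variable `log A(x,t) √t`. -/
lemma exists_W1_bounds {a b c : ℝ} (ha : 0 < a) (hb : 0 < b) (hc : 0 < c)
    (coef : ℕ → ℕ → ℂ) : ∃ κ : ℝ, 0 < κ ∧ ∃ C : ℝ, 0 ≤ C ∧ ∀ x t : ℝ, 0 < x → 1 ≤ t →
      ‖W1 a b c coef x t - if cutoffTime a b c x ≤ t then 1 else 0‖ ≤
        C * Real.exp (-κ * cutoffVar a b c x t ^ 2) ∧
      ‖W1Deriv a b c coef x t‖ ≤ C * (1 / √t * Real.exp (-κ * cutoffVar a b c x t ^ 2)) := by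
  have hα : 0 < (cutoffAlpha a b c).re := by rw [cutoffAlpha_re]; norm_num
  obtain ⟨κ, hκ0, hκ⟩ := exists_between (one_div_four_mul_re_pos hα)
  obtain ⟨C₀, hC₀, hE⟩ := exists_gaussCdf_tail hα hκ0.le hκ
  choose C hC hCb using fun w => exists_norm_hermiteGauss_le (cutoffAlpha a b c) w hκ
  choose D hD hDb using fun w => exists_norm_hermiteGauss_mul_le (cutoffAlpha a b c) w hκ
  refine ⟨κ, hκ0, (C₀ + ∑ p ∈ uvRange, ‖coef p.1 p.2‖ * C (p.1 - 1)) +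
    (D 0 + ∑ p ∈ uvRange, ‖coef p.1 p.2‖ * (|(p.1 : ℝ) / 2 - p.2| * C (p.1 - 1) + D p.1)),
    ?_, fun x t hx ht => ?_⟩
  · have h1 : 0 ≤ ∑ p ∈ uvRange, ‖coef p.1 p.2‖ * C (p.1 - 1) :=
      Finset.sum_nonneg fun p _ => mul_nonneg (norm_nonneg _) (hC _)
    have h2 : 0 ≤ ∑ p ∈ uvRange, ‖coef p.1 p.2‖ *
        (|(p.1 : ℝ) / 2 - p.2| * C (p.1 - 1) + D p.1) := Finset.sum_nonneg fun p _ =>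
      mul_nonneg (norm_nonneg _) (add_nonneg (mul_nonneg (abs_nonneg _) (hC _)) (hD _))
    have := hD 0
    linarith
  have h1 : 0 ≤ ∑ p ∈ uvRange, ‖coef p.1 p.2‖ * C (p.1 - 1) :=
    Finset.sum_nonneg fun p _ => mul_nonneg (norm_nonneg _) (hC _)
  have h2 : 0 ≤ ∑ p ∈ uvRange, ‖coef p.1 p.2‖ *
      (|(p.1 : ℝ) / 2 - p.2| * C (p.1 - 1) + D p.1) := Finset.sum_nonneg fun p _ =>
    mul_nonneg (norm_nonneg _) (add_nonneg (mul_nonneg (abs_nonneg _) (hC _)) (hD _))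
  have hD0 := hD 0
  have ht0 : 0 < t := by linarith
  have hst : 1 ≤ √t := Real.one_le_sqrt.2 ht
  set s := cutoffVar a b c x t with hs
  set G := Real.exp (-κ * s ^ 2) with hG
  have hG0 : 0 < G := Real.exp_pos _
  have hpow : ∀ p ∈ uvRange, t ^ ((p.1 : ℝ) / 2 - p.2) ≤ 1 := fun p hp =>
    Real.rpow_le_one_of_one_le_of_nonpos ht (uvRange_exponent_nonpos hp)
  constructor
  · rw [W1_eq ha hb hc coef hx ht0, ← hs]
    have e1 : (if cutoffTime a b c x ≤ t then (1 : ℂ) else 0) = if 0 ≤ s then 1 else 0 := by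
      simp only [hs, cutoffVar_nonneg_iff ha hb hc hx ht0]
    rw [e1, add_sub_right_comm]
    refine (norm_add_le _ _).trans ?_
    have e2 : ‖∑ p ∈ uvRange, coef p.1 p.2 * ((t ^ ((p.1 : ℝ) / 2 - p.2) : ℝ) : ℂ) *
        hermiteGauss (cutoffAlpha a b c) (p.1 - 1) s‖ ≤
        (∑ p ∈ uvRange, ‖coef p.1 p.2‖ * C (p.1 - 1)) * G := by
      rw [Finset.sum_mul]
      refine (norm_sum_le _ _).trans (Finset.sum_le_sum fun p hp => ?_)
      rw [norm_mul, norm_mul, Complex.norm_real, Real.norm_of_nonneg (by positivity)]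
      calc _ ≤ ‖coef p.1 p.2‖ * 1 * (C (p.1 - 1) * G) := by
            gcongr
            · exact hpow p hp
            · exact hCb _ _
        _ = _ := by ring
    have e3 := hE s
    nlinarith
  · have hs' : |1 / √t * (3 / 2 + Real.log (A a b c x t) / 2)| ≤ 1 / √t * (3 / 2 + |s| / 2) := by
      rw [abs_mul, abs_of_nonneg (by positivity : 0 ≤ 1 / √t)]
      gcongr
      have e1 : |Real.log (A a b c x t)| ≤ |s| := by
        rw [hs, cutoffVar, abs_mul, abs_of_nonneg (by positivity : 0 ≤ √t)]
        exact le_mul_of_one_le_right (abs_nonneg _) hst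
      refine (abs_add_le _ _).trans ?_
      rw [abs_of_nonneg (by norm_num : (0 : ℝ) ≤ 3 / 2), abs_div, abs_two]
      gcongr
    have hh : ∀ w, ‖hermiteGauss (cutoffAlpha a b c) w s *
        ((1 / √t * (3 / 2 + Real.log (A a b c x t) / 2) : ℝ) : ℂ)‖ ≤ D w * (1 / √t * G) := by
      intro w
      rw [norm_mul, Complex.norm_real, Real.norm_eq_abs]
      calc _ ≤ ‖hermiteGauss (cutoffAlpha a b c) w s‖ * (1 / √t * (3 / 2 + |s| / 2)) := by gcongr
        _ = 1 / √t * (‖hermiteGauss (cutoffAlpha a b c) w s‖ * (3 / 2 + |s| / 2)) := by ring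
        _ ≤ 1 / √t * (D w * G) := mul_le_mul_of_nonneg_left (hDb w s) (by positivity)
        _ = _ := by ring
    rw [W1Deriv, ← hs]
    refine (norm_add_le _ _).trans ?_
    have e2 : ‖∑ p ∈ uvRange, coef p.1 p.2 *
      (((((p.1 : ℝ) / 2 - p.2) * t ^ ((p.1 : ℝ) / 2 - p.2 - 1) : ℝ) : ℂ) *
        hermiteGauss (cutoffAlpha a b c) (p.1 - 1) s +
      ((t ^ ((p.1 : ℝ) / 2 - p.2) : ℝ) : ℂ) *
        (hermiteGauss (cutoffAlpha a b c) p.1 s *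
          ((1 / √t * (3 / 2 + Real.log (A a b c x t) / 2) : ℝ) : ℂ)))‖ ≤
        (∑ p ∈ uvRange, ‖coef p.1 p.2‖ * (|(p.1 : ℝ) / 2 - p.2| * C (p.1 - 1) + D p.1)) *
          (1 / √t * G) := by
      rw [Finset.sum_mul]
      refine (norm_sum_le _ _).trans (Finset.sum_le_sum fun p hp => ?_)
      rw [norm_mul, mul_assoc, add_mul]
      gcongr
      refine (norm_add_le _ _).trans (add_le_add ?_ ?_)
      · rw [norm_mul, Complex.norm_real, norm_mul, Real.norm_eq_abs,
          Real.norm_of_nonneg (by positivity)]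
        have e3 : t ^ ((p.1 : ℝ) / 2 - p.2 - 1) ≤ 1 / √t := by
          rw [Real.sqrt_eq_rpow, one_div, ← Real.rpow_neg ht0.le]
          refine Real.rpow_le_rpow_of_exponent_le ht ?_
          have := uvRange_exponent_nonpos hp
          linarith
        calc _ ≤ |(p.1 : ℝ) / 2 - p.2| * (1 / √t) * (C (p.1 - 1) * G) := by
              gcongr
              exact hCb _ _
          _ = _ := by ring
      · rw [norm_mul, Complex.norm_real, Real.norm_of_nonneg (by positivity)]
        calc _ ≤ 1 * (D p.1 * (1 / √t * G)) := by
              gcongr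
              · exact hpow p hp
              · exact hh p.1
          _ = _ := one_mul _
    have e3 := hh 0
    have e4 : 0 ≤ 1 / √t * G := by positivity
    nlinarith

/-! ### Integrals against the cutoff -/

lemma min_abs_sub_le_mul_log {u v : ℝ} (hu : 0 < u) (hv : 0 < v) :
    min |u - v| u ≤ 3 * u * |Real.log u - Real.log v| := by
  have h0 : 0 ≤ |u - v| := abs_nonneg _
  rcases le_total v u with h | h
  · have h1 : 0 ≤ Real.log u - Real.log v := sub_nonneg.2 (Real.log_le_log hv h)
    have h2 := Real.one_sub_inv_le_log_of_pos (div_pos hu hv)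
    rw [Real.log_div hu.ne' hv.ne', inv_div] at h2
    have h3 : u * (1 - v / u) = u - v := by field_simp
    rw [abs_of_nonneg h1]
    refine (min_le_left _ _).trans ?_
    rw [abs_of_nonneg (sub_nonneg.2 h)]
    nlinarith
  · have h1 : Real.log u - Real.log v ≤ 0 := sub_nonpos.2 (Real.log_le_log hu h)
    rw [abs_of_nonpos h1]
    rcases le_total (v / 2) u with h4 | h4
    · refine (min_le_left _ _).trans ?_
      rw [abs_of_nonpos (sub_nonpos.2 h)]
      have h2 := Real.one_sub_inv_le_log_of_pos (div_pos hv hu)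
      rw [Real.log_div hv.ne' hu.ne', inv_div] at h2
      have h3 : v * (1 - u / v) = v - u := by field_simp
      nlinarith
    · refine (min_le_right _ _).trans ?_
      have h2 : Real.log 2 ≤ Real.log v - Real.log u := by
        rw [← Real.log_div hv.ne' hu.ne']
        refine Real.log_le_log two_pos ?_
        rw [le_div_iff₀ hu]; linarith
      have := Real.log_two_gt_d9
      nlinarith

/-- In absolute value the variable `log A(x,t) √t` is at least the distance from `√t` to `√t₀`, or
at least `√t` when that is smaller. -/
lemma min_abs_sqrt_sub_le_cutoffVar {a b c : ℝ} (ha : 0 < a) (hb : 0 < b) (hc : 0 < c) {x t : ℝ}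
    (hx : 0 < x) (ht : 0 < t) :
    min |√t - √(cutoffTime a b c x)| √t ≤ |cutoffVar a b c x t| := by
  have h0 := cutoffTime_pos ha hb hc hx
  have h := min_abs_sub_le_mul_log (Real.sqrt_pos.2 ht) (Real.sqrt_pos.2 h0)
  refine h.trans_eq ?_
  rw [cutoffVar, log_A_eq ha hb hc hx ht, Real.log_sqrt ht.le, Real.log_sqrt h0.le, abs_mul,
    abs_mul, abs_of_nonneg (Real.sqrt_nonneg t), ← sub_div, abs_div, abs_two,
    abs_of_nonneg (by norm_num : (0 : ℝ) ≤ 3 / 2)]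
  ring

lemma continuousOn_cutoffVar {a b c : ℝ} (ha : 0 < a) (hb : 0 < b) (hc : 0 < c) {x : ℝ}
    (hx : 0 < x) : ContinuousOn (cutoffVar a b c x) (Ioi 0) := fun _ ht =>
  (hasDerivAt_cutoffVar ha hb hc hx ht).continuousAt.continuousWithinAt

lemma uIcc_one_subset {T : ℝ} (hT : 1 ≤ T) : uIcc 1 T ⊆ Ioi (0 : ℝ) := by
  rw [uIcc_of_le hT]
  intro t ht
  exact lt_of_lt_of_le one_pos ht.1

/-- The transition of the cutoff takes place within bounded distance in the variable `√t`, so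
that its derivative has bounded integral. -/
lemma exists_integral_gauss_le {a b c : ℝ} (ha : 0 < a) (hb : 0 < b) (hc : 0 < c) {κ : ℝ}
    (hκ : 0 < κ) : ∃ C : ℝ, 0 ≤ C ∧ ∀ x T : ℝ, 0 < x → 1 ≤ T →
      ∫ t in (1 : ℝ)..T, 1 / √t * Real.exp (-κ * cutoffVar a b c x t ^ 2) ≤ C := by
  have hg : Integrable fun u : ℝ => Real.exp (-κ * u ^ 2) := integrable_exp_neg_mul_sq hκ
  set G := ∫ u : ℝ, Real.exp (-κ * u ^ 2)
  have hG : 0 ≤ G := integral_nonneg fun u => (Real.exp_pos _).le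
  refine ⟨2 * (G + G), by positivity, fun x T hx hT => ?_⟩
  set u₀ := √(cutoffTime a b c x)
  set f : ℝ → ℝ := fun u => 2 * (Real.exp (-κ * (u - u₀) ^ 2) + Real.exp (-κ * u ^ 2)) with hf
  have hfc : Continuous f := by simp only [hf]; fun_prop
  have hsub := uIcc_one_subset hT
  have hcon : ContinuousOn (fun t : ℝ => 1 / (2 * √t)) (uIcc 1 T) :=
    continuousOn_const.div (continuousOn_const.mul Real.continuous_sqrt.continuousOn) fun t ht => by
      have := Real.sqrt_pos.2 (hsub ht); positivity
  have hcon' : ContinuousOn (fun t : ℝ => 1 / √t) (uIcc 1 T) :=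
    continuousOn_const.div Real.continuous_sqrt.continuousOn fun t ht =>
      (Real.sqrt_pos.2 (hsub ht)).ne'
  have hsq := intervalIntegral.integral_comp_mul_deriv' (a := 1) (b := T) (f := Real.sqrt)
    (f' := fun t => 1 / (2 * √t)) (g := f) (fun t ht => Real.hasDerivAt_sqrt (hsub ht).ne') hcon
    hfc.continuousOn
  have hshift : Integrable fun u : ℝ => Real.exp (-κ * (u - u₀) ^ 2) := hg.comp_sub_right u₀
  have hfi : Integrable f := (hshift.add hg).const_mul 2
  have hfI : ∫ u, f u = 2 * (G + G) := by
    rw [integral_const_mul, integral_add hshift hg,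
      integral_sub_right_eq_self (fun u : ℝ => Real.exp (-κ * u ^ 2)) u₀]
  calc _ ≤ ∫ t in (1 : ℝ)..T, (f ∘ Real.sqrt) t * (1 / (2 * √t)) := by
        refine intervalIntegral.integral_mono_on hT ?_ ?_ fun t ht => ?_
        · exact (hcon'.mul ((Real.continuous_exp.comp (continuous_const.mul
            (continuous_pow 2))).comp_continuousOn ((continuousOn_cutoffVar ha hb hc hx).mono
              hsub))).intervalIntegrable
        · exact ((hfc.comp Real.continuous_sqrt).continuousOn.mul hcon).intervalIntegrable
        · have ht0 : 0 < t := lt_of_lt_of_le one_pos ht.1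
          have hst := Real.sqrt_pos.2 ht0
          have h1 := min_abs_sqrt_sub_le_cutoffVar ha hb hc hx ht0
          have h2 : Real.exp (-κ * cutoffVar a b c x t ^ 2) ≤
              Real.exp (-κ * (√t - u₀) ^ 2) + Real.exp (-κ * √t ^ 2) := by
            rcases min_le_iff.1 h1 with h | h
            · have : Real.exp (-κ * cutoffVar a b c x t ^ 2) ≤ Real.exp (-κ * (√t - u₀) ^ 2) := by
                refine Real.exp_le_exp.2 ?_
                rw [neg_mul, neg_mul, neg_le_neg_iff]
                exact mul_le_mul_of_nonneg_left (sq_le_sq.2 h) hκ.le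
              linarith [Real.exp_pos (-κ * √t ^ 2)]
            · have : Real.exp (-κ * cutoffVar a b c x t ^ 2) ≤ Real.exp (-κ * √t ^ 2) := by
                refine Real.exp_le_exp.2 ?_
                rw [neg_mul, neg_mul, neg_le_neg_iff]
                refine mul_le_mul_of_nonneg_left (sq_le_sq.2 ?_) hκ.le
                rwa [abs_of_pos hst]
              linarith [Real.exp_pos (-κ * (√t - u₀) ^ 2)]
          have h3 : (f ∘ Real.sqrt) t * (1 / (2 * √t)) = 1 / √t *
              (Real.exp (-κ * (√t - u₀) ^ 2) + Real.exp (-κ * √t ^ 2)) := by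
            simp only [hf, Function.comp]; field_simp
          rw [h3]
          gcongr
    _ = ∫ u in √1..√T, f u := hsq
    _ ≤ ∫ u, f u := by
        rw [intervalIntegral.integral_of_le (Real.sqrt_le_sqrt hT)]
        exact setIntegral_le_integral hfi (Eventually.of_forall fun u => by
          simp only [hf, Pi.zero_apply]; positivity)
    _ = _ := hfI

/-- `min (1, T^{3/2} / x)`, the size of the cutoff on `[1, T]`. -/
noncomputable def cutoffSize (T x : ℝ) : ℝ := min 1 (T ^ (3 / 2 : ℝ) / x)

lemma cutoffSize_pos {T x : ℝ} (hT : 0 < T) (hx : 0 < x) : 0 < cutoffSize T x :=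
  lt_min one_pos (by positivity)

lemma exists_A_eq {a b c : ℝ} (ha : 0 < a) (hb : 0 < b) (hc : 0 < c) :
    ∃ K : ℝ, 0 < K ∧ ∀ x t : ℝ, 0 < x → 0 < t → A a b c x t = K * (t ^ (3 / 2 : ℝ) / x) := by
  have hQ := Qa_pos ha hb hc
  have hpi := Real.pi_pos
  refine ⟨Qa a b c ^ (1 / 2 : ℝ) / (2 * Real.pi) ^ (3 / 2 : ℝ), by positivity, fun x t hx ht => ?_⟩
  unfold A
  rw [Real.div_rpow ht.le (by positivity)]
  ring

lemma min_one_mul_le {K y : ℝ} (hK : 0 ≤ K) (hy : 0 ≤ y) : min 1 (K * y) ≤ (1 + K) * min 1 y := by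
  rcases le_total 1 y with h | h
  · rw [min_eq_left h]; exact (min_le_left _ _).trans (by linarith)
  · rw [min_eq_right h]; exact (min_le_right _ _).trans (by nlinarith)

/-- The Gaussian decay also yields the decay `T^{3/2} / x` before the cutoff switches on. -/
lemma exists_gauss_le_cutoffSize {a b c : ℝ} (ha : 0 < a) (hb : 0 < b) (hc : 0 < c) {κ : ℝ}
    (hκ : 0 < κ) : ∃ C : ℝ, 0 ≤ C ∧ ∀ x T t : ℝ, 0 < x → 1 ≤ t → t ≤ T →
      Real.exp (-κ * cutoffVar a b c x t ^ 2) ≤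
        C * cutoffSize T x * Real.exp (-(κ / 2) * cutoffVar a b c x t ^ 2) := by
  obtain ⟨K, hK, hA⟩ := exists_A_eq ha hb hc
  refine ⟨Real.exp (1 / κ) * (1 + K), by positivity, fun x T t hx ht htT => ?_⟩
  have ht0 : 0 < t := by linarith
  have hT0 : 0 < T := by linarith
  set s := cutoffVar a b c x t with hs
  set l := Real.log (A a b c x t) with hl
  have hst : 1 ≤ √t := Real.one_le_sqrt.2 ht
  have h1 : |l| ≤ |s| := by
    rw [hs, cutoffVar, abs_mul, abs_of_nonneg (by positivity : 0 ≤ √t)]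
    exact le_mul_of_one_le_right (abs_nonneg _) hst
  have h2 : Real.exp (-(κ / 2) * s ^ 2) ≤ Real.exp (1 / κ) * Real.exp (-|s|) := by
    rw [← Real.exp_add]
    gcongr
    have : 1 / κ + -|s| - -(κ / 2) * s ^ 2 = (κ * |s| - 1) ^ 2 / (2 * κ) + 1 / (2 * κ) := by
      rw [← sq_abs s]; field_simp; ring
    have h3 : 0 ≤ (κ * |s| - 1) ^ 2 / (2 * κ) + 1 / (2 * κ) := by positivity
    linarith
  have h3 : Real.exp (-|s|) ≤ min 1 (A a b c x T) := by
    refine le_min (Real.exp_le_one_iff.2 (by linarith [abs_nonneg s])) ?_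
    calc Real.exp (-|s|) ≤ Real.exp l := by
          gcongr; linarith [neg_abs_le l]
      _ = A a b c x t := Real.exp_log (A_pos ha hb hc hx ht0)
      _ ≤ A a b c x T := by
          rw [hA x t hx ht0, hA x T hx hT0]
          gcongr
  have h4 : min 1 (A a b c x T) ≤ (1 + K) * cutoffSize T x := by
    rw [hA x T hx hT0]; exact min_one_mul_le hK.le (by positivity)
  calc Real.exp (-κ * s ^ 2) = Real.exp (-(κ / 2) * s ^ 2) * Real.exp (-(κ / 2) * s ^ 2) := by
        rw [← Real.exp_add]; ring_nf
    _ ≤ (Real.exp (1 / κ) * ((1 + K) * cutoffSize T x)) * Real.exp (-(κ / 2) * s ^ 2) := by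
        gcongr
        exact h2.trans (by gcongr; exact h3.trans h4)
    _ = _ := by ring

lemma continuousOn_W1 {a b c : ℝ} (ha : 0 < a) (hb : 0 < b) (hc : 0 < c)
    (coef : ℕ → ℕ → ℂ) {x : ℝ} (hx : 0 < x) : ContinuousOn (W1 a b c coef x) (Ioi 0) := fun _ ht =>
  (hasDerivAt_W1 ha hb hc coef hx ht).continuousAt.continuousWithinAt

/-- Size of the cutoff `W₁(x,·)` on `[1, T]`: supremum, distance in mean to the indicator of
`t ≥ t₀(x)`, and, from its bounded variation, oscillatory integrals. -/
lemma exists_W1_integral_bounds {a b c : ℝ} (ha : 0 < a) (hb : 0 < b) (hc : 0 < c)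
    (coef : ℕ → ℕ → ℂ) : ∃ C : ℝ, 0 ≤ C ∧ ∀ x T : ℝ, 0 < x → 1 ≤ T →
      (∀ t ∈ Icc 1 T, ‖W1 a b c coef x t‖ ≤ C * cutoffSize T x) ∧
      (∫ t in (1 : ℝ)..T, ‖W1 a b c coef x t - if cutoffTime a b c x ≤ t then 1 else 0‖) ≤
        C * (√T * cutoffSize T x) ∧
      ∀ l : ℝ, l ≠ 0 → ‖∫ t in (1 : ℝ)..T, Complex.exp (Complex.I * t * l) * W1 a b c coef x t‖ ≤
        C * (cutoffSize T x / |l|) := by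
  obtain ⟨κ, hκ, C₁, hC₁, hW⟩ := exists_W1_bounds ha hb hc coef
  obtain ⟨C₂, hC₂, hG⟩ := exists_gauss_le_cutoffSize ha hb hc hκ
  obtain ⟨C₃, hC₃, hI⟩ := exists_integral_gauss_le ha hb hc (half_pos hκ)
  obtain ⟨K, hK, hA⟩ := exists_A_eq ha hb hc
  set C₄ := C₁ * C₂ + (1 + K) with hC₄
  have hC₄0 : 0 ≤ C₄ := by positivity
  refine ⟨C₄ + C₁ * C₂ * C₃ + (2 * C₄ + C₁ * C₂ * C₃), by positivity, fun x T hx hT => ?_⟩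
  have hT0 : 0 < T := by linarith
  have hm := cutoffSize_pos hT0 hx
  set m := cutoffSize T x with hmdef
  have hsub := uIcc_one_subset hT
  have hsup : ∀ t ∈ Icc 1 T, ‖W1 a b c coef x t‖ ≤ C₄ * m := by
    intro t ht
    have ht0 : 0 < t := lt_of_lt_of_le one_pos ht.1
    have h1 := (hW x t hx ht.1).1
    have h2 := hG x T t hx ht.1 ht.2
    have h3 : Real.exp (-(κ / 2) * cutoffVar a b c x t ^ 2) ≤ 1 :=
      Real.exp_le_one_iff.2 (by nlinarith [sq_nonneg (cutoffVar a b c x t)])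
    have h4 : Real.exp (-κ * cutoffVar a b c x t ^ 2) ≤ C₂ * m :=
      h2.trans (mul_le_of_le_one_right (by positivity) h3)
    have h5 : ‖(if cutoffTime a b c x ≤ t then (1 : ℂ) else 0)‖ ≤ (1 + K) * m := by
      split_ifs with h
      · rw [norm_one]
        have h6 : 1 ≤ A a b c x T := by
          have h0 := cutoffTime_pos ha hb hc hx
          rw [← Real.log_nonneg_iff (A_pos ha hb hc hx hT0), log_A_eq ha hb hc hx hT0]
          have := Real.log_le_log h0 (h.trans ht.2)
          linarith
        have h7 : min 1 (A a b c x T) ≤ (1 + K) * m := by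
          rw [hA x T hx hT0]; exact min_one_mul_le hK.le (by positivity)
        rwa [min_eq_left h6] at h7
      · rw [norm_zero]; positivity
    calc ‖W1 a b c coef x t‖ = ‖(W1 a b c coef x t - if cutoffTime a b c x ≤ t then 1 else 0) +
          (if cutoffTime a b c x ≤ t then 1 else 0)‖ := by rw [sub_add_cancel]
      _ ≤ C₁ * (C₂ * m) + (1 + K) * m := by
          refine (norm_add_le _ _).trans (add_le_add (h1.trans ?_) h5)
          gcongr
      _ = _ := by rw [hC₄]; ring
  set g : ℝ → ℝ := fun t => 1 / √t * Real.exp (-(κ / 2) * cutoffVar a b c x t ^ 2) with hg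
  have hgi : IntervalIntegrable g volume 1 T := by
    refine ContinuousOn.intervalIntegrable ((continuousOn_const.div
      Real.continuous_sqrt.continuousOn fun t ht => (Real.sqrt_pos.2 (hsub ht)).ne').mul
        ((Real.continuous_exp.comp (continuous_const.mul (continuous_pow 2))).comp_continuousOn
          ((continuousOn_cutoffVar ha hb hc hx).mono hsub)))
  have hgI : ∫ t in (1 : ℝ)..T, g t ≤ C₃ := hI x T hx hT
  have hind : Measurable fun t : ℝ => (if cutoffTime a b c x ≤ t then (1 : ℂ) else 0) :=
    Measurable.ite measurableSet_Ici measurable_const measurable_const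
  have hWc := (continuousOn_W1 ha hb hc coef hx).mono hsub
  have hmean : (∫ t in (1 : ℝ)..T, ‖W1 a b c coef x t - if cutoffTime a b c x ≤ t then 1 else 0‖) ≤
      C₁ * C₂ * C₃ * (√T * m) := by
    have hii : IntervalIntegrable (fun t : ℝ => (if cutoffTime a b c x ≤ t then (1 : ℂ) else 0))
        volume 1 T := by
      refine (intervalIntegrable_const (c := (1 : ℝ))).mono_fun' hind.aestronglyMeasurable
        (Eventually.of_forall fun t => ?_)
      dsimp only
      split_ifs <;> simp
    calc _ ≤ ∫ t in (1 : ℝ)..T, (C₁ * C₂ * (√T * m)) * g t := by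
          refine intervalIntegral.integral_mono_on hT (hWc.intervalIntegrable.sub hii).norm
            (hgi.const_mul _) fun t ht => ?_
          have ht0 : 0 < t := lt_of_lt_of_le one_pos ht.1
          have hst := Real.sqrt_pos.2 ht0
          have h1 := (hW x t hx ht.1).1
          have h2 := hG x T t hx ht.1 ht.2
          have h3 : 1 ≤ √T * (1 / √t) := by
            rw [mul_one_div, le_div_iff₀ hst, one_mul]
            exact Real.sqrt_le_sqrt ht.2
          calc _ ≤ C₁ * (C₂ * m * Real.exp (-(κ / 2) * cutoffVar a b c x t ^ 2)) :=
                h1.trans (by gcongr)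
            _ ≤ C₁ * (C₂ * m * Real.exp (-(κ / 2) * cutoffVar a b c x t ^ 2)) *
                (√T * (1 / √t)) := le_mul_of_one_le_right (by positivity) h3
            _ = _ := by simp only [hg]; ring
      _ = (C₁ * C₂ * (√T * m)) * ∫ t in (1 : ℝ)..T, g t := by
          rw [intervalIntegral.integral_const_mul]
      _ ≤ (C₁ * C₂ * (√T * m)) * C₃ := by gcongr
      _ = _ := by ring
  refine ⟨fun t ht => (hsup t ht).trans ?_, hmean.trans ?_, fun l hl => ?_⟩
  · have : 0 ≤ C₁ * C₂ * C₃ := by positivity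
    gcongr; linarith
  · have : 0 ≤ C₁ * C₂ * C₃ := by positivity
    gcongr; linarith
  -- integration by parts against the primitive `exp (itl) / (il)`
  have hIl : Complex.I * l ≠ 0 := mul_ne_zero Complex.I_ne_zero (by exact_mod_cast hl)
  set v : ℝ → ℂ := fun t => Complex.exp (Complex.I * t * l) / (Complex.I * l) with hv
  have hvd : ∀ t : ℝ, HasDerivAt v (Complex.exp (Complex.I * t * l)) t := by
    intro t
    have hs : HasDerivAt (fun s : ℝ => (s : ℂ)) 1 t := Complex.ofRealCLM.hasDerivAt
    have := (((hs.const_mul Complex.I).mul_const (l : ℂ)).cexp).div_const (Complex.I * l)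
    refine this.congr_deriv ?_
    rw [mul_one, mul_div_cancel_right₀ _ hIl]
  have hnv : ∀ t, ‖v t‖ = 1 / |l| := by
    intro t
    simp only [hv]
    rw [norm_div, show Complex.I * t * l = ((t * l : ℝ) : ℂ) * Complex.I by push_cast; ring,
      Complex.norm_exp_ofReal_mul_I, norm_mul, Complex.norm_I, one_mul, Complex.norm_real,
      Real.norm_eq_abs]
  have hdc := (continuousOn_W1Deriv ha hb hc coef hx).mono hsub
  have hparts := intervalIntegral.integral_mul_deriv_eq_deriv_mul (a := 1) (b := T)
    (u := W1 a b c coef x) (u' := W1Deriv a b c coef x) (v := v)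
    (v' := fun t => Complex.exp (Complex.I * t * l))
    (fun t ht => hasDerivAt_W1 ha hb hc coef hx (hsub ht)) (fun t _ => hvd t)
    hdc.intervalIntegrable (Continuous.intervalIntegrable (by fun_prop) _ _)
  have hcomm : ∫ t in (1 : ℝ)..T, Complex.exp (Complex.I * t * l) * W1 a b c coef x t =
      ∫ t in (1 : ℝ)..T, W1 a b c coef x t * Complex.exp (Complex.I * t * l) := by
    congr 1; funext t; ring
  rw [hcomm, hparts]
  have hl0 : 0 < |l| := abs_pos.2 hl
  have h1 : ‖∫ t in (1 : ℝ)..T, W1Deriv a b c coef x t * v t‖ ≤ C₁ * C₂ * C₃ * (m / |l|) := by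
    calc _ ≤ ∫ t in (1 : ℝ)..T, (C₁ * C₂ * m / |l|) * g t := by
          refine intervalIntegral.norm_integral_le_of_norm_le hT
            (Eventually.of_forall fun t ht => ?_) (hgi.const_mul _)
          have ht1 : 1 ≤ t := ht.1.le
          have h1 := (hW x t hx ht1).2
          have h2 := hG x T t hx ht1 ht.2
          rw [norm_mul, hnv]
          calc _ ≤ C₁ * (1 / √t * (C₂ * m * Real.exp (-(κ / 2) * cutoffVar a b c x t ^ 2))) *
                (1 / |l|) := by
                gcongr
                exact h1.trans (by gcongr)
            _ = _ := by simp only [hg]; ring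
      _ = (C₁ * C₂ * m / |l|) * ∫ t in (1 : ℝ)..T, g t := by
          rw [intervalIntegral.integral_const_mul]
      _ ≤ (C₁ * C₂ * m / |l|) * C₃ := by gcongr
      _ = _ := by ring
  have h2 : ∀ t ∈ Icc 1 T, ‖W1 a b c coef x t * v t‖ ≤ C₄ * (m / |l|) := by
    intro t ht
    rw [norm_mul, hnv]
    calc _ ≤ C₄ * m * (1 / |l|) := by gcongr; exact hsup t ht
      _ = _ := by ring
  have h3 := h2 1 ⟨le_rfl, hT⟩
  have h4 := h2 T ⟨hT, le_rfl⟩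
  have h5 : 0 ≤ (C₄ + C₁ * C₂ * C₃) * (m / |l|) := by positivity
  have h6 := norm_sub_le (W1 a b c coef x T * v T - W1 a b c coef x 1 * v 1)
    (∫ t in (1 : ℝ)..T, W1Deriv a b c coef x t * v t)
  have h7 := norm_sub_le (W1 a b c coef x T * v T) (W1 a b c coef x 1 * v 1)
  nlinarith

/-! ### Exponential sums against exponential integrals -/

lemma norm_exp_sub_one_sub_self_le (φ : ℝ) :
    ‖Complex.exp (Complex.I * φ) - 1 - Complex.I * φ‖ ≤ 2 * φ ^ 2 := by
  have hn : ‖Complex.I * (φ : ℂ)‖ = |φ| := by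
    rw [norm_mul, Complex.norm_I, one_mul, Complex.norm_real, Real.norm_eq_abs]
  rcases le_total |φ| 1 with h | h
  · have := Complex.norm_exp_sub_one_sub_id_le (x := Complex.I * φ) (by rw [hn]; exact h)
    rw [hn, sq_abs] at this
    nlinarith [sq_nonneg φ]
  · have h1 := Real.norm_exp_I_mul_ofReal_sub_one_le (x := φ)
    have h2 := norm_sub_le (Complex.exp (Complex.I * φ) - 1) (Complex.I * φ)
    rw [hn] at h2
    rw [Real.norm_eq_abs] at h1
    have h3 : |φ| ≤ φ ^ 2 := by rw [← sq_abs]; nlinarith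
    linarith

lemma integral_exp_I_mul {l : ℝ} (hl : l ≠ 0) (s t : ℝ) :
    ∫ x in s..t, Complex.exp (Complex.I * x * l) =
      (Complex.exp (Complex.I * t * l) - Complex.exp (Complex.I * s * l)) / (Complex.I * l) := by
  have hIl : Complex.I * (l : ℂ) ≠ 0 := mul_ne_zero Complex.I_ne_zero (by exact_mod_cast hl)
  have := integral_exp_mul_complex (a := s) (b := t) hIl
  rw [mul_right_comm, mul_right_comm Complex.I (s : ℂ), ← this]
  congr 1; funext x; congr 1; ring

lemma norm_exp_I_mul_mul (t l : ℝ) : ‖Complex.exp (Complex.I * t * l)‖ = 1 := by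
  rw [show Complex.I * t * l = ((t * l : ℝ) : ℂ) * Complex.I by push_cast; ring,
    Complex.norm_exp_ofReal_mul_I]

lemma norm_integral_exp_I_mul_le (l s t : ℝ) :
    ‖∫ x in s..t, Complex.exp (Complex.I * x * l)‖ ≤ |t - s| := by
  have := intervalIntegral.norm_integral_le_of_norm_le_const (a := s) (b := t) (C := 1)
    (f := fun x : ℝ => Complex.exp (Complex.I * x * l)) fun x _ => (norm_exp_I_mul_mul x l).le
  simpa using this

lemma e_eq (x : ℝ) : e x = Complex.exp (Complex.I * x * (2 * Real.pi : ℝ)) := by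
  unfold e; congr 1; push_cast; ring

lemma norm_e (x : ℝ) : ‖e x‖ = 1 := by rw [e_eq]; exact norm_exp_I_mul_mul _ _

lemma four_mul_abs_le_norm_e_sub_one {θ : ℝ} (h : |θ| ≤ 1 / 2) : 4 * |θ| ≤ ‖e θ - 1‖ := by
  have h1 : e θ = Complex.exp (Complex.I * (2 * Real.pi * θ : ℝ)) := by
    rw [e_eq]; congr 1; push_cast; ring
  have hpi := Real.pi_pos
  rw [h1, Complex.norm_exp_I_mul_ofReal_sub_one, norm_mul, Real.norm_two, Real.norm_eq_abs]
  have h2 : |2 * Real.pi * θ / 2| ≤ Real.pi / 2 := by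
    rw [show 2 * Real.pi * θ / 2 = Real.pi * θ by ring, abs_mul, abs_of_pos hpi]
    nlinarith
  have h3 := Real.mul_abs_le_abs_sin h2
  rw [show 2 * Real.pi * θ / 2 = Real.pi * θ by ring, abs_mul, abs_of_pos hpi] at h3
  have : 2 / Real.pi * (Real.pi * |θ|) = 2 * |θ| := by field_simp
  rw [show 2 * Real.pi * θ / 2 = Real.pi * θ by ring]
  linarith

lemma e_mul_eq_exp (x θ : ℝ) : e (x * θ) = Complex.exp (Complex.I * x * (2 * Real.pi * θ : ℝ)) := by
  unfold e; congr 1; push_cast; ring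

/-- Sum against integral of an additive character: if `0 < |θ| ≤ 1/2`, both are geometric, and
`1 / (e(θ) - 1)` differs from `1 / (2πiθ)` by a bounded amount. -/
lemma norm_sum_e_sub_integral_le {θ u v : ℝ} (h0 : θ ≠ 0) (h : |θ| ≤ 1 / 2) (hu : 0 ≤ u)
    (huv : u ≤ v) :
    ‖∑ k ∈ Finset.Icc ⌈u⌉₊ ⌊v⌋₊, e (k * θ) - ∫ x in u..v, e (x * θ)‖ ≤ 9 := by
  have hpi := Real.pi_pos
  set m := ⌈u⌉₊
  set n := ⌊v⌋₊ + 1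
  have hv : 0 ≤ v := hu.trans huv
  have hm1 : u ≤ m := Nat.le_ceil u
  have hm2 : (m : ℝ) < u + 1 := Nat.ceil_lt_add_one hu
  have hn1 : v < n := by simpa [n] using Nat.lt_floor_add_one v
  have hn2 : (n : ℝ) ≤ v + 1 := by
    simp only [n]; push_cast; linarith [Nat.floor_le hv]
  have hmn : m ≤ n := by
    have : (m : ℝ) < n + 1 := by linarith
    have : m < n + 1 := by exact_mod_cast this
    omega
  have hθ : 2 * Real.pi * θ ≠ 0 := by positivity
  have hw0 : Complex.I * ((2 * Real.pi * θ : ℝ) : ℂ) ≠ 0 :=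
    mul_ne_zero Complex.I_ne_zero (by exact_mod_cast hθ)
  have hpos : 0 < |θ| := abs_pos.2 h0
  have he1 : e θ - 1 ≠ 0 := by
    have := four_mul_abs_le_norm_e_sub_one h
    intro h1; rw [h1, norm_zero] at this; linarith
  have hpow : ∀ k : ℕ, e (k * θ) = e θ ^ k := by
    intro k
    unfold e
    rw [← Complex.exp_nat_mul]
    congr 1; push_cast; ring
  have hsum : ∑ k ∈ Finset.Icc m ⌊v⌋₊, e (k * θ) = (e (n * θ) - e (m * θ)) / (e θ - 1) := by
    have h1 : Finset.Icc m ⌊v⌋₊ = Finset.Ico m n := by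
      ext k; simp [n]
    rw [h1]
    simp_rw [hpow]
    exact geom_sum_Ico (sub_ne_zero.1 he1) hmn
  have hint : ∀ s t : ℝ, ∫ x in s..t, e (x * θ) =
      (e (t * θ) - e (s * θ)) / (Complex.I * ((2 * Real.pi * θ : ℝ) : ℂ)) := by
    intro s t
    simp_rw [e_mul_eq_exp]
    exact integral_exp_I_mul hθ s t
  have hii : ∀ s t : ℝ, IntervalIntegrable (fun x : ℝ => e (x * θ)) volume s t := fun s t => by
    apply Continuous.intervalIntegrable
    unfold e; fun_prop
  have hle : ∀ s t : ℝ, ‖∫ x in s..t, e (x * θ)‖ ≤ |t - s| := by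
    intro s t
    simp_rw [e_mul_eq_exp]
    exact norm_integral_exp_I_mul_le _ s t
  have hsplit : ∫ x in u..v, e (x * θ) = (∫ x in u..m, e (x * θ)) +
      (∫ x in (m : ℝ)..n, e (x * θ)) - ∫ x in v..n, e (x * θ) := by
    rw [intervalIntegral.integral_add_adjacent_intervals (hii _ _) (hii _ _),
      ← intervalIntegral.integral_add_adjacent_intervals (hii u v) (hii v n)]
    ring
  have hmain : ‖∑ k ∈ Finset.Icc m ⌊v⌋₊, e (k * θ) - ∫ x in (m : ℝ)..n, e (x * θ)‖ ≤
      2 * Real.pi := by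
    rw [hsum, hint]
    have h1 : (e (n * θ) - e (m * θ)) / (e θ - 1) - (e (n * θ) - e (m * θ)) /
        (Complex.I * ((2 * Real.pi * θ : ℝ) : ℂ)) = -((e (n * θ) - e (m * θ)) *
        (e θ - 1 - Complex.I * ((2 * Real.pi * θ : ℝ) : ℂ)) /
          ((e θ - 1) * (Complex.I * ((2 * Real.pi * θ : ℝ) : ℂ)))) := by
      rw [div_sub_div _ _ he1 hw0, ← neg_div]
      congr 1; ring
    rw [h1, norm_neg, norm_div, norm_mul, norm_mul]
    have e1 : ‖e (n * θ) - e (m * θ)‖ ≤ 2 := by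
      refine (norm_sub_le _ _).trans ?_
      rw [norm_e, norm_e]; norm_num
    have e2 : ‖e θ - 1 - Complex.I * ((2 * Real.pi * θ : ℝ) : ℂ)‖ ≤ 2 * (2 * Real.pi * θ) ^ 2 := by
      have := norm_exp_sub_one_sub_self_le (2 * Real.pi * θ)
      rwa [show Complex.exp (Complex.I * ((2 * Real.pi * θ : ℝ) : ℂ)) = e θ by
        unfold e; congr 1; push_cast; ring] at this
    have e3 := four_mul_abs_le_norm_e_sub_one h
    have e4 : ‖Complex.I * ((2 * Real.pi * θ : ℝ) : ℂ)‖ = 2 * Real.pi * |θ| := by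
      rw [norm_mul, Complex.norm_I, one_mul, Complex.norm_real, Real.norm_eq_abs, abs_mul,
        abs_of_pos (by positivity : 0 < 2 * Real.pi)]
    rw [e4, div_le_iff₀ (by positivity)]
    calc _ ≤ 2 * (2 * (2 * Real.pi * θ) ^ 2) := by gcongr
      _ = 2 * Real.pi * (4 * |θ| * (2 * Real.pi * |θ|)) := by
        rw [← sq_abs (2 * Real.pi * θ), abs_mul, abs_of_pos (by positivity : 0 < 2 * Real.pi)]
        ring
      _ ≤ _ := by gcongr
  have e1 := hle u m
  have e2 := hle v n
  rw [abs_of_nonneg (by linarith)] at e1 e2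
  rw [hsplit, show ∀ S p q r : ℂ, S - (p + q - r) = (S - q) - p + r from fun S p q r => by ring]
  refine (norm_add_le _ _).trans ?_
  have e3 := norm_sub_le (∑ k ∈ Finset.Icc m ⌊v⌋₊, e (k * θ) - ∫ x in (m : ℝ)..n, e (x * θ))
    (∫ x in u..m, e (x * θ))
  have := Real.pi_lt_d2
  linarith

/-- Perturbation of the frequency of an oscillatory integral: the change is measured by
`|t| |l - l'|` and by `|l - l'| / |l'|`, and the oscillation saves a factor `1/|l|` in both. -/
lemma norm_integral_exp_sub_le {l l' : ℝ} (hl : l ≠ 0) (hl' : l' ≠ 0) (t : ℝ) :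
    ‖(∫ x in (0 : ℝ)..t, Complex.exp (Complex.I * x * l)) -
      ∫ x in (0 : ℝ)..t, Complex.exp (Complex.I * x * l')‖ ≤
      |t| * |l - l'| / |l| + 2 * |l - l'| / (|l| * |l'|) := by
  have h1 : Complex.I * (l : ℂ) ≠ 0 := mul_ne_zero Complex.I_ne_zero (by exact_mod_cast hl)
  have h2 : Complex.I * (l' : ℂ) ≠ 0 := mul_ne_zero Complex.I_ne_zero (by exact_mod_cast hl')
  have hl0 : (l : ℂ) ≠ 0 := by exact_mod_cast hl
  have hl0' : (l' : ℂ) ≠ 0 := by exact_mod_cast hl'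
  rw [integral_exp_I_mul hl, integral_exp_I_mul hl']
  have e0 : ∀ l : ℝ, Complex.exp (Complex.I * (0 : ℝ) * l) = 1 := by intro l; simp
  rw [e0, e0]
  have key : (Complex.exp (Complex.I * t * l) - 1) / (Complex.I * l) -
      (Complex.exp (Complex.I * t * l') - 1) / (Complex.I * l') =
      (Complex.exp (Complex.I * t * l) - Complex.exp (Complex.I * t * l')) / (Complex.I * l) -
      (Complex.exp (Complex.I * t * l') - 1) * (((l - l' : ℝ) : ℂ) / (Complex.I * l * l')) := by
    push_cast
    field_simp
    ring
  rw [key]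
  refine (norm_sub_le _ _).trans (add_le_add ?_ ?_)
  · rw [norm_div, norm_mul, Complex.norm_I, one_mul, Complex.norm_real, Real.norm_eq_abs]
    gcongr
    have e1 : Complex.exp (Complex.I * t * l) - Complex.exp (Complex.I * t * l') =
        Complex.exp (Complex.I * t * l') *
          (Complex.exp (Complex.I * ((t * (l - l') : ℝ) : ℂ)) - 1) := by
      rw [mul_sub, ← Complex.exp_add, mul_one]
      congr 2; push_cast; ring
    rw [e1, norm_mul, norm_exp_I_mul_mul, one_mul, ← abs_mul]
    exact Real.norm_exp_I_mul_ofReal_sub_one_le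
  · rw [norm_mul, norm_div, norm_mul, norm_mul, Complex.norm_I, one_mul, Complex.norm_real,
      Complex.norm_real, Complex.norm_real, Real.norm_eq_abs, Real.norm_eq_abs, Real.norm_eq_abs,
      mul_div_assoc]
    gcongr
    refine (norm_sub_le _ _).trans ?_
    rw [norm_exp_I_mul_mul, norm_one]; norm_num

/-- Linearization of the phase `log (X/N)` at `N = X`, with a quadratic error. -/
lemma log_div_sub_bounds {X N : ℝ} (hX : 0 < X) (hN : 0 < N) :
    0 ≤ Real.log (X / N) - (X - N) / X ∧
      Real.log (X / N) - (X - N) / X ≤ (X - N) ^ 2 / (N * X) := by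
  have h1 := Real.one_sub_inv_le_log_of_pos (div_pos hX hN)
  have h2 := Real.log_le_sub_one_of_pos (div_pos hX hN)
  have e1 : 1 - (X / N)⁻¹ = (X - N) / X := by field_simp
  have e2 : (X - N) ^ 2 / (N * X) = (X / N - 1) - (X - N) / X := by field_simp
  rw [e1] at h1
  rw [e2]
  exact ⟨by linarith, by linarith⟩

lemma abs_sub_div_max_le_abs_log {X N : ℝ} (hX : 0 < X) (hN : 0 < N) :
    |X - N| / max X N ≤ |Real.log (X / N)| := by
  rcases le_total N X with h | h
  · have h1 := Real.one_sub_inv_le_log_of_pos (div_pos hX hN)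
    have e1 : 1 - (X / N)⁻¹ = (X - N) / X := by field_simp
    rw [max_eq_left h, abs_of_nonneg (sub_nonneg.2 h), ← e1]
    exact h1.trans (le_abs_self _)
  · have h2 := Real.log_le_sub_one_of_pos (div_pos hX hN)
    have e2 : X / N - 1 = -((N - X) / N) := by field_simp; ring
    rw [max_eq_right h, abs_sub_comm, abs_of_nonneg (sub_nonneg.2 h)]
    rw [e2] at h2
    exact (le_neg.2 h2).trans (neg_le_abs _)

set_option maxHeartbeats 1000000 in
/-- The integral of `(X/N)^{iat}` up to the time `2πN²/a` against the dual exponential sum of length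
about `X`. On this range the phase `a t log (X/N)` may be linearized, and with `t = 2πuX/a` the
integral becomes `∫ e(u(X - N)) du`, which is compared with `∑ e(k(X - N)) = ∑ e(kX)`. -/
lemma exists_dual_sum_sub_integral_le {a : ℝ} (ha : 0 < a) : ∃ C : ℝ, 0 ≤ C ∧
    ∀ (X t₂ T : ℝ) (N : ℤ), 1 ≤ X → (1 : ℝ) ≤ N → |X - N| ≤ 1 / 2 → X ≠ N → 0 < t₂ → 0 < T →
      t₂ ≤ 2 * Real.pi / a * X ^ 2 → t₂ ≤ 2 * Real.pi / a * (N : ℝ) ^ 2 →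
      ‖((2 * Real.pi / a * √X : ℝ) : ℂ) *
          ∑ k ∈ Finset.Icc ⌈t₂ / (2 * Real.pi * X / a)⌉₊ ⌊min X (T / (2 * Real.pi * X / a))⌋₊,
            e (k * X) -
        ((1 / √(N : ℝ) : ℝ) : ℂ) * ∫ t in (min t₂ T)..(min (2 * Real.pi / a * (N : ℝ) ^ 2) T),
          Complex.exp (Complex.I * t * (a * Real.log (X / N) : ℝ))‖ ≤
        C * min (√X) (T / √X) := by
  have hpi := Real.pi_pos
  have hpi3 := Real.pi_gt_three
  set C₀ : ℝ := (2 * Real.pi * 9 + 2 * (4 * Real.pi + 8) + 3 * Real.pi + 2 * Real.pi) / a with hC₀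
  have hC₀0 : 0 ≤ C₀ := by positivity
  refine ⟨2 * (1 + 2 * Real.pi / a) + C₀ * (1 + a), by positivity, ?_⟩
  intro X t₂ T N hX hN hXN hne ht₂ hT h1 h2
  set n : ℝ := (N : ℝ) with hn
  set θ := X - n with hθ
  have hθ0 : θ ≠ 0 := sub_ne_zero.2 hne
  have hX0 : 0 < X := by linarith
  have hN0 : 0 < n := by linarith
  have hθ' := abs_le.1 hXN
  have hNX : n ≤ 2 * X := by linarith
  have hXN2 : X ≤ 2 * n := by linarith
  set sX := √X
  set sN := √n
  have hsX : 0 < sX := Real.sqrt_pos.2 hX0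
  have hsN : 0 < sN := Real.sqrt_pos.2 hN0
  have hsXX : sX * sX = X := Real.mul_self_sqrt hX0.le
  have hsNN : sN * sN = n := Real.mul_self_sqrt hN0.le
  have hsXN : sX ≤ 2 * sN := by
    have : sX * sX ≤ (2 * sN) * (2 * sN) := by nlinarith
    exact (mul_self_le_mul_self_iff hsX.le (by positivity)).2 this
  set l := a * Real.log (X / n) with hl
  set c := 2 * Real.pi * X / a with hc
  have hc0 : 0 < c := by positivity
  set S := ∑ k ∈ Finset.Icc ⌈t₂ / c⌉₊ ⌊min X (T / c)⌋₊, e (k * X) with hS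
  set t₃' := min (2 * Real.pi / a * n ^ 2) T with ht₃'
  have ht₃'0 : 0 ≤ t₃' := le_min (by positivity) hT.le
  have hmin0 : 0 ≤ min t₂ T := le_min ht₂.le hT.le
  have hmin_le : min t₂ T ≤ t₃' := min_le_min h2 le_rfl
  have hceil : 1 ≤ ⌈t₂ / c⌉₊ := Nat.one_le_ceil_iff.2 (by positivity)
  rcases lt_or_ge T c with hTc | hTc
  · -- `T < 2πX/a`: the dual sum is empty
    have hS0 : S = 0 := by
      rw [hS, Finset.Icc_eq_empty, Finset.sum_empty]
      have : ⌊min X (T / c)⌋₊ = 0 := by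
        rw [Nat.floor_eq_zero]
        exact (min_le_right _ _).trans_lt ((div_lt_one hc0).2 hTc)
      omega
    rw [hS0, mul_zero, zero_sub, norm_neg, norm_mul, Complex.norm_real,
      Real.norm_of_nonneg (by positivity)]
    have e1 := norm_integral_exp_I_mul_le l (min t₂ T) t₃'
    rw [abs_of_nonneg (by linarith)] at e1
    have e2 : t₃' ≤ T := min_le_right _ _
    have e3 : T / sX ≤ (1 + 2 * Real.pi / a) * min sX (T / sX) := by
      rcases min_choice sX (T / sX) with h | h <;> rw [h]
      · rw [div_le_iff₀ hsX]
        calc T ≤ 2 * Real.pi / a * X := by rw [hc] at hTc; rw [div_mul_eq_mul_div]; exact hTc.le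
          _ = 2 * Real.pi / a * sX * sX := by rw [mul_assoc, hsXX]
          _ ≤ _ := by gcongr; linarith
      · exact le_mul_of_one_le_left (by positivity) (by
          have : 0 ≤ 2 * Real.pi / a := by positivity
          linarith)
    calc _ ≤ 1 / sN * T := by gcongr; linarith
      _ ≤ 2 * (T / sX) := by
        rw [one_div_mul_eq_div, div_le_iff₀ hsN]
        have : 2 * (T / sX) * sN = T * (2 * sN / sX) := by ring
        rw [this]
        exact le_mul_of_one_le_right hT.le ((one_le_div hsX).2 hsXN)
      _ ≤ 2 * ((1 + 2 * Real.pi / a) * min sX (T / sX)) := by gcongr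
      _ ≤ _ := by
        rw [← mul_assoc]
        have : 0 ≤ C₀ * (1 + a) := by positivity
        gcongr
        linarith
  -- from here on `2πX/a ≤ T`, and it suffices to bound by a multiple of `√X`
  have hfin : sX ≤ (1 + a) * min sX (T / sX) := by
    rcases min_choice sX (T / sX) with h | h <;> rw [h]
    · nlinarith
    · rw [mul_div_assoc', le_div_iff₀ hsX, hsXX]
      have : X ≤ a * T := by
        rw [hc, div_le_iff₀ ha] at hTc
        nlinarith
      nlinarith
  suffices hsuff : ‖((2 * Real.pi / a * sX : ℝ) : ℂ) * S -
      ((1 / sN : ℝ) : ℂ) * ∫ t in (min t₂ T)..t₃', Complex.exp (Complex.I * t * l)‖ ≤ C₀ * sX by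
    refine hsuff.trans ?_
    calc C₀ * sX ≤ C₀ * ((1 + a) * min sX (T / sX)) := by gcongr
      _ ≤ _ := by
        rw [← mul_assoc]
        have : 0 ≤ min sX (T / sX) := le_min hsX.le (by positivity)
        have : 0 ≤ 2 * (1 + 2 * Real.pi / a) := by positivity
        gcongr
        linarith
  rcases lt_or_ge T t₂ with hTt | hTt
  · have hS0 : S = 0 := by
      rw [hS, Finset.Icc_eq_empty, Finset.sum_empty]
      intro h
      have h3 : (⌈t₂ / c⌉₊ : ℝ) ≤ ⌊min X (T / c)⌋₊ := by exact_mod_cast h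
      have h4 : (⌊min X (T / c)⌋₊ : ℝ) ≤ T / c :=
        (Nat.floor_le (le_min hX0.le (by positivity))).trans (min_le_right _ _)
      have h5 := Nat.le_ceil (t₂ / c)
      have h6 : T / c < t₂ / c := by gcongr
      linarith
    have h3 : t₃' = T := min_eq_right (by linarith)
    rw [hS0, h3, min_eq_right hTt.le, intervalIntegral.integral_same, mul_zero, mul_zero, sub_zero,
      norm_zero]
    positivity
  rw [min_eq_left hTt]
  set t₃ := min (2 * Real.pi / a * X ^ 2) T with ht₃
  have ht₂₃ : t₂ ≤ t₃ := le_min h1 hTt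
  have ht₂₃' : t₂ ≤ t₃' := le_min h2 hTt
  set l' := 2 * Real.pi * θ / c with hl'
  have hl'eq : l' = a * θ / X := by rw [hl', hc]; field_simp
  have hl'0 : l' ≠ 0 := by rw [hl'eq]; positivity
  have hcu : c * (t₂ / c) = t₂ := by field_simp
  have hcv : c * min X (T / c) = t₃ := by
    rw [mul_min_of_nonneg _ _ hc0.le, ht₃]
    congr 1
    · rw [hc]; ring
    · field_simp
  have huv : t₂ / c ≤ min X (T / c) := by
    rw [div_le_iff₀ hc0, mul_comm, hcv]; exact ht₂₃
  -- `e(kX) = e(k(X - N))`, as `N` is an integer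
  have hSθ : S = ∑ k ∈ Finset.Icc ⌈t₂ / c⌉₊ ⌊min X (T / c)⌋₊, e (k * θ) := by
    refine Finset.sum_congr rfl fun k _ => ?_
    have : (2 * Real.pi * Complex.I * ((k * X : ℝ) : ℂ)) =
        2 * Real.pi * Complex.I * ((k * θ : ℝ) : ℂ) +
          ((k * N : ℤ) : ℂ) * (2 * Real.pi * Complex.I) := by
      simp only [hθ, hn]; push_cast; ring
    unfold e
    rw [this, Complex.exp_add, Complex.exp_int_mul_two_pi_mul_I, mul_one]
  have hsi := norm_sum_e_sub_integral_le hθ0 hXN (by positivity : 0 ≤ t₂ / c) huv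
  rw [← hSθ] at hsi
  -- the substitution `t = 2πxX/a`
  have hsubst : ((2 * Real.pi / a * sX : ℝ) : ℂ) * ∫ x in (t₂ / c)..(min X (T / c)), e (x * θ) =
      ((1 / sX : ℝ) : ℂ) * ∫ t in t₂..t₃, Complex.exp (Complex.I * t * l') := by
    have h3 := intervalIntegral.smul_integral_comp_mul_left
      (f := fun t : ℝ => Complex.exp (Complex.I * t * l')) (a := t₂ / c) (b := min X (T / c)) c
    rw [hcu, hcv] at h3
    rw [← h3]
    have h4 : ∀ x : ℝ, Complex.exp (Complex.I * ((c * x : ℝ) : ℂ) * l') = e (x * θ) := by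
      intro x
      rw [e_mul_eq_exp]
      congr 1
      have : c * l' = 2 * Real.pi * θ := by rw [hl']; field_simp
      rw [← this]; push_cast; ring
    simp_rw [h4]
    rw [Complex.real_smul, ← mul_assoc, ← Complex.ofReal_mul]
    congr 2
    rw [hc, ← hsXX]
    field_simp
  -- size of the frequencies
  have hlog := log_div_sub_bounds hX0 hN0
  have hll' : |l - l'| ≤ a * (θ ^ 2 / (n * X)) := by
    have e1 : l - l' = a * (Real.log (X / n) - (X - n) / X) := by rw [hl, hl'eq, ← hθ]; ring
    rw [e1, abs_mul, abs_of_pos ha, abs_of_nonneg hlog.1]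
    gcongr
    exact hlog.2
  have hpθ : 0 < |θ| := abs_pos.2 hθ0
  have hlge : a * (|θ| / (2 * X)) ≤ |l| := by
    rw [hl, abs_mul, abs_of_pos ha]
    gcongr
    refine le_trans ?_ (abs_sub_div_max_le_abs_log hX0 hN0)
    gcongr
    exact max_le (by linarith) hNX
  have hl'abs : |l'| = a * (|θ| / X) := by
    rw [hl'eq, abs_div, abs_mul, abs_of_pos ha, abs_of_pos hX0]; ring
  have hlpos : 0 < |l| := lt_of_lt_of_le (by positivity) hlge
  have hl0 : l ≠ 0 := abs_pos.1 hlpos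
  have hfreq : ∀ t, 0 ≤ t → t ≤ 2 * Real.pi / a * X ^ 2 →
      ‖(∫ x in (0 : ℝ)..t, Complex.exp (Complex.I * x * l)) -
      ∫ x in (0 : ℝ)..t, Complex.exp (Complex.I * x * l')‖ ≤ (4 * Real.pi + 8) / a * X := by
    intro t ht ht'
    refine (norm_integral_exp_sub_le hl0 hl'0 t).trans ?_
    rw [abs_of_nonneg ht, hl'abs]
    have e1 : t * |l - l'| / |l| ≤ 4 * Real.pi / a * X := by
      calc _ ≤ (2 * Real.pi / a * X ^ 2) * (a * (θ ^ 2 / (n * X))) / (a * (|θ| / (2 * X))) := by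
            gcongr
        _ = 4 * Real.pi / a * X * (|θ| * X / n) := by
            rw [← sq_abs θ]; field_simp; ring
        _ ≤ 4 * Real.pi / a * X * 1 := by
            gcongr
            rw [div_le_one hN0]
            nlinarith
        _ = _ := mul_one _
    have e2 : 2 * |l - l'| / (|l| * (a * (|θ| / X))) ≤ 8 / a * X := by
      calc _ ≤ 2 * (a * (θ ^ 2 / (n * X))) / (a * (|θ| / (2 * X)) * (a * (|θ| / X))) := by
            gcongr
        _ = 4 / a * (X / n) := by
            rw [← sq_abs θ]; field_simp; ring
        _ ≤ 4 / a * 2 := by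
            gcongr
            rw [div_le_iff₀ hN0]; exact hXN2
        _ ≤ 8 / a * X := by
            have : 0 ≤ 8 / a := by positivity
            have e : 4 / a * 2 = 8 / a := by ring
            rw [e]; nlinarith
    calc _ ≤ _ := add_le_add e1 e2
      _ = _ := by ring
  have hii : ∀ l s t : ℝ, IntervalIntegrable (fun x : ℝ => Complex.exp (Complex.I * x * l))
      volume s t := fun l s t => Continuous.intervalIntegrable (by fun_prop) _ _
  have ht₃X : t₃ ≤ 2 * Real.pi / a * X ^ 2 := min_le_left _ _
  -- the errors from the linearized phase, from the upper limit, from the weight `1/√X` in place of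
  -- `1/√N`, and from the passage between sum and integral
  have D2 : ‖(∫ t in t₂..t₃, Complex.exp (Complex.I * t * l')) -
      ∫ t in t₂..t₃, Complex.exp (Complex.I * t * l)‖ ≤ 2 * ((4 * Real.pi + 8) / a * X) := by
    rw [← intervalIntegral.integral_interval_sub_left (hii l' 0 t₃) (hii l' 0 t₂),
      ← intervalIntegral.integral_interval_sub_left (hii l 0 t₃) (hii l 0 t₂)]
    have e1 := hfreq t₃ (by linarith) ht₃X
    have e2 := hfreq t₂ ht₂.le h1
    rw [norm_sub_rev] at e1
    rw [sub_sub_sub_comm]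
    refine (norm_sub_le _ _).trans ?_
    rw [norm_sub_rev (∫ x in (0 : ℝ)..t₂, Complex.exp (Complex.I * x * l'))]
    linarith
  have D3 : ‖(∫ t in t₂..t₃, Complex.exp (Complex.I * t * l)) -
      ∫ t in t₂..t₃', Complex.exp (Complex.I * t * l)‖ ≤ 3 * Real.pi / a * X := by
    rw [intervalIntegral.integral_interval_sub_left (hii _ _ _) (hii _ _ _)]
    refine (norm_integral_exp_I_mul_le _ _ _).trans ?_
    calc |t₃ - t₃'| ≤ |2 * Real.pi / a * X ^ 2 - 2 * Real.pi / a * n ^ 2| := by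
          have := abs_min_sub_min_le_max (2 * Real.pi / a * X ^ 2) T (2 * Real.pi / a * n ^ 2) T
          rw [sub_self, abs_zero, max_eq_left (abs_nonneg _)] at this
          exact this
      _ = 2 * Real.pi / a * (|θ| * (X + n)) := by
          rw [← mul_sub, abs_mul, abs_of_pos (by positivity : 0 < 2 * Real.pi / a),
            sq_sub_sq, abs_mul, abs_of_pos (by linarith : 0 < X + n)]
          ring
      _ ≤ 2 * Real.pi / a * (1 / 2 * (X + 2 * X)) := by gcongr
      _ = _ := by ring
  have D4 : |1 / sX - 1 / sN| * t₃' ≤ 2 * Real.pi / a * sX := by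
    have e1 : 1 / sX - 1 / sN = -(θ / (sX * sN * (sX + sN))) := by
      rw [hθ, ← hsXX, ← hsNN]
      field_simp
      ring
    rw [e1, abs_neg, abs_div, abs_of_pos (by positivity : 0 < sX * sN * (sX + sN))]
    have e2 : t₃' ≤ 2 * Real.pi / a * n ^ 2 := min_le_left _ _
    calc _ ≤ 1 / 2 / (sX * sN * sN) * (2 * Real.pi / a * n ^ 2) := by
          gcongr
          linarith
      _ = 2 * Real.pi / a * (n / (2 * sX)) := by
          rw [mul_assoc sX, hsNN]; field_simp
      _ ≤ 2 * Real.pi / a * sX := by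
          gcongr
          rw [div_le_iff₀ (by positivity)]
          nlinarith
  have D1 : ‖((2 * Real.pi / a * sX : ℝ) : ℂ) * S - ((2 * Real.pi / a * sX : ℝ) : ℂ) *
      ∫ x in (t₂ / c)..(min X (T / c)), e (x * θ)‖ ≤ 2 * Real.pi / a * sX * 9 := by
    rw [← mul_sub, norm_mul, Complex.norm_real, Real.norm_of_nonneg (by positivity)]
    gcongr
  set J₁ := ∫ t in t₂..t₃, Complex.exp (Complex.I * t * l')
  set J₂ := ∫ t in t₂..t₃, Complex.exp (Complex.I * t * l)
  set J₃ := ∫ t in t₂..t₃', Complex.exp (Complex.I * t * l) with hJ₃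
  have hJ₃n : ‖J₃‖ ≤ t₃' := by
    refine (norm_integral_exp_I_mul_le _ _ _).trans ?_
    rw [abs_of_nonneg (by linarith)]; linarith
  rw [hsubst] at D1
  have hdecomp : ((2 * Real.pi / a * sX : ℝ) : ℂ) * S - ((1 / sN : ℝ) : ℂ) * J₃ =
      (((2 * Real.pi / a * sX : ℝ) : ℂ) * S - ((1 / sX : ℝ) : ℂ) * J₁) +
      ((1 / sX : ℝ) : ℂ) * (J₁ - J₂) + ((1 / sX : ℝ) : ℂ) * (J₂ - J₃) +
      ((1 / sX - 1 / sN : ℝ) : ℂ) * J₃ := by push_cast; ring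
  have hX' : 1 / sX * X = sX := by rw [← hsXX]; field_simp
  have n2 : ‖((1 / sX : ℝ) : ℂ) * (J₁ - J₂)‖ ≤ 2 * ((4 * Real.pi + 8) / a) * sX := by
    rw [norm_mul, Complex.norm_real, Real.norm_of_nonneg (by positivity)]
    calc _ ≤ 1 / sX * (2 * ((4 * Real.pi + 8) / a * X)) := by gcongr
      _ = 2 * ((4 * Real.pi + 8) / a) * (1 / sX * X) := by ring
      _ = _ := by rw [hX']
  have n3 : ‖((1 / sX : ℝ) : ℂ) * (J₂ - J₃)‖ ≤ 3 * Real.pi / a * sX := by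
    rw [norm_mul, Complex.norm_real, Real.norm_of_nonneg (by positivity)]
    calc _ ≤ 1 / sX * (3 * Real.pi / a * X) := by gcongr
      _ = 3 * Real.pi / a * (1 / sX * X) := by ring
      _ = _ := by rw [hX']
  have n4 : ‖((1 / sX - 1 / sN : ℝ) : ℂ) * J₃‖ ≤ 2 * Real.pi / a * sX := by
    rw [norm_mul, Complex.norm_real, Real.norm_eq_abs]
    exact (mul_le_mul_of_nonneg_left hJ₃n (abs_nonneg _)).trans D4
  rw [hdecomp]
  refine (norm_add_le _ _).trans ((add_le_add ((norm_add_le _ _).trans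
    (add_le_add ((norm_add_le _ _).trans (add_le_add D1 n2)) n3)) n4).trans_eq ?_)
  rw [hC₀]; ring

/-! ### Sums of powers over positive integers -/

lemma rpow_succ_le_telescope {δ : ℝ} (hδ : 0 < δ) {x : ℝ} (hx : 0 < x) :
    (x + 1) ^ (-1 - δ) ≤ (x ^ (-δ) - (x + 1) ^ (-δ)) / δ := by
  have hx1 : 0 < x + 1 := by linarith
  have h1 : (x + 1) ^ (-1 - δ) = (x + 1) ^ (-δ) / (x + 1) := by
    rw [show -1 - δ = -δ - 1 by ring, Real.rpow_sub_one hx1.ne']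
  have h2 : 1 + δ / (x + 1) ≤ x ^ (-δ) / (x + 1) ^ (-δ) := by
    rw [← Real.div_rpow hx.le hx1.le, Real.rpow_def_of_pos (div_pos hx hx1)]
    have e1 := Real.log_le_sub_one_of_pos (div_pos hx hx1)
    have e2 : x / (x + 1) - 1 = -(1 / (x + 1)) := by field_simp; ring
    rw [e2] at e1
    have e3 := Real.add_one_le_exp (Real.log (x / (x + 1)) * -δ)
    have e4 : δ / (x + 1) ≤ Real.log (x / (x + 1)) * -δ := by
      have : δ / (x + 1) = δ * (1 / (x + 1)) := by ring
      rw [this]; nlinarith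
    linarith
  have hp : 0 < (x + 1) ^ (-δ) := Real.rpow_pos_of_pos hx1 _
  rw [le_div_iff₀ hp] at h2
  rw [h1, le_div_iff₀ hδ]
  have : (x + 1) ^ (-δ) / (x + 1) * δ = δ / (x + 1) * (x + 1) ^ (-δ) := by ring
  linarith

lemma sum_range_rpow_le {δ : ℝ} (hδ : 0 < δ) {N : ℝ} (hN : 0 < N) (M : ℕ) :
    ∑ k ∈ Finset.range M, (N + k + 1) ^ (-1 - δ) ≤ N ^ (-δ) / δ := by
  have h : ∑ k ∈ Finset.range M, (N + k + 1) ^ (-1 - δ) ≤ (N ^ (-δ) - (N + M) ^ (-δ)) / δ := by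
    induction M with
    | zero => simp
    | succ M ih =>
      rw [Finset.sum_range_succ]
      have := rpow_succ_le_telescope hδ (x := N + M) (by positivity)
      push_cast
      rw [← add_assoc]
      calc _ ≤ (N ^ (-δ) - (N + M) ^ (-δ)) / δ + ((N + M) ^ (-δ) - (N + M + 1) ^ (-δ)) / δ :=
            add_le_add ih this
        _ = _ := by ring
  refine h.trans ?_
  gcongr
  have : 0 ≤ (N + M) ^ (-δ) := by positivity
  linarith

lemma summable_tail_rpow {δ : ℝ} (hδ : 0 < δ) {N : ℝ} (hN : 0 < N) :
    Summable fun k : ℕ => (N + k + 1) ^ (-1 - δ) :=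
  summable_of_sum_range_le (fun k => by positivity) (sum_range_rpow_le hδ hN)

lemma tsum_tail_rpow_le {δ : ℝ} (hδ : 0 < δ) {N : ℝ} (hN : 0 < N) :
    ∑' k : ℕ, (N + k + 1) ^ (-1 - δ) ≤ N ^ (-δ) / δ :=
  Real.tsum_le_of_sum_range_le (fun k => by positivity) (sum_range_rpow_le hδ hN)

/-- The sum `∑_{n ≥ 1} n^{-1-δ}`. -/
noncomputable def zetaSum (δ : ℝ) : ℝ := ∑' n : ℕ+, (n : ℝ) ^ (-1 - δ)

lemma summable_nat_rpow {δ : ℝ} (hδ : 0 < δ) : Summable fun k : ℕ => (k : ℝ) ^ (-1 - δ) :=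
  Real.summable_nat_rpow.2 (by linarith)

lemma summable_pnat_rpow {δ : ℝ} (hδ : 0 < δ) : Summable fun n : ℕ+ => (n : ℝ) ^ (-1 - δ) :=
  (summable_nat_rpow hδ).comp_injective (i := ((↑) : ℕ+ → ℕ)) PNat.coe_injective

lemma zetaSum_eq (δ : ℝ) : zetaSum δ = ∑' k : ℕ, ((k : ℝ) + 1) ^ (-1 - δ) := by
  rw [zetaSum, tsum_pnat_eq_tsum_succ (f := fun k : ℕ => (k : ℝ) ^ (-1 - δ))]
  push_cast; rfl

lemma zetaSum_nonneg (δ : ℝ) : 0 ≤ zetaSum δ := tsum_nonneg fun n => by positivity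

lemma zetaSum_le {δ : ℝ} (hδ : 0 < δ) : zetaSum δ ≤ 1 + 1 / δ := by
  have hs : Summable fun k : ℕ => ((k : ℝ) + 1) ^ (-1 - δ) := by
    have := (summable_nat_add_iff 1).2 (summable_nat_rpow hδ)
    simpa using this
  rw [zetaSum_eq, hs.tsum_eq_zero_add]
  have h1 := tsum_tail_rpow_le hδ one_pos
  rw [Real.one_rpow] at h1
  have h2 : ∀ k : ℕ, (((k + 1 : ℕ) : ℝ) + 1) ^ (-1 - δ) = (1 + (k : ℝ) + 1) ^ (-1 - δ) := by
    intro k; push_cast; ring_nf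
  simp_rw [h2]
  simp only [Nat.cast_zero, zero_add, Real.one_rpow]
  linarith

/-- Shifted sums `∑ |n - N|^{-1-δ}`; the term `n = N` is `0 ^ (-1-δ) = 0`. -/
lemma summable_shift_rpow {δ : ℝ} (hδ : 0 < δ) (N : ℤ) :
    Summable (fun n : ℕ+ => |(n : ℝ) - N| ^ (-1 - δ)) ∧
      ∑' n : ℕ+, |(n : ℝ) - N| ^ (-1 - δ) ≤ 2 * zetaSum δ := by
  have hZ := summable_nat_rpow hδ
  have h0 : (0 : ℝ) ^ (-1 - δ) = 0 := Real.zero_rpow (by linarith)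
  have hs' : Summable fun k : ℕ => ((k : ℝ) + 1) ^ (-1 - δ) := by
    have := (summable_nat_add_iff 1).2 hZ
    simpa using this
  have hneg : ∀ k : ℕ, |((-((k : ℤ) + 1) : ℤ) : ℝ)| ^ (-1 - δ) = ((k : ℝ) + 1) ^ (-1 - δ) := by
    intro k
    push_cast
    rw [abs_neg, abs_of_pos (by positivity)]
  have hpos : ∀ k : ℕ, |((k : ℤ) : ℝ)| ^ (-1 - δ) = (k : ℝ) ^ (-1 - δ) := by
    intro k; rw [Int.cast_natCast, abs_of_nonneg (by positivity)]
  have hsum : HasSum (fun j : ℤ => |(j : ℝ)| ^ (-1 - δ)) (zetaSum δ + zetaSum δ) := by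
    refine HasSum.of_nat_of_neg_add_one ?_ ?_
    · simp_rw [hpos]
      have := hZ.hasSum
      rwa [hZ.tsum_eq_zero_add, Nat.cast_zero, h0, zero_add, show
        ∑' b : ℕ, ((b + 1 : ℕ) : ℝ) ^ (-1 - δ) = zetaSum δ by rw [zetaSum_eq]; push_cast; rfl]
        at this
    · simp_rw [hneg]
      rw [zetaSum_eq]
      exact hs'.hasSum
  have hinj : Function.Injective fun n : ℕ+ => ((n : ℕ) : ℤ) - N := by
    intro m n h
    have : ((m : ℕ) : ℤ) = n := by simpa using h
    exact PNat.coe_injective (by exact_mod_cast this)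
  have hcomp : (fun n : ℕ+ => |(n : ℝ) - N| ^ (-1 - δ)) =
      (fun j : ℤ => |(j : ℝ)| ^ (-1 - δ)) ∘ fun n : ℕ+ => ((n : ℕ) : ℤ) - N := by
    funext n; simp
  constructor
  · rw [hcomp]
    exact hsum.summable.comp_injective hinj
  · have := tsum_comp_le_tsum_of_inj hsum.summable (fun j => by positivity) hinj
    rw [hsum.tsum_eq] at this
    rw [hcomp]
    simp only [Function.comp_def] at this ⊢
    linarith

/-- Rankin's device in the neighbourhood of a pole: `m^{-1-δ} min(m, X) / |m - X|` is bounded by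
two convergent sums, uniformly in the position `X` of the pole. -/
lemma rpow_mul_min_div_le {δ m X N : ℝ} (hδ : 0 < δ) (hm : 1 ≤ m)
    (hXN : |X - N| ≤ 1 / 2) (hmN : 1 ≤ |m - N|) :
    m ^ (-1 - δ) * (min m X / |m - X|) ≤ 4 * (m ^ (-1 - δ) + |m - N| ^ (-1 - δ)) := by
  have hm0 : 0 < m := by linarith
  set j := |m - N| with hj
  have hj0 : 0 < j := by linarith
  have hX := abs_le.1 hXN
  have hjX : j / 2 ≤ |m - X| := by
    have := abs_sub_abs_le_abs_sub (m - N) (X - N)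
    rw [sub_sub_sub_cancel_right] at this
    linarith
  have hjX0 : 0 < |m - X| := by linarith
  have hmin : min m X ≤ m := min_le_left _ _
  have key : m ^ (-1 - δ) * (m / j) ≤ m ^ (-1 - δ) + j ^ (-1 - δ) := by
    have e1 : m ^ (-1 - δ) * (m / j) = m ^ (-δ) * j⁻¹ := by
      rw [show -1 - δ = -δ - 1 by ring, Real.rpow_sub_one hm0.ne']; field_simp
    rw [e1]
    rcases le_total m j with h | h
    · have e2 : m ^ (-δ) * j⁻¹ ≤ m ^ (-δ) * m⁻¹ := by gcongr
      have e3 : m ^ (-δ) * m⁻¹ = m ^ (-1 - δ) := by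
        rw [show -1 - δ = -δ - 1 by ring, Real.rpow_sub_one hm0.ne']; rfl
      have : 0 ≤ j ^ (-1 - δ) := by positivity
      linarith
    · have e2 : m ^ (-δ) * j⁻¹ ≤ j ^ (-δ) * j⁻¹ :=
        mul_le_mul_of_nonneg_right (Real.rpow_le_rpow_of_nonpos hj0 h (neg_nonpos.2 hδ.le))
          (inv_nonneg.2 hj0.le)
      have e3 : j ^ (-δ) * j⁻¹ = j ^ (-1 - δ) := by
        rw [show -1 - δ = -δ - 1 by ring, Real.rpow_sub_one hj0.ne']; rfl
      have : 0 ≤ m ^ (-1 - δ) := by positivity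
      linarith
  calc m ^ (-1 - δ) * (min m X / |m - X|) ≤ m ^ (-1 - δ) * (m / (j / 2)) := by gcongr
    _ = 2 * (m ^ (-1 - δ) * (m / j)) := by field_simp
    _ ≤ 2 * (m ^ (-1 - δ) + j ^ (-1 - δ)) := by gcongr
    _ ≤ _ := by
      have : 0 ≤ m ^ (-1 - δ) + j ^ (-1 - δ) := by positivity
      linarith

/-- Summation over triples, fibrewise over the pairs `(n₂, n₃)`. -/
lemma summable_triple {f : Triple → ℝ} (hf : ∀ n, 0 ≤ f n) {g : ℕ+ × ℕ+ → ℝ}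
    (h : ∀ p, Summable (fun m => f (m, p)) ∧ ∑' m, f (m, p) ≤ g p) (hg : Summable g) :
    Summable f ∧ ∑' n, f n ≤ ∑' p, g p := by
  have h1 : Summable fun x : (ℕ+ × ℕ+) × ℕ+ => f (x.2, x.1) := by
    rw [summable_prod_of_nonneg (fun x => hf _)]
    exact ⟨fun p => (h p).1, hg.of_nonneg_of_le (fun p => tsum_nonneg fun m => hf _)
      fun p => (h p).2⟩
  have h2 : Summable f := (Equiv.prodComm (ℕ+ × ℕ+) ℕ+).summable_iff.1 h1
  refine ⟨h2, ?_⟩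
  rw [← (Equiv.prodComm (ℕ+ × ℕ+) ℕ+).tsum_eq f]
  have h3 : ∑' x : (ℕ+ × ℕ+) × ℕ+, f (Equiv.prodComm (ℕ+ × ℕ+) ℕ+ x) =
      ∑' p, ∑' m, f (m, p) := h1.tsum_prod
  rw [h3]
  exact (h1.prod).tsum_le_tsum (fun p => (h p).2) hg

lemma summable_pair_mul {φ ψ : ℕ+ → ℝ} (hφ0 : ∀ n, 0 ≤ φ n) (hψ0 : ∀ n, 0 ≤ ψ n)
    (hφ : Summable φ) (hψ : Summable ψ) :
    Summable (fun p : ℕ+ × ℕ+ => φ p.1 * ψ p.2) ∧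
      ∑' p : ℕ+ × ℕ+, φ p.1 * ψ p.2 = (∑' n, φ n) * ∑' n, ψ n := by
  have h := hφ.mul_of_nonneg hψ hφ0 hψ0
  exact ⟨h, (hφ.tsum_mul_tsum hψ h).symm⟩

lemma summable_pair_rpow {δ : ℝ} (hδ : 0 < δ) :
    Summable (fun p : ℕ+ × ℕ+ => ((p.1 : ℝ) * p.2) ^ (-1 - δ)) ∧
      ∑' p : ℕ+ × ℕ+, ((p.1 : ℝ) * p.2) ^ (-1 - δ) = zetaSum δ ^ 2 := by
  have h := summable_pair_mul (fun n : ℕ+ => by positivity) (fun n : ℕ+ => by positivity)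
    (summable_pnat_rpow hδ) (summable_pnat_rpow hδ)
  have e : (fun p : ℕ+ × ℕ+ => ((p.1 : ℝ) * p.2) ^ (-1 - δ)) =
      fun p : ℕ+ × ℕ+ => (p.1 : ℝ) ^ (-1 - δ) * (p.2 : ℝ) ^ (-1 - δ) := by
    funext p; rw [Real.mul_rpow (by positivity) (by positivity)]
  rw [e, h.2, ← zetaSum, sq]
  exact ⟨h.1, rfl⟩

/-- `∑ n^{-κ} min(n², T) ≪ T^{(3-κ)/2}` for `1 < κ < 2`, splitting at `n = √T`. -/
lemma exists_tsum_rpow_mul_min_le {κ : ℝ} (h1 : 1 < κ) (h2 : κ < 2) : ∃ C : ℝ, 0 ≤ C ∧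
    ∀ T : ℝ, 1 ≤ T → Summable (fun n : ℕ+ => (n : ℝ) ^ (-κ) * min ((n : ℝ) ^ 2) T) ∧
      ∑' n : ℕ+, (n : ℝ) ^ (-κ) * min ((n : ℝ) ^ 2) T ≤ C * T ^ ((3 - κ) / 2) := by
  have hδ : 0 < κ - 1 := by linarith
  have hκ : -κ = -1 - (κ - 1) := by ring
  refine ⟨1 + 2 ^ (κ - 1) / (κ - 1), by positivity, fun T hT => ?_⟩
  have hT0 : 0 < T := by linarith
  set f : ℕ → ℝ := fun k => (k : ℝ) ^ (-κ) * min ((k : ℝ) ^ 2) T with hf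
  have hf0 : ∀ k, 0 ≤ f k := fun k => mul_nonneg (by positivity) (le_min (by positivity) hT0.le)
  have hfT : ∀ k, f k ≤ T * (k : ℝ) ^ (-1 - (κ - 1)) := by
    intro k
    simp only [hf]
    rw [← hκ, mul_comm]
    gcongr
    exact min_le_right _ _
  have hfs : Summable f := ((summable_nat_rpow hδ).mul_left T).of_nonneg_of_le hf0 hfT
  refine ⟨hfs.comp_injective (i := ((↑) : ℕ+ → ℕ)) PNat.coe_injective, ?_⟩
  rw [show ∑' n : ℕ+, (n : ℝ) ^ (-κ) * min ((n : ℝ) ^ 2) T = ∑' n : ℕ+, f n from rfl,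
    tsum_pnat_eq_tsum_succ (f := f)]
  have hfs1 : Summable fun k => f (k + 1) := (summable_nat_add_iff 1).2 hfs
  set y := √T with hy
  have hy1 : 1 ≤ y := Real.one_le_sqrt.2 hT
  have hyy : y * y = T := Real.mul_self_sqrt hT0.le
  set M := ⌊y⌋₊ with hM
  have hM1 : 1 ≤ M := Nat.one_le_floor_iff _ |>.2 hy1
  have hM1' : (1 : ℝ) ≤ M := by exact_mod_cast hM1
  have hMy : (M : ℝ) ≤ y := Nat.floor_le (by linarith)
  have hyM : y / 2 ≤ M := by
    have := Nat.lt_floor_add_one y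
    rw [← hM] at this
    linarith
  rw [← hfs1.sum_add_tsum_nat_add M]
  have hpow : y ^ (3 - κ) = T ^ ((3 - κ) / 2) := by
    rw [hy, Real.sqrt_eq_rpow, ← Real.rpow_mul hT0.le]; ring_nf
  have hA : ∑ k ∈ Finset.range M, f (k + 1) ≤ y ^ (3 - κ) := by
    calc _ ≤ ∑ k ∈ Finset.range M, y ^ (2 - κ) := by
          refine Finset.sum_le_sum fun k hk => ?_
          have hk' : ((k + 1 : ℕ) : ℝ) ≤ y := by
            have : k + 1 ≤ M := Finset.mem_range.1 hk
            exact (by exact_mod_cast this : ((k + 1 : ℕ) : ℝ) ≤ M).trans hMy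
          have hk0 : (0 : ℝ) < ((k + 1 : ℕ) : ℝ) := by positivity
          simp only [hf]
          calc _ ≤ ((k + 1 : ℕ) : ℝ) ^ (-κ) * ((k + 1 : ℕ) : ℝ) ^ 2 := by
                gcongr; exact min_le_left _ _
            _ = ((k + 1 : ℕ) : ℝ) ^ (2 - κ) := by
                rw [← Real.rpow_natCast (((k + 1 : ℕ) : ℝ)) 2, ← Real.rpow_add hk0]
                congr 1; push_cast; ring
            _ ≤ _ := by gcongr
      _ = M * y ^ (2 - κ) := by simp
      _ ≤ y * y ^ (2 - κ) := by gcongr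
      _ = y ^ (3 - κ) := by
          rw [← Real.rpow_one_add' (by linarith) (by linarith)]; ring_nf
  have hB : ∑' k, f (k + M + 1) ≤ 2 ^ (κ - 1) / (κ - 1) * y ^ (3 - κ) := by
    have hM0 : (0 : ℝ) < M := by linarith
    have hs := (summable_tail_rpow hδ hM0).mul_left T
    calc _ ≤ ∑' k : ℕ, T * ((M : ℝ) + k + 1) ^ (-1 - (κ - 1)) := by
          refine ((summable_nat_add_iff M).2 hfs1).tsum_le_tsum (fun k => ?_) hs
          refine (hfT _).trans_eq ?_
          push_cast; ring_nf
      _ ≤ T * ((M : ℝ) ^ (-(κ - 1)) / (κ - 1)) := by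
          rw [tsum_mul_left]
          gcongr
          exact tsum_tail_rpow_le hδ hM0
      _ ≤ T * ((y / 2) ^ (-(κ - 1)) / (κ - 1)) := by
          have := Real.rpow_le_rpow_of_nonpos (by linarith : 0 < y / 2) hyM
            (neg_nonpos.2 hδ.le)
          gcongr
      _ = _ := by
          have hy0 : 0 < y := by linarith
          rw [Real.div_rpow hy0.le (by norm_num), Real.rpow_neg (by norm_num : (0 : ℝ) ≤ 2),
            ← hyy, show 3 - κ = 2 + -(κ - 1) by ring, Real.rpow_add hy0, Real.rpow_two]
          field_simp
  rw [← hpow]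
  linarith

/-! ### Individual terms of the off-diagonal sum -/

lemma one_le_pnat (n : ℕ+) : (1 : ℝ) ≤ (n : ℝ) := by exact_mod_cast n.pos

lemma rpow_le_X {a b c : ℝ} (ha : 0 < a) (hcb : c ≤ b) (n₂ n₃ : ℕ+) :
    ((n₂ : ℝ) * n₃) ^ (c / a) ≤ X a b c n₂ n₃ := by
  rw [X, Real.mul_rpow (by positivity) (by positivity)]
  gcongr
  exact one_le_pnat n₂

lemma le_rpow_of_one_le {x ρ : ℝ} (hx : 1 ≤ x) (hρ : 1 ≤ ρ) : x ≤ x ^ ρ := by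
  simpa using Real.rpow_le_rpow_of_exponent_le hx hρ

lemma mul_le_X {a b c : ℝ} (ha : 0 < a) (hac : a < c) (hcb : c ≤ b) (n₂ n₃ : ℕ+) :
    (n₂ : ℝ) * n₃ ≤ X a b c n₂ n₃ := by
  refine le_trans ?_ (rpow_le_X ha hcb n₂ n₃)
  exact le_rpow_of_one_le (one_le_mul_of_one_le_of_one_le (one_le_pnat _) (one_le_pnat _))
    ((one_le_div ha).2 hac.le)

/-- Since `n₂n₃ ≤ X` is an integer, it is also at most the nearest integer to `X`. -/
lemma mul_le_N1 {a b c : ℝ} (ha : 0 < a) (hac : a < c) (hcb : c ≤ b) (n₂ n₃ : ℕ+) :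
    (n₂ : ℝ) * n₃ ≤ N1 a b c n₂ n₃ := by
  have h := mul_le_X ha hac hcb n₂ n₃
  have : ((n₂ * n₃ : ℕ) : ℤ) ≤ N1 a b c n₂ n₃ := by
    rw [N1, round_eq, Int.le_floor]
    push_cast; linarith
  exact_mod_cast this

lemma one_le_N1 {a b c : ℝ} (ha : 0 < a) (hac : a < c) (hcb : c ≤ b) (n₂ n₃ : ℕ+) :
    (1 : ℝ) ≤ N1 a b c n₂ n₃ :=
  (one_le_mul_of_one_le_of_one_le (one_le_pnat n₂) (one_le_pnat n₃)).trans
    (mul_le_N1 ha hac hcb n₂ n₃)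

lemma one_le_X {a b c : ℝ} (ha : 0 < a) (hac : a < c) (hcb : c ≤ b) (n₂ n₃ : ℕ+) :
    1 ≤ X a b c n₂ n₃ :=
  (one_le_mul_of_one_le_of_one_le (one_le_pnat n₂) (one_le_pnat n₃)).trans
    (mul_le_X ha hac hcb n₂ n₃)

lemma left_le_mul_pnat (n₂ n₃ : ℕ+) : (n₂ : ℝ) ≤ n₂ * n₃ :=
  le_mul_of_one_le_right (by positivity) (one_le_pnat n₃)

lemma right_le_mul_pnat (n₂ n₃ : ℕ+) : (n₃ : ℝ) ≤ n₂ * n₃ :=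
  le_mul_of_one_le_left (by positivity) (one_le_pnat n₂)

lemma log_X {a b c : ℝ} (n₂ n₃ : ℕ+) :
    Real.log (X a b c n₂ n₃) = b / a * Real.log n₂ + c / a * Real.log n₃ := by
  have h2 : (0 : ℝ) < n₂ := by positivity
  have h3 : (0 : ℝ) < n₃ := by positivity
  rw [X, Real.log_mul (by positivity) (by positivity), Real.log_rpow h2, Real.log_rpow h3]

lemma X_pos (a b c : ℝ) (n₂ n₃ : ℕ+) : 0 < X a b c n₂ n₃ := by unfold X; positivity

/-- The oscillating factor in terms of `X = n₂^{b/a} n₃^{c/a}`: the frequency is `a log (X / n₁)`,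
small exactly when `n₁` is close to `X`. -/
lemma La_cpow_eq {a b c : ℝ} (ha : 0 < a) (n : Triple) (t : ℝ) :
    (La a b c n : ℂ) ^ (Complex.I * t) =
      Complex.exp (Complex.I * t * (a * Real.log (X a b c n.2.1 n.2.2 / n.1) : ℝ)) := by
  have h1 : (0 : ℝ) < n.1 := by positivity
  have h2 : (0 : ℝ) < n.2.1 := by positivity
  have h3 : (0 : ℝ) < n.2.2 := by positivity
  have hX := X_pos a b c n.2.1 n.2.2
  have hL : 0 < La a b c n := by unfold La; positivity
  have hlog : Real.log (La a b c n) = a * Real.log (X a b c n.2.1 n.2.2 / n.1) := by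
    rw [Real.log_div hX.ne' h1.ne', log_X, La, Real.log_mul (by positivity) (by positivity),
      Real.log_mul (by positivity) (by positivity), Real.log_rpow h1, Real.log_rpow h2,
      Real.log_rpow h3]
    field_simp
    ring
  rw [Complex.cpow_def_of_ne_zero (by exact_mod_cast hL.ne'), ← Complex.ofReal_log hL.le, hlog]
  congr 1; ring

lemma X_rpow {a b c : ℝ} (ha : 0 < a) (n₂ n₃ : ℕ+) :
    X a b c n₂ n₃ ^ a = (n₂ : ℝ) ^ b * (n₃ : ℝ) ^ c := by
  rw [X, Real.mul_rpow (by positivity) (by positivity), ← Real.rpow_mul (by positivity),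
    ← Real.rpow_mul (by positivity), div_mul_cancel₀ _ ha.ne', div_mul_cancel₀ _ ha.ne']

lemma L_eq {a b c : ℝ} (ha : 0 < a) {n₂ n₃ : ℕ+} (hN : (1 : ℝ) ≤ N1 a b c n₂ n₃) :
    L a b c n₂ n₃ = a * Real.log (X a b c n₂ n₃ / N1 a b c n₂ n₃) := by
  have hX := X_pos a b c n₂ n₃
  have hN0 : (0 : ℝ) < N1 a b c n₂ n₃ := by linarith
  rw [L, ← X_rpow ha, ← Real.div_rpow hX.le hN0.le, Real.log_rpow (by positivity)]

lemma mem_offDiagonal_iff {a b c : ℝ} (ha : 0 < a) (n : Triple) :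
    n ∈ offDiagonal a b c ↔ X a b c n.2.1 n.2.2 ≠ n.1 := by
  have hX := X_pos a b c n.2.1 n.2.2
  unfold offDiagonal
  rw [mem_ofPred_eq, ← X_rpow ha, not_iff_not, Real.rpow_left_inj (by positivity) hX.le ha.ne',
    eq_comm]

lemma cutoffSize_le_rpow {T x θ : ℝ} (hT : 0 < T) (hx : 0 < x) (h0 : 0 ≤ θ) (h1 : θ ≤ 1) :
    cutoffSize T x ≤ (T ^ (3 / 2 : ℝ) / x) ^ θ := by
  have hy : 0 < T ^ (3 / 2 : ℝ) / x := by positivity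
  unfold cutoffSize
  rcases le_total 1 (T ^ (3 / 2 : ℝ) / x) with h | h
  · exact (min_le_left _ _).trans (Real.one_le_rpow h h0)
  · refine (min_le_right _ _).trans ?_
    simpa using Real.rpow_le_rpow_of_exponent_ge hy h h1

lemma P_pos (n : Triple) : 0 < P n := by unfold P; positivity

lemma I12Term_eq {a b c : ℝ} (ha : 0 < a) (coef : ℕ → ℕ → ℂ) (T : ℝ) (n : Triple) :
    I12Term a b c coef T n = ((P n ^ (-(1 / 2) : ℝ) : ℝ) : ℂ) * ∫ t in (1 : ℝ)..T,
      Complex.exp (Complex.I * t * (a * Real.log (X a b c n.2.1 n.2.2 / n.1) : ℝ)) *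
        W1 a b c coef (P n) t := by
  unfold I12Term I12Integrand
  simp_rw [La_cpow_eq ha]

/-- The terms with `n₁ ≠ N₁`: bounded variation of the cutoff gives
`P^{-1/2} min(1, T^{3/2} / P) / |log L_𝐚(𝐧)|`, to which Rankin's device is applied. -/
lemma exists_I12Term_le {a b c : ℝ} (ha : 0 < a) (hac : a < c) (hcb : c ≤ b)
    (coef : ℕ → ℕ → ℂ) : ∃ C : ℝ, 0 ≤ C ∧ ∀ (T δ : ℝ) (n : Triple), 1 ≤ T → 0 < δ → δ ≤ 1 / 2 →
      ((n.1 : ℕ) : ℤ) ≠ N1 a b c n.2.1 n.2.2 → ‖I12Term a b c coef T n‖ ≤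
        C * T ^ (3 / 4 + 3 / 2 * δ) * (((n.2.1 : ℝ) * n.2.2) ^ (-1 - δ) *
          ((n.1 : ℝ) ^ (-1 - δ) + |(n.1 : ℝ) - N1 a b c n.2.1 n.2.2| ^ (-1 - δ))) := by
  have hc : 0 < c := ha.trans hac
  have hb : 0 < b := hc.trans_le hcb
  obtain ⟨C, hC, hW⟩ := exists_W1_integral_bounds ha hb hc coef
  refine ⟨C / a * 5, by positivity, fun T δ n hT hδ hδ1 hne => ?_⟩
  obtain ⟨m, p⟩ := n
  simp only at hne ⊢
  have hT0 : 0 < T := by linarith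
  have hP := P_pos (m, p)
  have hX1 := one_le_X ha hac hcb p.1 p.2
  have hXN : |X a b c p.1 p.2 - N1 a b c p.1 p.2| ≤ 1 / 2 := abs_sub_round _
  set x := X a b c p.1 p.2
  set N := N1 a b c p.1 p.2
  have hm1 := one_le_pnat m
  have hm0 : (0 : ℝ) < m := by linarith
  have hx0 : 0 < x := by linarith
  have hmN : (1 : ℝ) ≤ |(m : ℝ) - N| := by
    have : (1 : ℤ) ≤ |((m : ℕ) : ℤ) - N| := Int.one_le_abs (sub_ne_zero.2 hne)
    have h2 : ((1 : ℤ) : ℝ) ≤ ((|((m : ℕ) : ℤ) - N| : ℤ) : ℝ) := by exact_mod_cast this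
    push_cast at h2
    exact h2
  have hmx : 0 < |x - m| := by
    have := abs_sub_abs_le_abs_sub ((m : ℝ) - N) (x - N)
    rw [sub_sub_sub_cancel_right, abs_sub_comm (m : ℝ) x] at this
    linarith
  have hlog : |x - m| / max x m ≤ |Real.log (x / m)| := abs_sub_div_max_le_abs_log hx0 hm0
  have hmax : 0 < max x m := lt_max_of_lt_left hx0
  have hlog0 : 0 < |Real.log (x / m)| := lt_of_lt_of_le (by positivity) hlog
  have hl : a * Real.log (x / m) ≠ 0 := mul_ne_zero ha.ne' (abs_pos.1 hlog0)
  have hinv : 1 / |a * Real.log (x / m)| ≤ 1 / a * (1 + min (m : ℝ) x / |m - x|) := by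
    rw [abs_mul, abs_of_pos ha, one_div, mul_inv, ← one_div]
    gcongr
    have e1 : |Real.log (x / m)|⁻¹ ≤ (|x - m| / max x m)⁻¹ := by gcongr
    refine e1.trans_eq ?_
    rw [inv_div]
    have e2 : max x m = |x - m| + min (m : ℝ) x := by
      rcases le_total x m with h | h
      · rw [max_eq_right h, min_eq_right h, abs_of_nonpos (by linarith)]; ring
      · rw [max_eq_left h, min_eq_left h, abs_of_nonneg (by linarith)]; ring
    rw [e2, add_div, div_self hmx.ne', abs_sub_comm]
  have hsize : P (m, p) ^ (-(1 / 2) : ℝ) * cutoffSize T (P (m, p)) ≤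
      T ^ (3 / 4 + 3 / 2 * δ) * (((p.1 : ℝ) * p.2) ^ (-1 - δ) * (m : ℝ) ^ (-1 - δ)) := by
    calc _ ≤ P (m, p) ^ (-(1 / 2) : ℝ) * (T ^ (3 / 2 : ℝ) / P (m, p)) ^ (1 / 2 + δ) := by
          gcongr
          exact cutoffSize_le_rpow hT0 hP (by linarith) (by linarith)
      _ = (T ^ (3 / 2 : ℝ)) ^ (1 / 2 + δ) * P (m, p) ^ (-1 - δ) := by
          rw [Real.div_rpow (by positivity) hP.le, show -1 - δ = -(1 / 2) - (1 / 2 + δ) by ring,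
            Real.rpow_sub hP]
          ring
      _ = _ := by
          rw [← Real.rpow_mul hT0.le, show P (m, p) = ((p.1 : ℝ) * p.2) * m by
            simp only [P]; ring, Real.mul_rpow (by positivity) hm0.le]
          congr 2; ring
  have hr := rpow_mul_min_div_le hδ hm1 hXN hmN
  have hW3 := (hW (P (m, p)) T hP hT).2.2 _ hl
  rw [I12Term_eq ha, norm_mul, Complex.norm_real, Real.norm_of_nonneg (by positivity)]
  simp only
  set q := ((p.1 : ℝ) * p.2) ^ (-1 - δ) with hq
  have hq0 : 0 ≤ q := by positivity
  have hmp : 0 ≤ (m : ℝ) ^ (-1 - δ) := by positivity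
  have hNp : 0 ≤ |(m : ℝ) - N| ^ (-1 - δ) := by positivity
  have hmm : 0 ≤ min (m : ℝ) x / |m - x| := div_nonneg (le_min hm0.le hx0.le) (abs_nonneg _)
  calc _ ≤ P (m, p) ^ (-(1 / 2) : ℝ) * (C * (cutoffSize T (P (m, p)) /
          |a * Real.log (x / m)|)) := mul_le_mul_of_nonneg_left hW3 (by positivity)
    _ = C * (P (m, p) ^ (-(1 / 2) : ℝ) * cutoffSize T (P (m, p))) *
          (1 / |a * Real.log (x / m)|) := by ring
    _ ≤ C * (T ^ (3 / 4 + 3 / 2 * δ) * (q * (m : ℝ) ^ (-1 - δ))) *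
          (1 / a * (1 + min (m : ℝ) x / |m - x|)) := by gcongr
    _ = C / a * T ^ (3 / 4 + 3 / 2 * δ) * (q * ((m : ℝ) ^ (-1 - δ) +
          (m : ℝ) ^ (-1 - δ) * (min (m : ℝ) x / |m - x|))) := by ring
    _ ≤ C / a * T ^ (3 / 4 + 3 / 2 * δ) * (q * (5 * ((m : ℝ) ^ (-1 - δ) +
          |(m : ℝ) - N| ^ (-1 - δ)))) := by
        gcongr
        linarith
    _ = _ := by ring

/-- The nearest integer `N₁` to `n₂^{b/a} n₃^{c/a}`, as a positive integer. -/
noncomputable def nearest (a b c : ℝ) (p : ℕ+ × ℕ+) : ℕ+ := (N1 a b c p.1 p.2).toNat.toPNat'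

lemma nearest_cast {a b c : ℝ} (ha : 0 < a) (hac : a < c) (hcb : c ≤ b) (p : ℕ+ × ℕ+) :
    ((nearest a b c p : ℕ) : ℤ) = N1 a b c p.1 p.2 := by
  have h : (1 : ℤ) ≤ N1 a b c p.1 p.2 := by exact_mod_cast one_le_N1 ha hac hcb p.1 p.2
  rw [nearest, PNat.toPNat'_coe (by omega)]
  omega

lemma nearest_real {a b c : ℝ} (ha : 0 < a) (hac : a < c) (hcb : c ≤ b) (p : ℕ+ × ℕ+) :
    (nearest a b c p : ℝ) = N1 a b c p.1 p.2 := by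
  have := nearest_cast ha hac hcb p
  exact_mod_cast congrArg (Int.cast : ℤ → ℝ) this

/-- `2π max(n₂²/b, n₃²/c)`, the part of `N_𝐧` that depends on `n₂, n₃` only. -/
noncomputable def pairTime (b c : ℝ) (p : ℕ+ × ℕ+) : ℝ :=
  2 * Real.pi * max ((p.1 : ℝ) ^ 2 / b) ((p.2 : ℝ) ^ 2 / c)

lemma pairTime_pos {b c : ℝ} (hc : 0 < c) (p : ℕ+ × ℕ+) : 0 < pairTime b c p := by
  have hpi := Real.pi_pos
  have : 0 < max ((p.1 : ℝ) ^ 2 / b) ((p.2 : ℝ) ^ 2 / c) := lt_max_of_lt_right (by positivity)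
  unfold pairTime
  positivity

lemma pairTime_le {a b c : ℝ} (ha : 0 < a) (hac : a < c) (hcb : c ≤ b) (p : ℕ+ × ℕ+) {y : ℝ}
    (hy : (p.1 : ℝ) * p.2 ≤ y) : pairTime b c p ≤ 2 * Real.pi / a * y ^ 2 := by
  have hc : 0 < c := ha.trans hac
  have hpi := Real.pi_pos
  have h1 : (p.1 : ℝ) ≤ y := (left_le_mul_pnat _ _).trans hy
  have h2 : (p.2 : ℝ) ≤ y := (right_le_mul_pnat _ _).trans hy
  unfold pairTime
  rw [div_mul_eq_mul_div, mul_div_assoc]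
  have hy0 : 0 ≤ y := le_trans (by positivity) h1
  gcongr
  refine max_le ?_ ?_ <;> gcongr
  linarith

/-- For `n₁ = N₁` the maximum in `N_𝐧` is attained at `n₁²/a`, because `n₂, n₃ ≤ N₁` and
`a ≤ b, c`. -/
lemma Nn_nearest {a b c : ℝ} (ha : 0 < a) (hac : a < c) (hcb : c ≤ b) (p : ℕ+ × ℕ+) :
    Nn a b c (nearest a b c p, p) = 2 * Real.pi / a * (N1 a b c p.1 p.2 : ℝ) ^ 2 := by
  have h := pairTime_le ha hac hcb p (mul_le_N1 ha hac hcb p.1 p.2)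
  have hpi := Real.pi_pos
  unfold pairTime at h
  unfold Nn
  simp only
  rw [nearest_real ha hac hcb, max_eq_left]
  · ring
  · rw [div_mul_eq_mul_div, mul_div_assoc] at h
    exact le_of_mul_le_mul_left h (by positivity)

/-- The part of `M₁(T)` belonging to the pair `(n₂, n₃)`. -/
noncomputable def M1Pair (a b c T : ℝ) (p : ℕ+ × ℕ+) : ℂ :=
  ((1 / √((p.1 : ℝ) * p.2) : ℝ) : ℂ) * (((2 * Real.pi / a * √(X a b c p.1 p.2) : ℝ) : ℂ) *
    ∑ k ∈ Finset.Icc ⌈pairTime b c p / (2 * Real.pi * X a b c p.1 p.2 / a)⌉₊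
      ⌊min (X a b c p.1 p.2) (T / (2 * Real.pi * X a b c p.1 p.2 / a))⌋₊,
      e (k * X a b c p.1 p.2))

/-- The part of `J_{2,2}(T)` belonging to the pair `(n₂, n₃)`. -/
noncomputable def J22Pair (a b c T : ℝ) (p : ℕ+ × ℕ+) : ℂ :=
  ((P (nearest a b c p, p) ^ (-(1 / 2) : ℝ) : ℝ) : ℂ) *
    ∫ t in (min (Nn a b c (nearest a b c p, p)) T)..T,
      Complex.exp (Complex.I * t * L a b c p.1 p.2)

/-- An integral over `[1, T]` against the indicator of `t ≥ t₀`. Clamping the lower limit to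
`[1, T]` covers all positions of `t₀`. -/
lemma integral_indicator_eq {l t₀ T : ℝ} (hT : 1 ≤ T) :
    ∫ t in (1 : ℝ)..T, Complex.exp (Complex.I * t * l) * (if t₀ ≤ t then 1 else 0) =
      ∫ t in (min (max 1 t₀) T)..T, Complex.exp (Complex.I * t * l) := by
  set s := min (max 1 t₀) T
  have hs1 : 1 ≤ s := le_min (le_max_left _ _) hT
  have hsT : s ≤ T := min_le_right _ _
  have hind : Measurable fun t : ℝ => (if t₀ ≤ t then (1 : ℂ) else 0) :=
    Measurable.ite measurableSet_Ici measurable_const measurable_const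
  have hii : ∀ u v : ℝ, IntervalIntegrable (fun t : ℝ =>
      Complex.exp (Complex.I * t * l) * (if t₀ ≤ t then 1 else 0)) volume u v := by
    intro u v
    refine (intervalIntegrable_const (c := (1 : ℝ))).mono_fun' ?_
      (Eventually.of_forall fun t => ?_)
    · exact ((by fun_prop : Continuous fun t : ℝ =>
        Complex.exp (Complex.I * t * l)).measurable.mul hind).aestronglyMeasurable
    · dsimp only
      rw [norm_mul, norm_exp_I_mul_mul, one_mul]
      split_ifs <;> simp
  rw [← intervalIntegral.integral_add_adjacent_intervals (hii 1 s) (hii s T)]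
  have h1 : ∫ t in (1 : ℝ)..s, Complex.exp (Complex.I * t * l) * (if t₀ ≤ t then 1 else 0) = 0 := by
    have : ∫ t in (1 : ℝ)..s, Complex.exp (Complex.I * t * l) * (if t₀ ≤ t then 1 else 0) =
        ∫ t in (1 : ℝ)..s, (0 : ℂ) := by
      refine intervalIntegral.integral_congr_ae ?_
      filter_upwards [compl_mem_ae_iff.2 (measure_singleton s)] with t ht hmem
      rw [uIoc_of_le hs1] at hmem
      have hts : t < s := lt_of_le_of_ne hmem.2 ht
      have h3 : t < max 1 t₀ := hts.trans_le (min_le_left _ _)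
      have h4 : t < t₀ := (lt_max_iff.1 h3).resolve_left (not_lt.2 hmem.1.le)
      rw [if_neg (not_le.2 h4), mul_zero]
    rw [this, intervalIntegral.integral_zero]
  rw [h1, zero_add]
  refine intervalIntegral.integral_congr_ae (Eventually.of_forall fun t hmem => ?_)
  rw [uIoc_of_le hsT] at hmem
  have h5 : s < T := hmem.1.trans_le hmem.2
  have h6 : s = max 1 t₀ := by
    rcases min_choice (max 1 t₀) T with h | h
    · exact h
    · exact absurd h h5.ne
  have h7 : t₀ ≤ t := ((le_max_right 1 t₀).trans_eq h6.symm).trans hmem.1.le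
  rw [if_pos h7, mul_one]

/-- The terms with `n₁ = N₁` against the corresponding parts of `M₁` and `J_{2,2}`. The four errors
come from smoothing the cutoff, from its location `t₀`, from the lower end `2π max(n₂²/b, n₃²/c)` of
the sum `M₁`, and from the passage between sum and integral. -/
lemma exists_pair_estimate {a b c : ℝ} (ha : 0 < a) (hac : a < c) (hcb : c ≤ b)
    (coef : ℕ → ℕ → ℂ) : ∃ C : ℝ, 0 ≤ C ∧ ∀ (T : ℝ) (p : ℕ+ × ℕ+), 1 ≤ T →
      X a b c p.1 p.2 ≠ N1 a b c p.1 p.2 →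
      ‖M1Pair a b c T p + J22Pair a b c T p - I12Term a b c coef T (nearest a b c p, p)‖ ≤
        C * (√T * (P (nearest a b c p, p) ^ (-(1 / 2) : ℝ) *
            cutoffSize T (P (nearest a b c p, p))) +
          P (nearest a b c p, p) ^ (-(1 / 2) : ℝ) *
            min (cutoffTime a b c (P (nearest a b c p, p))) T +
          P (nearest a b c p, p) ^ (-(1 / 2) : ℝ) * min (pairTime b c p) T +
          1 / √((p.1 : ℝ) * p.2) * min (√(X a b c p.1 p.2)) (T / √(X a b c p.1 p.2))) := by
  have hc : 0 < c := ha.trans hac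
  have hb : 0 < b := hc.trans_le hcb
  have hpi := Real.pi_pos
  obtain ⟨C₁, hC₁, hW⟩ := exists_W1_integral_bounds ha hb hc coef
  obtain ⟨C₂, hC₂, hD⟩ := exists_dual_sum_sub_integral_le ha
  refine ⟨C₁ + C₂ + (2 + c), by positivity, fun T p hT hne => ?_⟩
  have hT0 : 0 < T := by linarith
  have hX1 := one_le_X ha hac hcb p.1 p.2
  have hN1 := one_le_N1 ha hac hcb p.1 p.2
  have hXN : |X a b c p.1 p.2 - N1 a b c p.1 p.2| ≤ 1 / 2 := abs_sub_round _
  have hPP : P (nearest a b c p, p) ^ (-(1 / 2) : ℝ) =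
      1 / √((p.1 : ℝ) * p.2) * (1 / √(N1 a b c p.1 p.2 : ℝ)) := by
    have : P (nearest a b c p, p) = ((p.1 : ℝ) * p.2) * N1 a b c p.1 p.2 := by
      simp only [P]; rw [nearest_real ha hac hcb]; ring
    rw [this, Real.rpow_neg (by positivity), ← Real.sqrt_eq_rpow, Real.sqrt_mul (by positivity)]
    rw [mul_inv]; simp
  have hP := P_pos (nearest a b c p, p)
  have ht₂ : 0 < pairTime b c p := pairTime_pos hc p
  have hDp := hD (X a b c p.1 p.2) (pairTime b c p) T (N1 a b c p.1 p.2) hX1 hN1 hXN hne ht₂ hT0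
    (pairTime_le ha hac hcb p (mul_le_X ha hac hcb p.1 p.2))
    (pairTime_le ha hac hcb p (mul_le_N1 ha hac hcb p.1 p.2))
  -- absorbs the unit lost because the integrals in `I_{1,2}` start at `1`
  have ht₂1 : 1 ≤ (1 + c) * min (pairTime b c p) T := by
    have h1 : 2 * Real.pi / c ≤ pairTime b c p := by
      have : 1 / c ≤ max ((p.1 : ℝ) ^ 2 / b) ((p.2 : ℝ) ^ 2 / c) := by
        refine le_max_of_le_right ?_
        gcongr
        exact one_le_pow₀ (one_le_pnat _)
      calc 2 * Real.pi / c = 2 * Real.pi * (1 / c) := by ring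
        _ ≤ _ := by unfold pairTime; gcongr
    rcases min_choice (pairTime b c p) T with h | h <;> rw [h]
    · have h2 : c * (2 * Real.pi / c) = 2 * Real.pi := by field_simp
      have h3 := Real.pi_gt_three
      nlinarith
    · nlinarith
  have hL := L_eq ha hN1
  have hI := I12Term_eq ha coef T (nearest a b c p, p) (b := b) (c := c)
  simp only [nearest_real ha hac hcb] at hI
  rw [← hL] at hI hDp
  rw [hI]
  unfold M1Pair J22Pair
  rw [Nn_nearest ha hac hcb]
  obtain ⟨-, hW2, -⟩ := hW _ T hP hT
  set Pm := P (nearest a b c p, p) ^ (-(1 / 2) : ℝ) with hPm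
  have hPm0 : 0 ≤ Pm := by positivity
  set Pn := P (nearest a b c p, p)
  set sq := 1 / √((p.1 : ℝ) * p.2) with hsq
  have hsq0 : 0 ≤ sq := by positivity
  set l := L a b c p.1 p.2
  set x := X a b c p.1 p.2
  set t₂ := pairTime b c p
  set t₀ := cutoffTime a b c Pn
  have ht₀ : 0 < t₀ := cutoffTime_pos ha hb hc hP
  set Nt := 2 * Real.pi / a * (N1 a b c p.1 p.2 : ℝ) ^ 2
  set f : ℝ → ℂ := fun t => Complex.exp (Complex.I * t * l) with hf
  have hfc : Continuous f := by simp only [hf]; fun_prop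
  have hii : ∀ u v, IntervalIntegrable f volume u v := fun u v => hfc.intervalIntegrable u v
  set s := min (max 1 t₀) T with hs
  set Q := ((2 * Real.pi / a * √x : ℝ) : ℂ) * ∑ k ∈ Finset.Icc ⌈t₂ / (2 * Real.pi * x / a)⌉₊
      ⌊min x (T / (2 * Real.pi * x / a))⌋₊, e (k * x)
  have hind : Measurable fun t : ℝ => (if t₀ ≤ t then (1 : ℂ) else 0) :=
    Measurable.ite measurableSet_Ici measurable_const measurable_const
  have hWc := (continuousOn_W1 ha hb hc coef hP).mono (uIcc_one_subset hT)
  have hindi : IntervalIntegrable (fun t : ℝ => (if t₀ ≤ t then (1 : ℂ) else 0)) volume 1 T := by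
    refine (intervalIntegrable_const (c := (1 : ℝ))).mono_fun' hind.aestronglyMeasurable
      (Eventually.of_forall fun t => ?_)
    dsimp only
    split_ifs <;> simp
  have hsplit : ∫ t in (1 : ℝ)..T, f t * W1 a b c coef Pn t =
      (∫ t in s..T, f t) +
        ∫ t in (1 : ℝ)..T, f t * (W1 a b c coef Pn t - if t₀ ≤ t then 1 else 0) := by
    rw [hs, ← integral_indicator_eq hT, ← intervalIntegral.integral_add]
    · congr 1; funext t; simp only [hf]; ring
    · exact hindi.continuousOn_mul hfc.continuousOn
    · exact (hWc.intervalIntegrable.sub hindi).continuousOn_mul hfc.continuousOn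
  have hB : ‖∫ t in (1 : ℝ)..T, f t * (W1 a b c coef Pn t - if t₀ ≤ t then 1 else 0)‖ ≤
      C₁ * (√T * cutoffSize T Pn) := by
    refine (intervalIntegral.norm_integral_le_integral_norm hT).trans (le_trans (le_of_eq ?_) hW2)
    congr 1; funext t
    simp only [hf]
    rw [norm_mul, norm_exp_I_mul_mul, one_mul]
  have hA : ‖(∫ t in (min t₂ T)..T, f t) - ∫ t in s..T, f t‖ ≤ min t₀ T + (2 + c) * min t₂ T := by
    have e1 : (∫ t in (min t₂ T)..T, f t) - ∫ t in s..T, f t = ∫ t in (min t₂ T)..s, f t := by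
      rw [← intervalIntegral.integral_add_adjacent_intervals (hii (min t₂ T) s) (hii s T)]
      ring
    rw [e1]
    refine (norm_integral_exp_I_mul_le _ _ _).trans ?_
    have e2 : 0 < min t₂ T := lt_min ht₂ hT0
    have e3 : 0 < s := lt_min (lt_max_of_lt_left one_pos) hT0
    have e4 : s ≤ min t₀ T + 1 := by
      rcases le_total t₀ T with h | h
      · rw [min_eq_left h]
        exact (min_le_left _ _).trans (max_le (by linarith) (by linarith))
      · rw [min_eq_right h]
        exact (min_le_right _ _).trans (by linarith)
    have e5 : 0 < min t₀ T := lt_min ht₀ hT0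
    rw [abs_le]
    constructor <;> nlinarith
  -- the dual sum stands for the integral from `t₂` to `2πN₁²/a` and completes that of `J_{2,2}` to
  -- one from `t₂`; its lower limit is then moved to `t₀`, where the cutoff switches on
  have hdecomp : (sq : ℂ) * Q + (Pm : ℂ) * (∫ t in (min Nt T)..T, f t) -
      (Pm : ℂ) * ∫ t in (1 : ℝ)..T, f t * W1 a b c coef Pn t =
      (sq : ℂ) * (Q - ((1 / √(N1 a b c p.1 p.2 : ℝ) : ℝ) : ℂ) *
        ∫ t in (min t₂ T)..(min Nt T), f t) +
      (Pm : ℂ) * ((∫ t in (min t₂ T)..T, f t) - ∫ t in s..T, f t) -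
      (Pm : ℂ) * ∫ t in (1 : ℝ)..T, f t * (W1 a b c coef Pn t - if t₀ ≤ t then 1 else 0) := by
    rw [hsplit, ← intervalIntegral.integral_add_adjacent_intervals (hii (min t₂ T) (min Nt T))
      (hii (min Nt T) T)]
    have : (Pm : ℂ) = (sq : ℂ) * ((1 / √(N1 a b c p.1 p.2 : ℝ) : ℝ) : ℂ) := by
      rw [hPP]; push_cast; ring
    rw [this]
    ring
  rw [hdecomp]
  have hPmn : ‖(Pm : ℂ)‖ = Pm := by rw [Complex.norm_real, Real.norm_of_nonneg hPm0]
  have hsqn : ‖(sq : ℂ)‖ = sq := by rw [Complex.norm_real, Real.norm_of_nonneg hsq0]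
  have n1 := mul_le_mul_of_nonneg_left hDp hsq0
  have n2 := mul_le_mul_of_nonneg_left hA hPm0
  have n3 := mul_le_mul_of_nonneg_left hB hPm0
  refine (norm_sub_le _ _).trans ((add_le_add_left (norm_add_le _ _) _).trans ?_)
  rw [norm_mul, norm_mul, norm_mul, hPmn, hsqn]
  refine (add_le_add (add_le_add n1 n2) n3).trans ?_
  have p1 : 0 ≤ √T * (Pm * cutoffSize T Pn) :=
    mul_nonneg (Real.sqrt_nonneg _) (mul_nonneg hPm0 (cutoffSize_pos hT0 hP).le)
  have p2 : 0 ≤ Pm * min t₀ T := mul_nonneg hPm0 (le_min ht₀.le hT0.le)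
  have p3 : 0 ≤ Pm * min t₂ T := mul_nonneg hPm0 (le_min ht₂.le hT0.le)
  have p4 : 0 ≤ sq * min √x (T / √x) :=
    mul_nonneg hsq0 (le_min (Real.sqrt_nonneg _) (by positivity))
  nlinarith [mul_nonneg hC₁ p2, mul_nonneg hC₁ p3, mul_nonneg hC₁ p4, mul_nonneg hC₂ p1,
    mul_nonneg hC₂ p2, mul_nonneg hC₂ p3, mul_nonneg hc.le p1, mul_nonneg hc.le p2,
    mul_nonneg hc.le p4]

/-! ### Summation of the errors over pairs -/

lemma half_le_log {T : ℝ} (hT : 2 ≤ T) : 1 / 2 ≤ Real.log T := by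
  have := Real.log_le_log two_pos hT
  have := Real.log_two_gt_d9
  linarith

lemma min_le_rpow_mul_rpow {u v μ : ℝ} (hu : 0 < u) (hv : 0 < v) (h0 : 0 ≤ μ) (h1 : μ ≤ 1) :
    min u v ≤ u ^ (1 - μ) * v ^ μ := by
  have hm : 0 < min u v := lt_min hu hv
  calc min u v = min u v ^ (1 - μ) * min u v ^ μ := by
        rw [← Real.rpow_add hm]; simp
    _ ≤ _ := mul_le_mul (Real.rpow_le_rpow hm.le (min_le_left _ _) (by linarith))
        (Real.rpow_le_rpow hm.le (min_le_right _ _) h0) (by positivity) (by positivity)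

lemma min_mul_le {K u v : ℝ} (hK : 0 ≤ K) (hu : 0 ≤ u) (hv : 0 ≤ v) :
    min (K * u) v ≤ (1 + K) * min u v := by
  rcases le_total u v with h | h
  · rw [min_eq_left h]; exact (min_le_left _ _).trans (by nlinarith)
  · rw [min_eq_right h]; exact (min_le_right _ _).trans (by nlinarith)

lemma P_nearest_eq {a b c : ℝ} (ha : 0 < a) (hac : a < c) (hcb : c ≤ b) (p : ℕ+ × ℕ+) :
    P (nearest a b c p, p) = ((p.1 : ℝ) * p.2) * N1 a b c p.1 p.2 := by
  simp only [P]; rw [nearest_real ha hac hcb]; ring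

lemma one_le_mul_pnat (p : ℕ+ × ℕ+) : (1 : ℝ) ≤ (p.1 : ℝ) * p.2 :=
  one_le_mul_of_one_le_of_one_le (one_le_pnat _) (one_le_pnat _)

lemma sq_le_P_nearest {a b c : ℝ} (ha : 0 < a) (hac : a < c) (hcb : c ≤ b) (p : ℕ+ × ℕ+) :
    ((p.1 : ℝ) * p.2) ^ 2 ≤ P (nearest a b c p, p) := by
  rw [P_nearest_eq ha hac hcb, sq]
  exact mul_le_mul_of_nonneg_left (mul_le_N1 ha hac hcb _ _) (by positivity)

lemma rpow_le_P_nearest {a b c : ℝ} (ha : 0 < a) (hac : a < c) (hcb : c ≤ b) (p : ℕ+ × ℕ+) :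
    ((p.1 : ℝ) * p.2) ^ (1 + c / a) / 2 ≤ P (nearest a b c p, p) := by
  have hq := one_le_mul_pnat p
  have hX1 := one_le_X ha hac hcb p.1 p.2
  have hXN : |X a b c p.1 p.2 - N1 a b c p.1 p.2| ≤ 1 / 2 := abs_sub_round _
  have hN : X a b c p.1 p.2 / 2 ≤ N1 a b c p.1 p.2 := by
    have := (abs_le.1 hXN).2
    linarith
  have hX := rpow_le_X ha hcb p.1 p.2
  rw [P_nearest_eq ha hac hcb, Real.rpow_add (by linarith), Real.rpow_one, mul_div_assoc]
  gcongr
  linarith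

lemma rpow_neg_P_nearest_le {a b c θ : ℝ} (ha : 0 < a) (hac : a < c) (hcb : c ≤ b)
    (p : ℕ+ × ℕ+) (h0 : 0 ≤ θ) (h1 : θ ≤ 1) :
    P (nearest a b c p, p) ^ (-θ) ≤ 2 * ((p.1 : ℝ) * p.2) ^ (-((1 + c / a) * θ)) := by
  have hq := one_le_mul_pnat p
  have hq0 : 0 < (p.1 : ℝ) * p.2 := by linarith
  have hp : 0 < ((p.1 : ℝ) * p.2) ^ (1 + c / a) := by positivity
  calc _ ≤ (((p.1 : ℝ) * p.2) ^ (1 + c / a) / 2) ^ (-θ) :=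
        Real.rpow_le_rpow_of_nonpos (by positivity) (rpow_le_P_nearest ha hac hcb p)
          (neg_nonpos.2 h0)
    _ = 2 ^ θ * ((p.1 : ℝ) * p.2) ^ (-((1 + c / a) * θ)) := by
        rw [Real.div_rpow hp.le (by norm_num), ← Real.rpow_mul hq0.le,
          Real.rpow_neg (by norm_num : (0 : ℝ) ≤ 2), div_inv_eq_mul, mul_neg, mul_comm]
    _ ≤ _ := by
        gcongr
        simpa using Real.rpow_le_rpow_of_exponent_le (one_le_two : (1 : ℝ) ≤ 2) h1

/-- The error from smoothing the cutoff is summable over the pairs with total `O(T^{3/4})`, since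
`P ≥ (n₂n₃)²` when `n₁ = N₁`. -/
lemma sqrt_mul_cutoffSize_le {a b c T : ℝ} (ha : 0 < a) (hac : a < c) (hcb : c ≤ b)
    (p : ℕ+ × ℕ+) (hT : 0 < T) :
    √T * (P (nearest a b c p, p) ^ (-(1 / 2) : ℝ) * cutoffSize T (P (nearest a b c p, p))) ≤
      T ^ (3 / 4 : ℝ) * ((p.1 : ℝ) * p.2) ^ (-1 - 1 / 3 : ℝ) := by
  have hP := P_pos (nearest a b c p, p)
  have hq0 : 0 < (p.1 : ℝ) * p.2 := by positivity
  have h1 := cutoffSize_le_rpow hT hP (by norm_num : (0 : ℝ) ≤ 1 / 6) (by norm_num)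
  have h2 : P (nearest a b c p, p) ^ (-(2 / 3) : ℝ) ≤ ((p.1 : ℝ) * p.2) ^ (-1 - 1 / 3 : ℝ) := by
    calc _ ≤ (((p.1 : ℝ) * p.2) ^ 2) ^ (-(2 / 3) : ℝ) :=
          Real.rpow_le_rpow_of_nonpos (by positivity) (sq_le_P_nearest ha hac hcb p) (by norm_num)
      _ = _ := by
          rw [← Real.rpow_natCast, ← Real.rpow_mul hq0.le]; norm_num
  set Pn := P (nearest a b c p, p)
  calc _ ≤ √T * (Pn ^ (-(1 / 2) : ℝ) * (T ^ (3 / 2 : ℝ) / Pn) ^ (1 / 6 : ℝ)) := by gcongr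
    _ = T ^ (3 / 4 : ℝ) * Pn ^ (-(2 / 3) : ℝ) := by
        rw [Real.div_rpow (by positivity) hP.le, ← Real.rpow_mul hT.le, Real.sqrt_eq_rpow,
          show (-(2 / 3) : ℝ) = -(1 / 2) - 1 / 6 by norm_num, Real.rpow_sub hP,
          show (3 / 4 : ℝ) = 1 / 2 + 3 / 2 * (1 / 6) by norm_num, Real.rpow_add hT]
        ring
    _ ≤ _ := by gcongr

/-- The error from the location `t₀ ≍ P^{2/3}` of the cutoff: interpolating in `min(t₀, T)` so that
the power of `n₂n₃ ≪ P^{a/(a+c)}` becomes just summable produces the exponent `1/4 + 3a/(2(a+c))`.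
-/
lemma exists_cutoffTime_error_le {a b c : ℝ} (ha : 0 < a) (hac : a < c) (hcb : c ≤ b) :
    ∃ C : ℝ, 0 ≤ C ∧ ∀ (T δ : ℝ) (p : ℕ+ × ℕ+), 0 < T → 0 < δ → δ ≤ (c / a - 1) / 2 →
      P (nearest a b c p, p) ^ (-(1 / 2) : ℝ) * min (cutoffTime a b c (P (nearest a b c p, p))) T ≤
        C * T ^ (1 / 4 + 3 / 2 * ((1 + δ) / (1 + c / a))) * ((p.1 : ℝ) * p.2) ^ (-1 - δ) := by
  have hc : 0 < c := ha.trans hac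
  have hb : 0 < b := hc.trans_le hcb
  have hQ := Qa_pos ha hb hc
  have hpi := Real.pi_pos
  set K := 2 * Real.pi * Qa a b c ^ (-(1 / 3) : ℝ) with hK
  have hK0 : 0 < K := by positivity
  refine ⟨(1 + K) * 2, by positivity, fun T δ p hT hδ hδ1 => ?_⟩
  have hP := P_pos (nearest a b c p, p)
  have hρ : 0 < c / a := by positivity
  set θ := (1 + δ) / (1 + c / a) with hθ
  have hθ0 : 0 ≤ θ := by positivity
  have hθ1 : θ ≤ 1 / 2 := by rw [hθ, div_le_iff₀ (by positivity)]; linarith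
  have hpow := rpow_neg_P_nearest_le ha hac hcb p hθ0 (by linarith)
  rw [show -((1 + c / a) * θ) = -1 - δ by rw [hθ]; field_simp; ring] at hpow
  set Pn := P (nearest a b c p, p)
  have hct : cutoffTime a b c Pn = K * Pn ^ (2 / 3 : ℝ) := by
    unfold cutoffTime
    rw [Real.div_rpow (by positivity) hQ.le, ← Real.rpow_natCast, ← Real.rpow_mul hP.le, hK,
      Real.rpow_neg hQ.le]
    norm_num
    ring
  rw [hct]
  have hP23 : 0 < Pn ^ (2 / 3 : ℝ) := by positivity
  have h1 := min_mul_le hK0.le hP23.le hT.le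
  have h2 := min_le_rpow_mul_rpow hP23 hT (μ := 1 / 4 + 3 / 2 * θ) (by positivity) (by linarith)
  calc _ ≤ Pn ^ (-(1 / 2) : ℝ) * ((1 + K) * ((Pn ^ (2 / 3 : ℝ)) ^ (1 - (1 / 4 + 3 / 2 * θ)) *
        T ^ (1 / 4 + 3 / 2 * θ))) := by
        gcongr
        exact h1.trans (by gcongr)
    _ = (1 + K) * T ^ (1 / 4 + 3 / 2 * θ) * Pn ^ (-θ) := by
        rw [← Real.rpow_mul hP.le, show -θ = -(1 / 2) + 2 / 3 * (1 - (1 / 4 + 3 / 2 * θ)) by ring,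
          Real.rpow_add hP]
        ring
    _ ≤ (1 + K) * T ^ (1 / 4 + 3 / 2 * θ) * (2 * ((p.1 : ℝ) * p.2) ^ (-1 - δ)) := by gcongr
    _ = _ := by ring

/-- The error from the passage between sum and integral: interpolating so that the power of `n₂n₃`
becomes just summable produces the exponent `1/2 + a/(2c)`. -/
lemma sum_integral_error_le {a b c T δ : ℝ} (ha : 0 < a) (hac : a < c) (hcb : c ≤ b)
    (p : ℕ+ × ℕ+) (hT : 0 < T) (hδ : 0 < δ) (hδ1 : δ ≤ (c / a - 1) / 2) :
    1 / √((p.1 : ℝ) * p.2) * min (√(X a b c p.1 p.2)) (T / √(X a b c p.1 p.2)) ≤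
      T ^ (1 / 2 + (1 / 2 + δ) / (c / a)) * ((p.1 : ℝ) * p.2) ^ (-1 - δ) := by
  have hc : 0 < c := ha.trans hac
  have hρ : 0 < c / a := by positivity
  have hq0 : 0 < (p.1 : ℝ) * p.2 := by positivity
  have hX := X_pos a b c p.1 p.2
  have hqX := rpow_le_X ha hcb p.1 p.2
  set τ := (1 / 2 + δ) / (c / a) with hτ
  have hτ0 : 0 ≤ τ := by positivity
  have hτ1 : τ ≤ 1 / 2 := by rw [hτ, div_le_iff₀ hρ]; linarith
  set x := X a b c p.1 p.2
  have hsx : 0 < √x := Real.sqrt_pos.2 hX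
  have h2 := min_le_rpow_mul_rpow hsx (by positivity : 0 < T / √x) (μ := 1 / 2 + τ)
    (by positivity) (by linarith)
  have h3 : √x ^ (1 - (1 / 2 + τ)) * (T / √x) ^ (1 / 2 + τ) = T ^ (1 / 2 + τ) * x ^ (-τ) := by
    rw [Real.div_rpow hT.le hsx.le, Real.sqrt_eq_rpow, ← Real.rpow_mul hX.le, ← Real.rpow_mul hX.le,
      show -τ = 1 / 2 * (1 - (1 / 2 + τ)) - 1 / 2 * (1 / 2 + τ) by ring, Real.rpow_sub hX]
    ring
  have h4 : x ^ (-τ) ≤ ((p.1 : ℝ) * p.2) ^ (-1 / 2 - δ) := by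
    calc _ ≤ (((p.1 : ℝ) * p.2) ^ (c / a)) ^ (-τ) :=
          Real.rpow_le_rpow_of_nonpos (by positivity) hqX (neg_nonpos.2 hτ0)
      _ = _ := by
          rw [← Real.rpow_mul hq0.le]
          congr 1
          rw [hτ]; field_simp; ring
  calc _ ≤ 1 / √((p.1 : ℝ) * p.2) * (T ^ (1 / 2 + τ) * ((p.1 : ℝ) * p.2) ^ (-1 / 2 - δ)) := by
        gcongr
        rw [h3] at h2
        exact h2.trans (by gcongr)
    _ = _ := by
        rw [Real.sqrt_eq_rpow, one_div, ← Real.rpow_neg hq0.le,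
          show -1 - δ = -(1 / 2) + (-1 / 2 - δ) by ring, Real.rpow_add hq0]
        ring

/-- If `c ≥ 2a`, the lower end of the sum `M₁` only costs `T^{3/4}` up to logarithms. -/
lemma exists_pairTime_error_le_of_two_le {a b c : ℝ} (ha : 0 < a) (hac : a < c) (hcb : c ≤ b)
    (h2 : 2 ≤ c / a) :
    ∃ C : ℝ, 0 ≤ C ∧ ∀ (T δ : ℝ) (p : ℕ+ × ℕ+), 0 < T → 0 < δ → δ ≤ 1 / 2 →
      P (nearest a b c p, p) ^ (-(1 / 2) : ℝ) * min (pairTime b c p) T ≤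
        C * T ^ (3 / 4 + δ / 2) * ((p.1 : ℝ) * p.2) ^ (-1 - δ) := by
  have hc : 0 < c := ha.trans hac
  have hpi := Real.pi_pos
  refine ⟨2 * (1 + 2 * Real.pi / a), by positivity, fun T δ p hT hδ hδ1 => ?_⟩
  have hq1 := one_le_mul_pnat p
  have hq0 : 0 < (p.1 : ℝ) * p.2 := by linarith
  have hP := P_pos (nearest a b c p, p)
  have hpow := rpow_neg_P_nearest_le ha hac hcb p (by norm_num : (0 : ℝ) ≤ 1 / 2) (by norm_num)
  have ht := pairTime_le ha hac hcb p le_rfl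
  set q := (p.1 : ℝ) * p.2
  have hpow2 : P (nearest a b c p, p) ^ (-(1 / 2) : ℝ) ≤ 2 * q ^ (-(3 / 2) : ℝ) := by
    refine hpow.trans ?_
    gcongr
    linarith
  have h3 : min (pairTime b c p) T ≤ (1 + 2 * Real.pi / a) * min (q ^ 2) T :=
    (min_le_min ht le_rfl).trans (min_mul_le (by positivity) (by positivity) hT.le)
  have h4 := min_le_rpow_mul_rpow (by positivity : 0 < q ^ 2) hT (μ := 3 / 4 + δ / 2)
    (by positivity) (by linarith)
  have hm : 0 ≤ min (pairTime b c p) T := by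
    exact le_min (pairTime_pos hc p).le hT.le
  calc _ ≤ (2 * q ^ (-(3 / 2) : ℝ)) * ((1 + 2 * Real.pi / a) *
        ((q ^ 2) ^ (1 - (3 / 4 + δ / 2)) * T ^ (3 / 4 + δ / 2))) := by
        gcongr
        exact h3.trans (by gcongr)
    _ = _ := by
        rw [← Real.rpow_natCast q 2, ← Real.rpow_mul hq0.le,
          show -1 - δ = -(3 / 2) + ((2 : ℕ) : ℝ) * (1 - (3 / 4 + δ / 2)) by push_cast; ring,
          Real.rpow_add hq0]
        ring

/-- If `c < 2a`, the lower end of the sum `M₁` costs `T^{5/4 - c/(4a)}`. -/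
lemma exists_tsum_pairTime_error_le {a b c : ℝ} (ha : 0 < a) (hac : a < c) (hcb : c ≤ b)
    (h2 : c / a < 2) :
    ∃ C : ℝ, 0 ≤ C ∧ ∀ T : ℝ, 1 ≤ T →
      Summable (fun p : ℕ+ × ℕ+ =>
        P (nearest a b c p, p) ^ (-(1 / 2) : ℝ) * min (pairTime b c p) T) ∧
      ∑' p : ℕ+ × ℕ+, P (nearest a b c p, p) ^ (-(1 / 2) : ℝ) * min (pairTime b c p) T ≤
        C * T ^ (5 / 4 - c / (4 * a)) := by
  have hc : 0 < c := ha.trans hac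
  have hpi := Real.pi_pos
  have hρ : 1 < c / a := (one_lt_div ha).2 hac
  set κ := (1 + c / a) / 2 with hκ
  obtain ⟨C, hC, h⟩ := exists_tsum_rpow_mul_min_le (κ := κ) (by linarith) (by linarith)
  have hZ := zetaSum_nonneg (κ - 1)
  set K := 1 + 2 * Real.pi / c with hK
  have hK0 : 0 ≤ K := by positivity
  refine ⟨2 * K * (2 * (zetaSum (κ - 1) * C)), by positivity, fun T hT => ?_⟩
  have hT0 : 0 < T := by linarith
  obtain ⟨hs, hle⟩ := h T hT
  have hz : Summable fun n : ℕ+ => (n : ℝ) ^ (-κ) := by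
    have := summable_pnat_rpow (δ := κ - 1) (by linarith)
    rwa [show -1 - (κ - 1) = -κ by ring] at this
  have hz' : ∑' n : ℕ+, (n : ℝ) ^ (-κ) = zetaSum (κ - 1) := by
    rw [zetaSum, show -1 - (κ - 1) = -κ by ring]
  have hm0 : ∀ n : ℕ+, 0 ≤ (n : ℝ) ^ (-κ) * min ((n : ℝ) ^ 2) T := fun n =>
    mul_nonneg (by positivity) (le_min (by positivity) hT0.le)
  have s1 := summable_pair_mul (fun n : ℕ+ => by positivity) hm0 hz hs
  have s2 := summable_pair_mul hm0 (fun n : ℕ+ => by positivity) hs hz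
  have hpt : ∀ p : ℕ+ × ℕ+, P (nearest a b c p, p) ^ (-(1 / 2) : ℝ) * min (pairTime b c p) T ≤
      2 * K * ((p.1 : ℝ) ^ (-κ) * ((p.2 : ℝ) ^ (-κ) * min ((p.2 : ℝ) ^ 2) T) +
        (p.1 : ℝ) ^ (-κ) * min ((p.1 : ℝ) ^ 2) T * (p.2 : ℝ) ^ (-κ)) := by
    intro p
    have hpow := rpow_neg_P_nearest_le ha hac hcb p (by norm_num : (0 : ℝ) ≤ 1 / 2) (by norm_num)
    rw [show -((1 + c / a) * (1 / 2)) = -κ by rw [hκ]; ring,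
      Real.mul_rpow (by positivity) (by positivity)] at hpow
    have hmax : pairTime b c p ≤ 2 * Real.pi / c * max ((p.1 : ℝ) ^ 2) ((p.2 : ℝ) ^ 2) := by
      unfold pairTime
      rw [div_mul_eq_mul_div, mul_div_assoc]
      gcongr
      refine max_le ?_ ?_
      · gcongr
        exact le_max_left _ _
      · gcongr
        exact le_max_right _ _
    have hM : min (pairTime b c p) T ≤ K * (min ((p.2 : ℝ) ^ 2) T + min ((p.1 : ℝ) ^ 2) T) := by
      refine (min_le_min hmax le_rfl).trans ((min_mul_le (by positivity)
        (le_max_of_le_left (by positivity)) hT0.le).trans ?_)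
      have e1 : 0 ≤ min ((p.1 : ℝ) ^ 2) T := le_min (by positivity) hT0.le
      have e2 : 0 ≤ min ((p.2 : ℝ) ^ 2) T := le_min (by positivity) hT0.le
      gcongr
      rcases max_choice ((p.1 : ℝ) ^ 2) ((p.2 : ℝ) ^ 2) with h | h <;> rw [h] <;> linarith
    have hm : 0 ≤ min (pairTime b c p) T := by
      exact le_min (pairTime_pos hc p).le hT0.le
    calc _ ≤ 2 * ((p.1 : ℝ) ^ (-κ) * (p.2 : ℝ) ^ (-κ)) *
          (K * (min ((p.2 : ℝ) ^ 2) T + min ((p.1 : ℝ) ^ 2) T)) := by gcongr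
      _ = _ := by ring
  have hnn : ∀ p : ℕ+ × ℕ+,
      0 ≤ P (nearest a b c p, p) ^ (-(1 / 2) : ℝ) * min (pairTime b c p) T := by
    intro p
    have hP := P_pos (nearest a b c p, p)
    exact mul_nonneg (by positivity) (le_min (pairTime_pos hc p).le hT0.le)
  have hS := (s1.1.add s2.1).mul_left (2 * K)
  have hsum := hS.of_nonneg_of_le hnn hpt
  refine ⟨hsum, (hsum.tsum_le_tsum hpt hS).trans ?_⟩
  rw [tsum_mul_left, s1.1.tsum_add s2.1, s1.2, s2.2, hz']
  have hexp : (3 - κ) / 2 = 5 / 4 - c / (4 * a) := by rw [hκ]; field_simp; ring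
  rw [hexp] at hle
  set S := ∑' n : ℕ+, (n : ℝ) ^ (-κ) * min ((n : ℝ) ^ 2) T
  calc _ = 2 * K * (2 * (zetaSum (κ - 1) * S)) := by ring
    _ ≤ 2 * K * (2 * (zetaSum (κ - 1) * (C * T ^ (5 / 4 - c / (4 * a))))) := by gcongr
    _ = _ := by ring

/-- The error term without the powers `T^{1/4 + 3a/(2(a+c))}` and `T^{1/2 + a/(2c)}`, which it
dominates even when they carry two logarithms. -/
noncomputable def errorBound (a c T : ℝ) : ℝ :=
  T ^ (5 / 4 - c / (4 * a)) + T ^ (3 / 4 : ℝ) * Real.log T ^ 3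

/-- A power `T^ε` below `T^{3/4}` when `c ≥ 2a`, and strictly below `T^{5/4 - c/(4a)}` when
`c < 2a`, is dominated by `errorBound` even with two logarithms. With `ρ = c/a`, the exponents
`1/4 + 3/(2(1+ρ))` and `1/2 + 1/(2ρ)` qualify: their comparison with `5/4 - ρ/4` comes down to the
sign of `(ρ - 1)(ρ - 2)`. -/
lemma exists_rpow_mul_log_sq_le {a c ε : ℝ} (h1 : 2 ≤ c / a → ε ≤ 3 / 4)
    (h2 : c / a < 2 → ε < 5 / 4 - c / (4 * a)) :
    ∃ C : ℝ, 0 ≤ C ∧ ∀ T : ℝ, 2 ≤ T → T ^ ε * Real.log T ^ 2 ≤ C * errorBound a c T := by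
  rcases le_or_gt 2 (c / a) with h | h
  · refine ⟨2, by norm_num, fun T hT => ?_⟩
    have hT0 : 0 < T := by linarith
    have hlog := half_le_log hT
    have hl0 : 0 < Real.log T := by linarith
    have e1 : T ^ ε ≤ T ^ (3 / 4 : ℝ) :=
      Real.rpow_le_rpow_of_exponent_le (by linarith) (h1 h)
    have e2 : Real.log T ^ 2 ≤ 2 * Real.log T ^ 3 := by
      have : 0 ≤ Real.log T ^ 2 := by positivity
      calc Real.log T ^ 2 ≤ 2 * Real.log T * Real.log T ^ 2 :=
            le_mul_of_one_le_left this (by linarith)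
        _ = _ := by ring
    have e3 : 0 ≤ T ^ (5 / 4 - c / (4 * a)) := by positivity
    calc _ ≤ T ^ (3 / 4 : ℝ) * (2 * Real.log T ^ 3) := by gcongr
      _ ≤ _ := by unfold errorBound; linarith
  · set ν := (5 / 4 - c / (4 * a) - ε) / 2 with hν
    have hν0 : 0 < ν := by have := h2 h; linarith
    refine ⟨(1 / ν) ^ 2, by positivity, fun T hT => ?_⟩
    have hT0 : 0 < T := by linarith
    have hl0 : 0 ≤ Real.log T := Real.log_nonneg (by linarith)
    have e1 := Real.log_le_rpow_div hT0.le hν0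
    have e3 : 0 ≤ T ^ (3 / 4 : ℝ) * Real.log T ^ 3 := by positivity
    calc _ ≤ T ^ ε * (T ^ ν / ν) ^ 2 := by gcongr
      _ = (1 / ν) ^ 2 * T ^ (5 / 4 - c / (4 * a)) := by
          rw [show 5 / 4 - c / (4 * a) = ε + ν * (2 : ℕ) by rw [hν]; push_cast; ring,
            Real.rpow_add hT0, Real.rpow_mul_natCast hT0.le]
          ring
      _ ≤ _ := by
          unfold errorBound
          gcongr
          linarith

/-- Rankin's choice `δ = η / log T`, for which `T^δ` is bounded and `∑ n^{-1-δ} ≪ log T`. -/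
lemma exists_zetaSum_le_log {η : ℝ} (hη : 0 < η) : ∃ C : ℝ, 0 ≤ C ∧ ∀ T : ℝ, 2 ≤ T →
    zetaSum (η / Real.log T) ≤ C * Real.log T := by
  refine ⟨2 + 1 / η, by positivity, fun T hT => ?_⟩
  have hlog := half_le_log hT
  have hl0 : 0 < Real.log T := by linarith
  refine (zetaSum_le (by positivity)).trans ?_
  rw [one_div_div, add_mul, one_div_mul_eq_div]
  linarith

lemma rpow_div_log {T η : ℝ} (hT : 2 ≤ T) (x : ℝ) :
    T ^ (x * (η / Real.log T)) = Real.exp (x * η) := by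
  have hl0 : 0 < Real.log T := Real.log_pos (by linarith)
  rw [Real.rpow_def_of_pos (by linarith)]
  congr 1
  field_simp

/-- The sum over all pairs of the four errors of `exists_pair_estimate`. -/
noncomputable def pairError (a b c T : ℝ) (p : ℕ+ × ℕ+) : ℝ :=
  √T * (P (nearest a b c p, p) ^ (-(1 / 2) : ℝ) * cutoffSize T (P (nearest a b c p, p))) +
    P (nearest a b c p, p) ^ (-(1 / 2) : ℝ) * min (cutoffTime a b c (P (nearest a b c p, p))) T +
    P (nearest a b c p, p) ^ (-(1 / 2) : ℝ) * min (pairTime b c p) T +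
    1 / √((p.1 : ℝ) * p.2) * min (√(X a b c p.1 p.2)) (T / √(X a b c p.1 p.2))

lemma summable_of_le_pair_rpow {f : ℕ+ × ℕ+ → ℝ} {K δ : ℝ} (hδ : 0 < δ) (hf : ∀ p, 0 ≤ f p)
    (h : ∀ p, f p ≤ K * ((p.1 : ℝ) * p.2) ^ (-1 - δ)) :
    Summable f ∧ ∑' p, f p ≤ K * zetaSum δ ^ 2 := by
  have hs := (summable_pair_rpow hδ).1.mul_left K
  have hf' := hs.of_nonneg_of_le hf h
  refine ⟨hf', (hf'.tsum_le_tsum h hs).trans_eq ?_⟩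
  rw [tsum_mul_left, (summable_pair_rpow hδ).2]

lemma exists_tsum_pairError_le {a b c : ℝ} (ha : 0 < a) (hac : a < c) (hcb : c ≤ b) :
    ∃ C : ℝ, 0 ≤ C ∧ ∀ T : ℝ, 2 ≤ T → Summable (pairError a b c T) ∧
      ∑' p, pairError a b c T p ≤ C * errorBound a c T := by
  have hc : 0 < c := ha.trans hac
  have hb : 0 < b := hc.trans_le hcb
  have hpi := Real.pi_pos
  have hρ : 1 < c / a := (one_lt_div ha).2 hac
  set ρ := c / a with hρdef
  have h4a : c / (4 * a) = ρ / 4 := by rw [hρdef]; field_simp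
  -- `η ≤ (ρ - 1)/4` keeps `δ = η / log T` in the range `δ ≤ (ρ - 1)/2`, as `log T ≥ 1/2`
  set η := min (1 / 4) ((ρ - 1) / 4) with hη
  have hη0 : 0 < η := lt_min (by norm_num) (by linarith)
  obtain ⟨CZ, hCZ, hZ⟩ := exists_zetaSum_le_log hη0
  obtain ⟨C₃, hC₃, h₃⟩ := exists_cutoffTime_error_le ha hac hcb
  obtain ⟨B₂, hB₂, hb₂⟩ := exists_rpow_mul_log_sq_le (a := a) (c := c) (ε := 3 / 4)
    (fun _ => le_rfl) (fun h => by rw [h4a]; linarith)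
  obtain ⟨B₃, hB₃, hb₃⟩ := exists_rpow_mul_log_sq_le (a := a) (c := c)
    (ε := 1 / 4 + 3 / 2 * (1 / (1 + ρ)))
    (fun h => by
      have : 1 / (1 + ρ) ≤ 1 / 3 := by gcongr; linarith
      linarith)
    (fun h => by
      rw [h4a]
      have : 1 / (1 + ρ) < (4 - ρ) / 6 := by
        rw [div_lt_div_iff₀ (by linarith) (by norm_num)]
        nlinarith [mul_pos (sub_pos.2 hρ) (sub_pos.2 h)]
      linarith)
  obtain ⟨B₅, hB₅, hb₅⟩ := exists_rpow_mul_log_sq_le (a := a) (c := c)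
    (ε := 1 / 2 + 1 / 2 * (1 / ρ))
    (fun h => by
      have : 1 / ρ ≤ 1 / 2 := by gcongr
      linarith)
    (fun h => by
      rw [h4a]
      have : 1 / ρ < (3 - ρ) / 2 := by
        rw [div_lt_div_iff₀ (by linarith) (by norm_num)]
        nlinarith [mul_pos (sub_pos.2 hρ) (sub_pos.2 h)]
      linarith)
  have hδ : ∀ T : ℝ, 2 ≤ T → 0 < η / Real.log T ∧ η / Real.log T ≤ 1 / 2 ∧
      η / Real.log T ≤ (ρ - 1) / 2 ∧ 1 / 2 ≤ Real.log T := by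
    intro T hT
    have hlog := half_le_log hT
    have hl0 : 0 < Real.log T := by linarith
    have e1 : η ≤ 1 / 4 := min_le_left _ _
    have e2 : η ≤ (ρ - 1) / 4 := min_le_right _ _
    refine ⟨by positivity, ?_, ?_, hlog⟩
    · rw [div_le_iff₀ hl0]; linarith
    · rw [div_le_iff₀ hl0]; nlinarith
  have hPp : ∀ p, 0 < P (nearest a b c p, p) := fun p => P_pos _
  have ht₂ : ∀ p : ℕ+ × ℕ+, 0 ≤ pairTime b c p := fun p => (pairTime_pos hc p).le
  -- the lower end of `M₁`; only for `c < 2a` does it exceed `T^{3/4}` up to logarithms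
  have hlower : ∃ C : ℝ, 0 ≤ C ∧ ∀ T : ℝ, 2 ≤ T →
      Summable (fun p : ℕ+ × ℕ+ =>
        P (nearest a b c p, p) ^ (-(1 / 2) : ℝ) * min (pairTime b c p) T) ∧
      ∑' p : ℕ+ × ℕ+, P (nearest a b c p, p) ^ (-(1 / 2) : ℝ) * min (pairTime b c p) T ≤
        C * errorBound a c T := by
    rcases le_or_gt 2 ρ with h | h
    · obtain ⟨C₄, hC₄, h₄⟩ := exists_pairTime_error_le_of_two_le ha hac hcb h
      refine ⟨C₄ * Real.exp (1 / 2 * η) * (CZ ^ 2 * B₂), by positivity, fun T hT => ?_⟩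
      obtain ⟨d1, d2, d3, hlog⟩ := hδ T hT
      have hT0 : 0 < T := by linarith
      have hl0 : 0 < Real.log T := by linarith
      obtain ⟨s, hs⟩ := summable_of_le_pair_rpow d1 (fun p => mul_nonneg
        (Real.rpow_nonneg (hPp p).le _) (le_min (ht₂ p) hT0.le)) (fun p => h₄ T _ p hT0 d1 d2)
      refine ⟨s, hs.trans ?_⟩
      have hZn := zetaSum_nonneg (η / Real.log T)
      have hZT := hZ T hT
      rw [show 3 / 4 + η / Real.log T / 2 = 3 / 4 + 1 / 2 * (η / Real.log T) by ring,
        Real.rpow_add hT0, rpow_div_log hT]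
      calc _ ≤ C₄ * (T ^ (3 / 4 : ℝ) * Real.exp (1 / 2 * η)) * (CZ * Real.log T) ^ 2 := by gcongr
        _ = C₄ * Real.exp (1 / 2 * η) * (CZ ^ 2 * (T ^ (3 / 4 : ℝ) * Real.log T ^ 2)) := by ring
        _ ≤ C₄ * Real.exp (1 / 2 * η) * (CZ ^ 2 * (B₂ * errorBound a c T)) :=
            mul_le_mul_of_nonneg_left (mul_le_mul_of_nonneg_left (hb₂ T hT) (by positivity))
              (by positivity)
        _ = _ := by ring
    · obtain ⟨C₄, hC₄, h₄⟩ := exists_tsum_pairTime_error_le ha hac hcb h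
      refine ⟨C₄, hC₄, fun T hT => ⟨(h₄ T (by linarith)).1, (h₄ T (by linarith)).2.trans ?_⟩⟩
      unfold errorBound
      have hl0 : 0 ≤ Real.log T := Real.log_nonneg (by linarith)
      have : 0 ≤ T ^ (3 / 4 : ℝ) * Real.log T ^ 3 := by positivity
      gcongr
      linarith
  obtain ⟨C₄, hC₄, h₄⟩ := hlower
  refine ⟨zetaSum (1 / 3) ^ 2 * (4 * B₂) +
    C₃ * Real.exp (3 / 2 * (1 / (1 + ρ)) * η) * (CZ ^ 2 * B₃) + C₄ +
    Real.exp (1 / ρ * η) * (CZ ^ 2 * B₅), by positivity, fun T hT => ?_⟩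
  obtain ⟨d1, d2, d3, hlog⟩ := hδ T hT
  have hT0 : 0 < T := by linarith
  have hl0 : 0 < Real.log T := by linarith
  have hZn := zetaSum_nonneg (η / Real.log T)
  have hZT := hZ T hT
  obtain ⟨s2, b2⟩ := summable_of_le_pair_rpow (by norm_num : (0 : ℝ) < 1 / 3)
    (fun p => mul_nonneg (Real.sqrt_nonneg T) (mul_nonneg
      (Real.rpow_nonneg (hPp p).le _) (cutoffSize_pos hT0 (hPp p)).le))
    (fun p => sqrt_mul_cutoffSize_le ha hac hcb p hT0)
  obtain ⟨s3, b3⟩ := summable_of_le_pair_rpow d1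
    (fun p => mul_nonneg (Real.rpow_nonneg (hPp p).le _)
      (le_min (cutoffTime_pos ha hb hc (hPp p)).le hT0.le)) (fun p => h₃ T _ p hT0 d1 d3)
  obtain ⟨s4, b4⟩ := h₄ T hT
  obtain ⟨s5, b5⟩ := summable_of_le_pair_rpow d1
    (fun p : ℕ+ × ℕ+ => mul_nonneg (one_div_nonneg.2 (Real.sqrt_nonneg ((p.1 : ℝ) * p.2)))
      (le_min (Real.sqrt_nonneg (X a b c p.1 p.2)) (div_nonneg hT0.le (Real.sqrt_nonneg _))))
    (fun p => sum_integral_error_le ha hac hcb p hT0 d1 d3)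
  refine ⟨((s2.add s3).add s4).add s5, ?_⟩
  rw [← hρdef] at b3 b5
  have htot : ∑' p, pairError a b c T p = _ := ((s2.add s3).add s4).tsum_add s5
  rw [htot, (s2.add s3).tsum_add s4, s2.tsum_add s3]
  have f2 : T ^ (3 / 4 : ℝ) * zetaSum (1 / 3) ^ 2 ≤
      zetaSum (1 / 3) ^ 2 * (4 * B₂) * errorBound a c T := by
    have e1 : (1 : ℝ) ≤ 4 * Real.log T ^ 2 := by nlinarith
    have e2 : T ^ (3 / 4 : ℝ) ≤ 4 * (T ^ (3 / 4 : ℝ) * Real.log T ^ 2) := by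
      have : 0 ≤ T ^ (3 / 4 : ℝ) := by positivity
      nlinarith
    have e3 := hb₂ T hT
    calc _ ≤ (4 * (B₂ * errorBound a c T)) * zetaSum (1 / 3) ^ 2 := by
          gcongr; linarith
      _ = _ := by ring
  have f3 : C₃ * T ^ (1 / 4 + 3 / 2 * ((1 + η / Real.log T) / (1 + ρ))) *
      zetaSum (η / Real.log T) ^ 2 ≤
      C₃ * Real.exp (3 / 2 * (1 / (1 + ρ)) * η) * (CZ ^ 2 * B₃) * errorBound a c T := by
    rw [show 1 / 4 + 3 / 2 * ((1 + η / Real.log T) / (1 + ρ)) =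
      (1 / 4 + 3 / 2 * (1 / (1 + ρ))) + 3 / 2 * (1 / (1 + ρ)) * (η / Real.log T) by ring,
      Real.rpow_add hT0, rpow_div_log hT]
    calc _ ≤ C₃ * (T ^ (1 / 4 + 3 / 2 * (1 / (1 + ρ))) *
          Real.exp (3 / 2 * (1 / (1 + ρ)) * η)) * (CZ * Real.log T) ^ 2 := by gcongr
      _ = C₃ * Real.exp (3 / 2 * (1 / (1 + ρ)) * η) *
          (CZ ^ 2 * (T ^ (1 / 4 + 3 / 2 * (1 / (1 + ρ))) * Real.log T ^ 2)) := by ring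
      _ ≤ C₃ * Real.exp (3 / 2 * (1 / (1 + ρ)) * η) * (CZ ^ 2 * (B₃ * errorBound a c T)) :=
          mul_le_mul_of_nonneg_left (mul_le_mul_of_nonneg_left (hb₃ T hT) (by positivity))
            (by positivity)
      _ = _ := by ring
  have f5 : T ^ (1 / 2 + (1 / 2 + η / Real.log T) / ρ) * zetaSum (η / Real.log T) ^ 2 ≤
      Real.exp (1 / ρ * η) * (CZ ^ 2 * B₅) * errorBound a c T := by
    rw [show 1 / 2 + (1 / 2 + η / Real.log T) / ρ =
      (1 / 2 + 1 / 2 * (1 / ρ)) + 1 / ρ * (η / Real.log T) by ring,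
      Real.rpow_add hT0, rpow_div_log hT]
    calc _ ≤ (T ^ (1 / 2 + 1 / 2 * (1 / ρ)) * Real.exp (1 / ρ * η)) * (CZ * Real.log T) ^ 2 := by
          gcongr
      _ = Real.exp (1 / ρ * η) *
          (CZ ^ 2 * (T ^ (1 / 2 + 1 / 2 * (1 / ρ)) * Real.log T ^ 2)) := by ring
      _ ≤ Real.exp (1 / ρ * η) * (CZ ^ 2 * (B₅ * errorBound a c T)) :=
          mul_le_mul_of_nonneg_left (mul_le_mul_of_nonneg_left (hb₅ T hT) (by positivity))
            (by positivity)
      _ = _ := by ring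
  linarith

/-! ### Decomposition of the sums over triples -/

lemma intervalIntegrable_I12Integrand {a b c : ℝ} (ha : 0 < a) (hb : 0 < b) (hc : 0 < c)
    (coef : ℕ → ℕ → ℂ) {T : ℝ} (hT : 1 ≤ T) (n : Triple) :
    IntervalIntegrable (I12Integrand a b c coef n) volume 1 T := by
  apply ContinuousOn.intervalIntegrable
  have h : I12Integrand a b c coef n = fun t : ℝ =>
      Complex.exp (Complex.I * t * (a * Real.log (X a b c n.2.1 n.2.2 / n.1) : ℝ)) *
        W1 a b c coef (P n) t := by
    funext t
    rw [I12Integrand, La_cpow_eq ha]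
  rw [h]
  refine ContinuousOn.mul (Continuous.continuousOn (by fun_prop)) ?_
  exact (continuousOn_W1 ha hb hc coef (P_pos n)).mono (uIcc_one_subset hT)

/-- `∑ P_𝐧^{-3/2}` converges. -/
lemma summable_P_rpow : Summable fun n : Triple => P n ^ (-1 - 1 / 2 : ℝ) := by
  have h : (0 : ℝ) < 1 / 2 := by norm_num
  refine (summable_triple (g := fun p => zetaSum (1 / 2) * ((p.1 : ℝ) * p.2) ^ (-1 - 1 / 2 : ℝ))
    (fun n => Real.rpow_nonneg (P_pos n).le _) (fun p => ?_)
    ((summable_pair_rpow h).1.mul_left _)).1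
  have e : (fun m : ℕ+ => P (m, p) ^ (-1 - 1 / 2 : ℝ)) = fun m : ℕ+ =>
      (m : ℝ) ^ (-1 - 1 / 2 : ℝ) * ((p.1 : ℝ) * p.2) ^ (-1 - 1 / 2 : ℝ) := by
    funext m
    rw [← Real.mul_rpow (by positivity) (by positivity)]
    congr 1; simp only [P]; ring
  rw [e, tsum_mul_right]
  exact ⟨(summable_pnat_rpow h).mul_right _, le_rfl⟩

/-- Absolute convergence of `I_{1,2}(T)`: the decay `W₁(P,t) ≪ T^{3/2} / P` suffices. -/
lemma summable_norm_I12Term {a b c : ℝ} (ha : 0 < a) (hb : 0 < b) (hc : 0 < c)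
    (coef : ℕ → ℕ → ℂ) {T : ℝ} (hT : 1 ≤ T) :
    Summable fun n : Triple => ‖I12Term a b c coef T n‖ := by
  obtain ⟨C, hC, hW⟩ := exists_W1_integral_bounds ha hb hc coef
  have hT0 : 0 < T := by linarith
  refine (summable_P_rpow.mul_left (C * T ^ (3 / 2 : ℝ) * (T - 1))).of_nonneg_of_le
    (fun n => norm_nonneg _) fun n => ?_
  have hP := P_pos n
  obtain ⟨h1, -, -⟩ := hW (P n) T hP hT
  rw [I12Term_eq ha, norm_mul, Complex.norm_real, Real.norm_of_nonneg (by positivity)]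
  have h2 : ‖∫ t in (1 : ℝ)..T,
      Complex.exp (Complex.I * t * (a * Real.log (X a b c n.2.1 n.2.2 / n.1) : ℝ)) *
        W1 a b c coef (P n) t‖ ≤ (C * (T ^ (3 / 2 : ℝ) / P n)) * |T - 1| := by
    refine intervalIntegral.norm_integral_le_of_norm_le_const fun t ht => ?_
    rw [uIoc_of_le hT] at ht
    rw [norm_mul, norm_exp_I_mul_mul, one_mul]
    refine (h1 t ⟨ht.1.le, ht.2⟩).trans ?_
    gcongr
    exact min_le_right _ _
  rw [abs_of_nonneg (by linarith)] at h2
  calc _ ≤ P n ^ (-(1 / 2) : ℝ) * ((C * (T ^ (3 / 2 : ℝ) / P n)) * (T - 1)) := by gcongr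
    _ = _ := by
      rw [show (-1 - 1 / 2 : ℝ) = -(1 / 2) - 1 by ring, Real.rpow_sub_one hP.ne']
      ring

lemma summable_far_majorant_fibre {δ K : ℝ} (hδ : 0 < δ) (hK : 0 ≤ K) (x : ℝ) (hx : 0 ≤ x)
    (N : ℤ) :
    Summable (fun m : ℕ+ => K * (x * ((m : ℝ) ^ (-1 - δ) + |(m : ℝ) - N| ^ (-1 - δ)))) ∧
    ∑' m : ℕ+, K * (x * ((m : ℝ) ^ (-1 - δ) + |(m : ℝ) - N| ^ (-1 - δ))) ≤
      K * (3 * zetaSum δ) * x := by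
  obtain ⟨s1, e1⟩ := summable_shift_rpow hδ N
  have s2 := summable_pnat_rpow hδ
  have s3 := s2.add s1
  refine ⟨(s3.mul_left _).mul_left K, ?_⟩
  rw [tsum_mul_left, tsum_mul_left, s2.tsum_add s1, ← zetaSum]
  calc _ ≤ K * (x * (zetaSum δ + 2 * zetaSum δ)) := by gcongr
    _ = _ := by ring

/-- The majorant of the terms with `n₁ ≠ N₁`, summed over all triples. -/
lemma summable_far_majorant (a b c : ℝ) {δ K : ℝ} (hδ : 0 < δ) (hK : 0 ≤ K) :
    Summable (fun n : Triple => K * (((n.2.1 : ℝ) * n.2.2) ^ (-1 - δ) *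
      ((n.1 : ℝ) ^ (-1 - δ) + |(n.1 : ℝ) - N1 a b c n.2.1 n.2.2| ^ (-1 - δ)))) ∧
    ∑' n : Triple, K * (((n.2.1 : ℝ) * n.2.2) ^ (-1 - δ) *
      ((n.1 : ℝ) ^ (-1 - δ) + |(n.1 : ℝ) - N1 a b c n.2.1 n.2.2| ^ (-1 - δ))) ≤
      K * (3 * zetaSum δ ^ 3) := by
  obtain ⟨hpr, hpe⟩ := summable_pair_rpow hδ
  obtain ⟨hs, hle⟩ := summable_triple
    (f := fun n : Triple => K * (((n.2.1 : ℝ) * n.2.2) ^ (-1 - δ) *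
      ((n.1 : ℝ) ^ (-1 - δ) + |(n.1 : ℝ) - N1 a b c n.2.1 n.2.2| ^ (-1 - δ))))
    (g := fun p => K * (3 * zetaSum δ) * ((p.1 : ℝ) * p.2) ^ (-1 - δ))
    (fun n => by positivity)
    (fun p => summable_far_majorant_fibre hδ hK (((p.1 : ℝ) * p.2) ^ (-1 - δ)) (by positivity)
      (N1 a b c p.1 p.2)) (hpr.mul_left _)
  refine ⟨hs, hle.trans (le_of_eq ?_)⟩
  rw [tsum_mul_left, hpe]
  ring

/-- The total of the terms with `n₁ ≠ N₁`; Rankin's exponent is `δ = 1 / (4 log T)`. -/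
lemma exists_tsum_far_le {a b c : ℝ} (ha : 0 < a) (hac : a < c) (hcb : c ≤ b)
    (coef : ℕ → ℕ → ℂ) : ∃ C : ℝ, 0 ≤ C ∧ ∀ (T : ℝ) (f : Triple → ℂ), 2 ≤ T →
      (∀ n, f n = 0 ∨ ((n.1 : ℕ) : ℤ) ≠ N1 a b c n.2.1 n.2.2 ∧ f n = I12Term a b c coef T n) →
      ‖∑' n, f n‖ ≤ C * errorBound a c T := by
  obtain ⟨C, hC, h⟩ := exists_I12Term_le ha hac hcb coef
  have hη : (0 : ℝ) < 1 / 4 := by norm_num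
  obtain ⟨CZ, hCZ, hZ⟩ := exists_zetaSum_le_log hη
  refine ⟨C * Real.exp (3 / 2 * (1 / 4)) * (3 * CZ ^ 3), by positivity, fun T f hT hf => ?_⟩
  have hT0 : 0 < T := by linarith
  have hlog := half_le_log hT
  have hl0 : 0 < Real.log T := by linarith
  have hZT := hZ T hT
  obtain ⟨δ, hδ⟩ : ∃ δ, δ = 1 / 4 / Real.log T := ⟨_, rfl⟩
  rw [← hδ] at hZT
  have hδ0 : 0 < δ := by rw [hδ]; positivity
  have hδ1 : δ ≤ 1 / 2 := by rw [hδ, div_le_iff₀ hl0]; linarith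
  have hZn := zetaSum_nonneg δ
  have hTδ : T ^ (3 / 4 + 3 / 2 * δ) = T ^ (3 / 4 : ℝ) * Real.exp (3 / 2 * (1 / 4)) := by
    rw [Real.rpow_add hT0, hδ, rpow_div_log hT]
  have hK0 : 0 ≤ C * T ^ (3 / 4 + 3 / 2 * δ) := by positivity
  obtain ⟨hs, hle⟩ := summable_far_majorant a b c hδ0 hK0
  refine (tsum_of_norm_bounded hs.hasSum fun n => ?_).trans (hle.trans ?_)
  · rcases hf n with h0 | ⟨h1, h2⟩
    · rw [h0, norm_zero]; positivity
    · rw [h2]; exact h T δ n (by linarith) hδ0 hδ1 h1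
  · rw [hTδ]
    calc _ ≤ C * (T ^ (3 / 4 : ℝ) * Real.exp (3 / 2 * (1 / 4))) * (3 * (CZ * Real.log T) ^ 3) := by
          gcongr
      _ = C * Real.exp (3 / 2 * (1 / 4)) * (3 * CZ ^ 3) * (T ^ (3 / 4 : ℝ) * Real.log T ^ 3) := by
          ring
      _ ≤ _ := by
          unfold errorBound
          have : 0 ≤ T ^ (5 / 4 - c / (4 * a)) := by positivity
          gcongr
          linarith

lemma finite_Nn_le {a b c : ℝ} (ha : 0 < a) (hac : a < c) (hcb : c ≤ b) (T : ℝ) :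
    {n : Triple | Nn a b c n ≤ T}.Finite := by
  have hc : 0 < c := ha.trans hac
  have hb : 0 < b := hc.trans_le hcb
  set k := ⌊b * T⌋₊.succPNat
  refine ((finite_Iic k).prod ((finite_Iic k).prod (finite_Iic k))).subset ?_
  have key : ∀ (n : Triple), Nn a b c n ≤ T → ∀ (m : ℕ+) (r : ℝ), 0 < r → r ≤ b →
      (m : ℝ) ^ 2 / r ≤ max ((n.1 : ℝ) ^ 2 / a)
        (max ((n.2.1 : ℝ) ^ 2 / b) ((n.2.2 : ℝ) ^ 2 / c)) → m ≤ k := by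
    intro n hn m r hr hrb hm
    have hpi := Real.pi_gt_three
    have h1 : (m : ℝ) ≤ (m : ℝ) ^ 2 := by
      have := one_le_pnat m; nlinarith
    have h2 : (m : ℝ) ^ 2 / r ≤ T := by
      have h0 : 0 ≤ (m : ℝ) ^ 2 / r := by positivity
      unfold Nn at hn
      nlinarith
    have h3 : (m : ℝ) ≤ b * T := by
      rw [div_le_iff₀ hr] at h2
      have : 0 ≤ T := by
        by_contra hneg
        have : (0 : ℝ) < m := by positivity
        nlinarith
      nlinarith
    have h4 : (m : ℕ) ≤ ⌊b * T⌋₊ := Nat.le_floor h3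
    have h5 : (m : ℕ) ≤ (k : ℕ) := by
      rw [Nat.succPNat_coe]; omega
    exact_mod_cast h5
  intro n hn
  refine ⟨?_, ?_, ?_⟩
  · exact key n hn n.1 a ha (by linarith) (le_max_left _ _)
  · exact key n hn n.2.1 b hb le_rfl ((le_max_left _ _).trans (le_max_right _ _))
  · exact key n hn n.2.2 c hc hcb ((le_max_right _ _).trans (le_max_right _ _))

lemma M1Set_subset (a b c T : ℝ) : M1Set a b c T ⊆ {n | Nn a b c n ≤ T} :=
  fun _ hn => hn.2.1.trans hn.2.2

lemma J22Set_subset (a b c T : ℝ) : J22Set a b c T ⊆ {n | Nn a b c n ≤ T} :=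
  fun _ hn => hn.2.2

lemma X_ne_int_iff (a b c : ℝ) (n₂ n₃ : ℕ+) :
    (∀ m : ℤ, X a b c n₂ n₃ ≠ m) ↔ X a b c n₂ n₃ ≠ N1 a b c n₂ n₃ := by
  refine ⟨fun h => h _, fun h m hm => h ?_⟩
  rw [N1, hm, round_intCast]

/-- For a fixed pair `(n₂, n₃)` the range of `n₁` in `M₁` is an interval: `N_𝐧 ≤ (2π/a) n₁ X` says
that `n₁ ≤ X` and that `n₁` is at least `pairTime` divided by `2πX/a`. -/
lemma mem_M1Set_iff {a b c T : ℝ} (ha : 0 < a) (k : ℕ+) (p : ℕ+ × ℕ+) :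
    (k, p) ∈ M1Set a b c T ↔ X a b c p.1 p.2 ≠ N1 a b c p.1 p.2 ∧
      (k : ℕ) ∈ Finset.Icc ⌈pairTime b c p / (2 * Real.pi * X a b c p.1 p.2 / a)⌉₊
      ⌊min (X a b c p.1 p.2) (T / (2 * Real.pi * X a b c p.1 p.2 / a))⌋₊ := by
  have hX := X_pos a b c p.1 p.2
  have hpi := Real.pi_pos
  have hk : (0 : ℝ) < k := by positivity
  unfold M1Set
  rw [mem_ofPred_eq, X_ne_int_iff]
  refine and_congr_right fun _ => ?_
  simp only
  set x := X a b c p.1 p.2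
  have hd : 0 < 2 * Real.pi * x / a := by positivity
  rw [Finset.mem_Icc, Nat.ceil_le, Nat.le_floor_iff' k.pos.ne', le_min_iff, le_div_iff₀ hd,
    div_le_iff₀ hd]
  have e1 : 2 * Real.pi / a * (k * x) = k * (2 * Real.pi * x / a) := by ring
  rw [e1, Nn, mul_max_of_nonneg _ _ (by positivity), max_le_iff, ← pairTime]
  have e2 : 2 * Real.pi * ((k : ℝ) ^ 2 / a) ≤ k * (2 * Real.pi * x / a) ↔ (k : ℝ) ≤ x := by
    have e3 : 2 * Real.pi * ((k : ℝ) ^ 2 / a) = (2 * Real.pi * k / a) * k := by ring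
    have e4 : (k : ℝ) * (2 * Real.pi * x / a) = (2 * Real.pi * k / a) * x := by ring
    rw [e3, e4]
    exact mul_le_mul_iff_right₀ (by positivity)
  rw [e2]
  tauto

/-- `M₁` as a sum over the pairs `(n₂, n₃)`; finitely many summands are nonzero. -/
lemma M1_eq_tsum_pair {a b c : ℝ} (ha : 0 < a) (hac : a < c) (hcb : c ≤ b) (T : ℝ) :
    Summable (fun p : ℕ+ × ℕ+ =>
      if X a b c p.1 p.2 ≠ N1 a b c p.1 p.2 then M1Pair a b c T p else 0) ∧
    M1 a b c T = ∑' p : ℕ+ × ℕ+,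
      if X a b c p.1 p.2 ≠ N1 a b c p.1 p.2 then M1Pair a b c T p else 0 := by
  classical
  set F : Triple → ℂ := (M1Set a b c T).indicator fun n => (2 * Real.pi / a : ℂ) *
    ((((n.2.1 : ℝ) ^ (b / (2 * a) - 1 / 2) * (n.2.2 : ℝ) ^ (c / (2 * a) - 1 / 2) : ℝ) : ℂ) *
      e ((n.1 : ℝ) * X a b c n.2.1 n.2.2)) with hF
  have hfin : (Function.support F).Finite :=
    ((finite_Nn_le ha hac hcb T).subset (M1Set_subset a b c T)).subset
      (Set.support_indicator_subset)
  have hM : M1 a b c T = ∑' n, F n := by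
    rw [M1, ← tsum_mul_left]
    exact tsum_subtype (M1Set a b c T) fun n => (2 * Real.pi / a : ℂ) *
    ((((n.2.1 : ℝ) ^ (b / (2 * a) - 1 / 2) * (n.2.2 : ℝ) ^ (c / (2 * a) - 1 / 2) : ℝ) : ℂ) *
      e ((n.1 : ℝ) * X a b c n.2.1 n.2.2))
  have hs : Summable F := summable_of_hasFiniteSupport hfin
  have hs' : Summable fun x : (ℕ+ × ℕ+) × ℕ+ => F (x.2, x.1) :=
    (Equiv.prodComm (ℕ+ × ℕ+) ℕ+).summable_iff.2 hs
  have hinner : ∀ p : ℕ+ × ℕ+, ∑' k : ℕ+, F (k, p) =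
      if X a b c p.1 p.2 ≠ N1 a b c p.1 p.2 then M1Pair a b c T p else 0 := by
    intro p
    split_ifs with hX
    · have hXp := X_pos a b c p.1 p.2
      set S := Finset.Icc ⌈pairTime b c p / (2 * Real.pi * X a b c p.1 p.2 / a)⌉₊
        ⌊min (X a b c p.1 p.2) (T / (2 * Real.pi * X a b c p.1 p.2 / a))⌋₊ with hS
      set w := ((1 / √((p.1 : ℝ) * p.2) : ℝ) : ℂ) * ((2 * Real.pi / a * √(X a b c p.1 p.2) : ℝ) : ℂ)
        with hw
      have hF' : ∀ k : ℕ+, F (k, p) =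
          (fun k : ℕ => if k ∈ S then w * e (k * X a b c p.1 p.2) else 0) (k : ℕ) := by
        intro k
        simp only [hF, indicator_apply]
        have hiff : (k, p) ∈ M1Set a b c T ↔ (k : ℕ) ∈ S := by
          rw [mem_M1Set_iff ha]; exact and_iff_right hX
        by_cases hk : (k : ℕ) ∈ S
        · rw [if_pos (hiff.2 hk), if_pos hk, ← mul_assoc]
          congr 1
          have h2 : (0 : ℝ) < p.1 := by positivity
          have h3 : (0 : ℝ) < p.2 := by positivity
          have : (p.1 : ℝ) ^ (b / (2 * a) - 1 / 2) * (p.2 : ℝ) ^ (c / (2 * a) - 1 / 2) =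
              1 / √((p.1 : ℝ) * p.2) * √(X a b c p.1 p.2) := by
            rw [X, Real.sqrt_mul (by positivity), Real.sqrt_mul (by positivity),
              Real.rpow_sub h2, Real.rpow_sub h3, ← Real.sqrt_eq_rpow, ← Real.sqrt_eq_rpow,
              Real.sqrt_eq_rpow (_ ^ _), Real.sqrt_eq_rpow (_ ^ _), ← Real.rpow_mul h2.le,
              ← Real.rpow_mul h3.le]
            rw [show b / a * (1 / 2) = b / (2 * a) by ring,
              show c / a * (1 / 2) = c / (2 * a) by ring]
            field_simp
          rw [this, hw]
          push_cast
          ring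
        · rw [if_neg (fun h => hk (hiff.1 h)), if_neg hk]
      simp_rw [hF']
      have hpos : 0 < pairTime b c p / (2 * Real.pi * X a b c p.1 p.2 / a) := by
        have hpi := Real.pi_pos
        have hc : 0 < c := ha.trans hac
        have : 0 < pairTime b c p := pairTime_pos hc p
        positivity
      rw [PNat.coe_injective.tsum_eq (f := fun k : ℕ =>
        if k ∈ S then w * e (k * X a b c p.1 p.2) else 0), tsum_eq_sum (s := S)]
      · rw [M1Pair, ← mul_assoc, ← hw, Finset.mul_sum]
        exact Finset.sum_congr rfl fun k hk => if_pos hk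
      · intro k hk; exact if_neg hk
      · intro k hk
        have hkS : k ∈ S := by
          by_contra h; exact hk (if_neg h)
        have : 1 ≤ k := (Nat.one_le_ceil_iff.2 hpos).trans (Finset.mem_Icc.1 hkS).1
        exact ⟨⟨k, this⟩, rfl⟩
    · have : ∀ k : ℕ+, F (k, p) = 0 := by
        intro k
        refine indicator_of_notMem (fun h => ?_) _
        exact hX ((mem_M1Set_iff ha k p).1 h).1
      simp_rw [this, tsum_zero]
  have hprod := hs'.prod
  simp_rw [hinner] at hprod
  refine ⟨hprod, ?_⟩
  rw [hM, ← (Equiv.prodComm (ℕ+ × ℕ+) ℕ+).tsum_eq F]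
  have h3 : ∑' x : (ℕ+ × ℕ+) × ℕ+, F (Equiv.prodComm (ℕ+ × ℕ+) ℕ+ x) =
      ∑' p, ∑' m, F (m, p) := hs'.tsum_prod
  rw [h3]
  simp_rw [hinner]

lemma injective_nearest (a b c : ℝ) :
    Function.Injective fun p : ℕ+ × ℕ+ => ((nearest a b c p, p) : Triple) :=
  fun _ _ h => (Prod.ext_iff.1 h).2

lemma mem_range_nearest {a b c : ℝ} (ha : 0 < a) (hac : a < c) (hcb : c ≤ b) {n : Triple}
    (h : ((n.1 : ℕ) : ℤ) = N1 a b c n.2.1 n.2.2) :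
    n ∈ range fun p : ℕ+ × ℕ+ => ((nearest a b c p, p) : Triple) := by
  refine ⟨n.2, Prod.ext ?_ rfl⟩
  rw [← nearest_cast ha hac hcb n.2] at h
  exact (PNat.coe_injective (by exact_mod_cast h)).symm

/-- `J_{2,2}` as a sum over the pairs `(n₂, n₃)`: `n₁ = N₁` is determined by the pair, and the
condition `N_𝐧 ≤ T` is absorbed into the lower limit `min(N_𝐧, T)` of the integral. -/
lemma J22_eq_tsum_pair {a b c : ℝ} (ha : 0 < a) (hac : a < c) (hcb : c ≤ b) (T : ℝ) :
    Summable (fun p : ℕ+ × ℕ+ =>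
      if X a b c p.1 p.2 ≠ N1 a b c p.1 p.2 then J22Pair a b c T p else 0) ∧
    J22 a b c T = ∑' p : ℕ+ × ℕ+,
      if X a b c p.1 p.2 ≠ N1 a b c p.1 p.2 then J22Pair a b c T p else 0 := by
  classical
  set F : Triple → ℂ := (J22Set a b c T).indicator fun n => (((P n) ^ (-(1 / 2) : ℝ) : ℝ) : ℂ) *
    ∫ t in (Nn a b c n)..T, Complex.exp (Complex.I * t * L a b c n.2.1 n.2.2) with hF
  have hfin : (Function.support F).Finite :=
    ((finite_Nn_le ha hac hcb T).subset (J22Set_subset a b c T)).subset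
      (Set.support_indicator_subset)
  have hJ : J22 a b c T = ∑' n, F n :=
    tsum_subtype (J22Set a b c T) fun n => (((P n) ^ (-(1 / 2) : ℝ) : ℝ) : ℂ) *
      ∫ t in (Nn a b c n)..T, Complex.exp (Complex.I * t * L a b c n.2.1 n.2.2)
  have hs : Summable F := summable_of_hasFiniteSupport hfin
  have hcomp : ∀ p : ℕ+ × ℕ+, F (nearest a b c p, p) =
      if X a b c p.1 p.2 ≠ N1 a b c p.1 p.2 then J22Pair a b c T p else 0 := by
    intro p
    have hmem : (nearest a b c p, p) ∈ J22Set a b c T ↔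
        X a b c p.1 p.2 ≠ N1 a b c p.1 p.2 ∧ Nn a b c (nearest a b c p, p) ≤ T := by
      rw [J22Set, mem_ofPred_eq, mem_offDiagonal_iff ha, nearest_cast ha hac hcb]
      simp only [nearest_real ha hac hcb, true_and]
    simp only [hF, indicator_apply, hmem]
    by_cases h1 : X a b c p.1 p.2 ≠ N1 a b c p.1 p.2
    · rw [if_pos h1, J22Pair]
      by_cases h2 : Nn a b c (nearest a b c p, p) ≤ T
      · rw [if_pos ⟨h1, h2⟩, min_eq_left h2]
      · rw [if_neg (fun h => h2 h.2), min_eq_right (not_le.1 h2).le, intervalIntegral.integral_same,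
          mul_zero]
    · rw [if_neg h1, if_neg (fun h => h1 h.1)]
  have hsc := hs.comp_injective (injective_nearest a b c)
  simp only [Function.comp_def, hcomp] at hsc
  refine ⟨hsc, ?_⟩
  rw [hJ, ← (injective_nearest a b c).tsum_eq]
  · simp_rw [hcomp]
  · intro n hn
    have : n ∈ J22Set a b c T := Set.support_indicator_subset hn
    exact mem_range_nearest ha hac hcb this.2.1

/-- `I_{1,2}` splits into the terms with `n₁ = N₁`, indexed by pairs, and the remaining ones, given
here by a family `f` that is zero at the other triples. -/
lemma I12_eq_add {a b c : ℝ} (ha : 0 < a) (hac : a < c) (hcb : c ≤ b) (coef : ℕ → ℕ → ℂ)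
    {T : ℝ} (hT : 1 ≤ T) :
    Summable (fun p : ℕ+ × ℕ+ => if X a b c p.1 p.2 ≠ N1 a b c p.1 p.2 then
      I12Term a b c coef T (nearest a b c p, p) else 0) ∧
    ∃ f : Triple → ℂ,
      (∀ n, f n = 0 ∨ ((n.1 : ℕ) : ℤ) ≠ N1 a b c n.2.1 n.2.2 ∧ f n = I12Term a b c coef T n) ∧
      I12 a b c coef T = (∑' p : ℕ+ × ℕ+, if X a b c p.1 p.2 ≠ N1 a b c p.1 p.2 then
        I12Term a b c coef T (nearest a b c p, p) else 0) + ∑' n, f n := by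
  classical
  have hc : 0 < c := ha.trans hac
  have hb : 0 < b := hc.trans_le hcb
  have hsum := (summable_norm_I12Term ha hb hc coef hT).of_norm
  set D : Set Triple := {n | ((n.1 : ℕ) : ℤ) = N1 a b c n.2.1 n.2.2} with hD
  set F := (offDiagonal a b c).indicator (I12Term a b c coef T) with hF
  have hI : I12 a b c coef T = ∑' n, F n := tsum_subtype (offDiagonal a b c) _
  have hs : Summable F := hsum.indicator _
  have hcomp : ∀ p : ℕ+ × ℕ+, D.indicator F (nearest a b c p, p) =
      if X a b c p.1 p.2 ≠ N1 a b c p.1 p.2 then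
        I12Term a b c coef T (nearest a b c p, p) else 0 := by
    intro p
    rw [indicator_of_mem (show (nearest a b c p, p) ∈ D from nearest_cast ha hac hcb p), hF,
      indicator_apply, mem_offDiagonal_iff ha]
    simp only [nearest_real ha hac hcb]
  have hsc := (hs.indicator D).comp_injective (injective_nearest a b c)
  simp only [Function.comp_def, hcomp] at hsc
  refine ⟨hsc, Dᶜ.indicator F, fun n => ?_, ?_⟩
  · by_cases h1 : n ∈ D
    · exact Or.inl (indicator_of_notMem (by simpa using h1) _)
    · rw [indicator_of_mem (show n ∈ Dᶜ from h1), hF, indicator_apply]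
      split_ifs
      · exact Or.inr ⟨h1, rfl⟩
      · exact Or.inl rfl
  · have h1 : ∑' n, D.indicator F n = ∑' p : ℕ+ × ℕ+,
        if X a b c p.1 p.2 ≠ N1 a b c p.1 p.2 then
        I12Term a b c coef T (nearest a b c p, p) else 0 := by
      rw [← (injective_nearest a b c).tsum_eq]
      · simp_rw [hcomp]
      · intro n hn
        exact mem_range_nearest ha hac hcb (Set.support_indicator_subset hn : n ∈ D)
    rw [← h1, hI, ← (hs.indicator D).tsum_add (hs.indicator Dᶜ)]
    congr 1
    funext n
    exact (congrFun (indicator_self_add_compl D F) n).symm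

/-- The estimate of the theorem with the smaller error `errorBound`. -/
lemma exists_M1_add_J22_sub_I12_le {a b c : ℝ} (ha : 0 < a) (hac : a < c) (hcb : c ≤ b)
    (coef : ℕ → ℕ → ℂ) : ∃ C : ℝ, 0 ≤ C ∧ ∀ T : ℝ, 2 ≤ T →
      ‖M1 a b c T + J22 a b c T - I12 a b c coef T‖ ≤ C * errorBound a c T := by
  obtain ⟨C₁, hC₁, h₁⟩ := exists_tsum_far_le ha hac hcb coef
  obtain ⟨C₂, hC₂, h₂⟩ := exists_pair_estimate ha hac hcb coef
  obtain ⟨C₃, hC₃, h₃⟩ := exists_tsum_pairError_le ha hac hcb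
  refine ⟨C₂ * C₃ + C₁, by positivity, fun T hT => ?_⟩
  obtain ⟨sM, eM⟩ := M1_eq_tsum_pair ha hac hcb T
  obtain ⟨sJ, eJ⟩ := J22_eq_tsum_pair ha hac hcb T
  obtain ⟨sI, f, hf, eI⟩ := I12_eq_add ha hac hcb coef (by linarith : (1 : ℝ) ≤ T)
  obtain ⟨sE, hE⟩ := h₃ T hT
  have hfar := h₁ T f hT hf
  rw [eM, eJ, eI, ← sub_sub, ← sM.tsum_add sJ, ← (sM.add sJ).tsum_sub sI]
  refine (norm_sub_le _ _).trans ?_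
  have hnear := tsum_of_norm_bounded (f := fun p : ℕ+ × ℕ+ =>
    (if X a b c p.1 p.2 ≠ N1 a b c p.1 p.2 then M1Pair a b c T p else 0) +
    (if X a b c p.1 p.2 ≠ N1 a b c p.1 p.2 then J22Pair a b c T p else 0) -
    (if X a b c p.1 p.2 ≠ N1 a b c p.1 p.2 then
      I12Term a b c coef T (nearest a b c p, p) else 0)) (sE.mul_left C₂).hasSum fun p => by
    have hnn : 0 ≤ pairError a b c T p := by
      have hc : 0 < c := ha.trans hac
      have hP := P_pos (nearest a b c p, p)
      have hT0 : 0 < T := by linarith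
      have := cutoffSize_pos hT0 hP
      have := cutoffTime_pos ha (hc.trans_le hcb) hc hP
      have hpt : 0 ≤ pairTime b c p := (pairTime_pos hc p).le
      have m1 : 0 ≤ min (cutoffTime a b c (P (nearest a b c p, p))) T := by positivity
      have m2 : 0 ≤ min (pairTime b c p) T := le_min hpt hT0.le
      have m3 : 0 ≤ min (√(X a b c p.1 p.2)) (T / √(X a b c p.1 p.2)) := by positivity
      unfold pairError
      positivity
    by_cases hX : X a b c p.1 p.2 ≠ N1 a b c p.1 p.2
    · simp only [if_pos hX]
      exact h₂ T p (by linarith) hX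
    · simp only [if_neg hX]
      simpa using mul_nonneg hC₂ hnn
  rw [tsum_mul_left] at hnear
  have : C₂ * ∑' p, pairError a b c T p ≤ C₂ * (C₃ * errorBound a c T) := by gcongr
  linarith
end OffDiag

theorem mainTheorem4 (a b c : ℝ) (ha : 0 < a) (hac : a < c) (hcb : c ≤ b)
    (coef : ℕ → ℕ → ℂ) :
    (∀ x t : ℝ, 0 < x → 0 < t → MeasureTheory.Integrable
      (fun y : ℝ => OffDiag.W1Integrand a b c coef x t (1 + y * Complex.I))) ∧
    (∀ T : ℝ, 1 ≤ T → ∀ n : OffDiag.Triple, IntervalIntegrable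
      (OffDiag.I12Integrand a b c coef n) MeasureTheory.volume 1 T) ∧
    (∀ T : ℝ, 1 ≤ T → Summable
      (fun n : OffDiag.offDiagonal a b c => OffDiag.I12Term a b c coef T n)) ∧
    ∃ C : ℝ, ∀ T : ℝ, 2 ≤ T →
      ‖OffDiag.M1 a b c T + OffDiag.J22 a b c T - OffDiag.I12 a b c coef T‖ ≤
        C * (T ^ (1 / 4 + 3 * a / (2 * (a + c))) * Real.log T
          + T ^ (5 / 4 - c / (4 * a))
          + T ^ (1 / 2 + a / (2 * c)) * Real.log T
          + T ^ (3 / 4 : ℝ) * Real.log T ^ 3) := by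
  have hc : 0 < c := ha.trans hac
  have hb : 0 < b := hc.trans_le hcb
  refine ⟨fun x t hx ht => OffDiag.integrable_W1Integrand ha hb hc coef hx ht,
    fun T hT n => OffDiag.intervalIntegrable_I12Integrand ha hb hc coef hT n,
    fun T hT => (OffDiag.summable_norm_I12Term ha hb hc coef hT).of_norm.subtype _, ?_⟩
  obtain ⟨C, hC, h⟩ := OffDiag.exists_M1_add_J22_sub_I12_le ha hac hcb coef
  refine ⟨C, fun T hT => (h T hT).trans ?_⟩
  have hT0 : 0 < T := by linarith
  have hl0 : 0 ≤ Real.log T := Real.log_nonneg (by linarith)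
  have h1 : 0 ≤ T ^ (1 / 4 + 3 * a / (2 * (a + c))) * Real.log T := by positivity
  have h2 : 0 ≤ T ^ (1 / 2 + a / (2 * c)) * Real.log T := by positivity
  unfold OffDiag.errorBound
  gcongr
  linarith
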